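/- Let $\kappa,f>0$ and $r\ge 0$ (with facility cost $f$, outbound cost $\kappa f$ per unit area and distance, inbound cost $\kappa r f$ per distance). **Definitions.** For real $n\ge 3$ put $\bar\alpha(\alpha)=\frac{\pi-2\alpha}{n-2}$ and $$H(n,r,\alpha)=\sin\alpha\cos^2\bar\alpha\,\log\tan\left(\tfrac{\pi}{4}+\tfrac{\bar\alpha}{2}\right)-\cos^2\alpha\sin\bar\alpha\,\log\tan\left(\tfrac{\pi}{4}+\tfrac{\alpha}{2}\right)-r\sin 2\alpha\sin\bar\alpha-r(n-2)\cos\bar\alpha\sin^2\bar\alpha .$$ Let $\alpha^*=\alpha^*(n,r)$ be the root of $H(n,r,\cdot)$ in $[\frac{\pi}{n},\frac{\pi}{2})$ (unique by (1)), $\bar\alpha^*=\bar\alpha(\alpha^*)$, and $$g(n,r)=\frac{3\sin\bar\alpha^*\left(\sin 2\alpha^*+(n-2)\cos\bar\alpha^*\sin\bar\alpha^*\right)^{1/2}}{\sin\bar\alpha^*+\cos^2\bar\alpha^*\log\tan\left(\frac{\pi}{4}+\frac{\bar\alpha^*}{2}\right)+4r\sin\bar\alpha^*\cos\alpha^*}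 .$$ For an integer $n\ge 3$ consider cyclic $n$-gons of circumradius $R>0$ consisting of two isosceles triangles ("inbound") with apex angle $2\alpha$ at the circumcentre and $n-2$ isosceles triangles with apex angle $2\bar\alpha$ at the circumcentre, arranged in any order, where $(n-2)\bar\alpha+2\alpha=\pi$, $\bar\alpha>0$, $\frac{\pi}{n}\le\alpha<\frac{\pi}{2}$. If the area is $A$, i.e. $\frac{n-2}{2}R^2\sin 2\bar\alpha+R^2\sin 2\alpha=A$, its average cost is $$c(\alpha,\bar\alpha,R)=\frac1A\left[\tfrac{n-2}{3}\kappa fR^3\cos^3\bar\alpha\int_{-\bar\alpha}^{\bar\alpha}\frac{dt}{\cos^3t}+\tfrac23\kappa fR^3\cos^3\alpha\int_{-\alpha}^{\alpha}\frac{dt}{\cos^3t}+2\kappa rfAR\cos\alpha\right].$$ The $n$-gon is called *optimal* if $\alpha=\alpha^*(n,r)$ (hence $\bar\alpha=\bar\alpha^*$); its size is arbitrary. Given finitely many $n_i\geq 3$ and $A_i>0$, $i=1,\dots,N$, write $A=\sum_iA_i$, $\bar n=\frac1N\sum_i n_i$ and $$z_{ub}^*=3\sqrt[3]{\frac{\kappa^2f^3}{4g^2(6,r)}},\qquad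 a^*=\left(\tfrac{\kappa}{2}\right)^{-2/3}g(6,r)^{2/3}.$$ A partition of the plane is a family of polygons with pairwise disjoint interiors whose union is $\mathbb R^2$. A *layout* is an injective sequence $(x_i)_{i\ge1}$ in $\mathbb R^2$, locally finite, whose Voronoi cells $\mathcal A_i=\{y:\|y-x_i\|\le\|y-x_j\|\ \forall j\}$ cover the plane and are bounded. Its cost is, if the limit exists, $$\lim_{N\to\infty}\left\{\frac{f}{\sum_{i\le N}|\mathcal A_i|}\sum_{i\le N}\left(1+\kappa\int_{\mathcal A_i}\|y-x_i\|\,dy\right)+\frac{\kappa rf}{N}\sum_{i\le N}l_i\right\},\quad l_i=\tfrac12\left(\|x_i-x_{i-1}\|+\|x_i-x_{i+1}\|\right),$$ where the indices in $l_i$ are taken modulo $N$ (the closed tour $x_1,x_2,\dots,x_N,x_1$). The optimal cost is the infimum of the costs of all layouts for which the limit exists. **Statement.** 1. For every real $n\ge3$, $H(n,r,\cdot)$ has exactly one root in $[\frac{\pi}{n},\frac{\pi}{2})$, and $g(n,r)>0$. 2. For every integer $n\ge 3$ and $A>0$, the angles $\alpha^*,\bar\alpha^*$ together with $R^*=\sqrt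 A\,[(n-2)\sin\bar\alpha^*\cos\bar\alpha^*+\sin2\alpha^*]^{-1/2}$ are admissible for area $A$ and minimize $c$ among all admissible $(\alpha,\bar\alpha,R)$ of area $A$; the minimum is $\kappa f\sqrt A/g(n,r)$. 3. For all $N\ge1$, integers $n_i\ge3$ and $A_i>0$, $$\sum_{i=1}^N\frac{A_i^{3/2}}{A\,g(n_i,r)}\ \ge\ \frac{A^{1/2}}{\sqrt N\,g(\bar n,r)} .$$ 4. If optimal cyclic polygons with $n_i$ sides and areas $A_i$ ($i=1,\dots,N$) together with all their translates by some planar lattice form a partition of the plane ($N\ge1$ polygons per period), then $$\sum_{i=1}^N\frac{A_i^{3/2}}{A\,g(n_i,r)}\ge\frac{A^{1/2}}{\sqrt N\,g(\bar n,r)}\ge\frac{A^{1/2}}{\sqrt N\,g(6,r)},\qquad \frac{Nf}{A}+\sum_{i=1}^N\frac{\kappa fA_i^{3/2}}{A\,g(n_i,r)}\ge z_{ub}^* .$$ 5. Let optimal cyclic polygons form any partition of the plane, with areas bounded and bounded away from $0$. For every $\varepsilon>0$ and all sufficiently large $\rho$, the set of polygons contained in the disc of radius $\rho$ about the origin is finite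 and non-empty, and, with $N,n_i,A_i,A,\bar n$ referring to these polygons, $$\sum_{i}\frac{A_i^{3/2}}{A\,g(n_i,r)}\ge\frac{A^{1/2}}{\sqrt N\,g(\bar n,r)}\ge(1-\varepsilon)\frac{A^{1/2}}{\sqrt N\,g(6,r)},\qquad \frac{Nf}{A}+\sum_{i}\frac{\kappa fA_i^{3/2}}{A\,g(n_i,r)}\ge(1-\varepsilon)z_{ub}^* .$$ 6. For all $N\ge 1$ and $A_i>0$: if $n_i=6$ for all $i$, then $\frac{A^{1/2}}{\sqrt N g(\bar n,r)}=\frac{A^{1/2}}{\sqrt N g(6,r)}$; if moreover all $A_i$ are equal, then $\sum_i\frac{A_i^{3/2}}{A g(n_i,r)}=\frac{A^{1/2}}{\sqrt N g(6,r)}$; and if $n_i=6$ and $A_i=a^*$ for all $i$, then $\frac{Nf}{A}+\sum_i\frac{\kappa fA_i^{3/2}}{Ag(n_i,r)}=z_{ub}^*$. 7. There is a layout whose Voronoi cells are translates of a single optimal cyclic hexagon of area $a^*$ (circumcentres at the facilities, the two inbound triangles opposite to each other) and whose cost exists and equals $z_{ub}^*$. The set of costs of layouts is bounded below, and the optimal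 cost is at most $z_{ub}^*$. -/

import Mathlib

namespace Transshipment

noncomputable section

/-- The Euclidean plane. -/
abbrev Plane : Type := EuclideanSpace ℝ (Fin 2)

/-- Area of a region of the plane (Lebesgue measure). -/
def area (S : Set Plane) : ℝ := (MeasureTheory.volume S).toReal

/-! ### The optimal basic angles and the function `g` -/

/-- The half basic angle of the `n - 2` remaining basic triangles when the two inbound basic
triangles have half basic angle `α`, i.e. the solution `β` of `(n - 2) β + 2 α = π`. -/
def otherAngle (n α : ℝ) : ℝ := (Real.pi - 2 * α) / (n - 2)

/-- The function `H(n, r, α)`. -/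
def H (n r α : ℝ) : ℝ :=
  Real.sin α * Real.cos (otherAngle n α) ^ 2 *
      Real.log (Real.tan (Real.pi / 4 + otherAngle n α / 2))
    - Real.cos α ^ 2 * Real.sin (otherAngle n α) * Real.log (Real.tan (Real.pi / 4 + α / 2))
    - r * Real.sin (2 * α) * Real.sin (otherAngle n α)
    - r * (n - 2) * Real.cos (otherAngle n α) * Real.sin (otherAngle n α) ^ 2

/-- The roots of `H(n, r, ·)` in `[π / n, π / 2)`. -/
def rootSet (n r : ℝ) : Set ℝ := {α | α ∈ Set.Ico (Real.pi / n) (Real.pi / 2) ∧ H n r α = 0}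

/-- `α*(n, r)`: the root of `H(n, r, ·)` in `[π / n, π / 2)` (there is exactly one for `n ≥ 3`
and `r ≥ 0`, which is part of the main statement). -/
def alphaStar (n r : ℝ) : ℝ := sInf (rootSet n r)

/-- The optimal half basic angle of the `n - 2` triangles without inbound traffic. -/
def betaStar (n r : ℝ) : ℝ := otherAngle n (alphaStar n r)

/-- The function `g(n, r)`, for real `n`. -/
def g (n r : ℝ) : ℝ :=
  3 * Real.sin (betaStar n r) *
      √(Real.sin (2 * alphaStar n r)
        + (n - 2) * Real.cos (betaStar n r) * Real.sin (betaStar n r)) /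
    (Real.sin (betaStar n r)
      + Real.cos (betaStar n r) ^ 2 * Real.log (Real.tan (Real.pi / 4 + betaStar n r / 2))
      + 4 * r * Real.sin (betaStar n r) * Real.cos (alphaStar n r))

/-- The radius of the `n`-sided cyclic polygon of area `A` with the optimal basic angles. -/
def radiusStar (n r A : ℝ) : ℝ :=
  √A / √((n - 2) * Real.sin (betaStar n r) * Real.cos (betaStar n r)
    + Real.sin (2 * alphaStar n r))

/-! ### Cyclic polygons -/

/-- Admissible parameters `(α, β, R)` of an `n`-sided cyclic polygon of area `A` with two inbound
basic triangles (angle `2 α`) and `n - 2` other ones (angle `2 β`). -/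
structure IsAdmissible (n : ℕ) (A α β R : ℝ) : Prop where
  angle_mem : α ∈ Set.Ico (Real.pi / n) (Real.pi / 2)
  other_pos : 0 < β
  angle_sum : ((n : ℝ) - 2) * β + 2 * α = Real.pi
  radius_pos : 0 < R
  area_eq : ((n : ℝ) - 2) / 2 * R ^ 2 * Real.sin (2 * β) + R ^ 2 * Real.sin (2 * α) = A

/-- Average (per unit area) outbound and inbound cost of such a cyclic polygon. -/
def regionCost (κ f r : ℝ) (n : ℕ) (A α β R : ℝ) : ℝ :=
  1 / A *
    (1 / 3 * ((n : ℝ) - 2) * κ * f * R ^ 3 * Real.cos β ^ 3 * (∫ t in (-β)..β, 1 / Real.cos t ^ 3)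
      + 2 / 3 * κ * f * R ^ 3 * Real.cos α ^ 3 * (∫ t in (-α)..α, 1 / Real.cos t ^ 3)
      + 2 * κ * r * f * A * R * Real.cos α)

/-- The polygon inscribed in the circle of centre `p` and radius `R` whose `k`-th side is seen
from `p` under the angle `2 * β k`, the first vertex being in direction `φ`. -/
def cyclicPolygon {n : ℕ} (p : Plane) (R φ : ℝ) (β : Fin n → ℝ) : Set Plane :=
  convexHull ℝ (Set.range fun k : Fin n =>
    p + R • (!₂[Real.cos (φ + 2 * ∑ i ∈ Finset.Iio k, β i),
      Real.sin (φ + 2 * ∑ i ∈ Finset.Iio k, β i)] : Plane))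

/-- The optimal half basic angles, the two inbound triangles being in positions `j` and `k`. -/
def optimalAngles (r : ℝ) (n : ℕ) (j k : Fin n) : Fin n → ℝ :=
  fun i => if i = j ∨ i = k then alphaStar n r else betaStar n r

/-- `S` is an `n`-sided cyclic polygon with two inbound basic triangles (in any two positions) and
`n - 2` other ones, with the optimal basic angles. Its size is arbitrary. -/
def IsOptimalCyclicPolygon (r : ℝ) (n : ℕ) (S : Set Plane) : Prop :=
  ∃ (p : Plane) (R φ : ℝ) (j k : Fin n), 0 < R ∧ j ≠ k ∧
    S = cyclicPolygon p R φ (optimalAngles r n j k)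

/-- The sets `P i` cover the plane and have pairwise disjoint interiors. -/
def IsPlanePartition {ι : Type} (P : ι → Set Plane) : Prop :=
  (⋃ i, P i) = Set.univ ∧ Pairwise fun i j => Disjoint (interior (P i)) (interior (P j))

/-! ### Averaged costs over finitely many polygons -/

/-- `∑ A_i ^ (3/2) / (A g(n_i, r))` with `A = ∑ A_i`, over the finite index set `T`. -/
def averagedCost {ι : Type} (r : ℝ) (T : Finset ι) (n : ι → ℕ) (a : ι → ℝ) : ℝ :=
  ∑ i ∈ T, a i ^ (3 / 2 : ℝ) / ((∑ j ∈ T, a j) * g (n i) r)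

/-- `A ^ (1/2) / (√N g(x, r))` with `A = ∑ A_i` and `N` the number of polygons. -/
def costBound {ι : Type} (r : ℝ) (T : Finset ι) (a : ι → ℝ) (x : ℝ) : ℝ :=
  √(∑ i ∈ T, a i) / (√(T.card : ℝ) * g x r)

/-- The average number of sides `∑ n_i / N`. -/
def meanSides {ι : Type} (T : Finset ι) (n : ι → ℕ) : ℝ := (∑ i ∈ T, (n i : ℝ)) / (T.card : ℝ)

/-- The average total cost per unit area `N f / A + ∑ κ f A_i ^ (3/2) / (A g(n_i, r))`. -/
def totalCost {ι : Type} (κ f r : ℝ) (T : Finset ι) (n : ι → ℕ) (a : ι → ℝ) : ℝ :=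
  (T.card : ℝ) * f / (∑ i ∈ T, a i)
    + ∑ i ∈ T, κ * f * a i ^ (3 / 2 : ℝ) / ((∑ j ∈ T, a j) * g (n i) r)

/-- `z_ub* = 3 (κ² f³ / (4 g(6, r)²)) ^ (1/3)`. -/
def zUb (κ f r : ℝ) : ℝ := 3 * (κ ^ 2 * f ^ 3 / (4 * g 6 r ^ 2)) ^ (1 / 3 : ℝ)

/-- The area `(κ / 2) ^ (-2/3) g(6, r) ^ (2/3)` of the optimal cyclic hexagon. -/
def hexArea (κ r : ℝ) : ℝ := (κ / 2) ^ (-(2 / 3) : ℝ) * g 6 r ^ (2 / 3 : ℝ)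

/-! ### The layout problem -/

/-- The service region of facility `i`: its Voronoi cell. -/
def serviceRegion (x : ℕ → Plane) (i : ℕ) : Set Plane := {y | ∀ j, ‖y - x i‖ ≤ ‖y - x j‖}

/-- An infinite facility layout, indexed along the inbound tour. -/
structure IsLayout (x : ℕ → Plane) : Prop where
  injective : Function.Injective x
  locallyFinite : ∀ ρ : ℝ, {i | ‖x i‖ ≤ ρ}.Finite
  covers : (⋃ i, serviceRegion x i) = Set.univ
  bounded : ∀ i, Bornology.IsBounded (serviceRegion x i)

/-- Inbound distance within the region of facility `i` on the closed tour
`x 0, x 1, …, x (N - 1), x 0` (indices modulo `N`). -/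
def inboundLength (x : ℕ → Plane) (N i : ℕ) : ℝ :=
  1 / 2 * (‖x i - x ((i + N - 1) % N)‖ + ‖x i - x ((i + 1) % N)‖)

/-- Average set-up, outbound and inbound cost of the first `N` facilities. -/
def layoutCost (κ f r : ℝ) (x : ℕ → Plane) (N : ℕ) : ℝ :=
  f / (∑ i ∈ Finset.range N, area (serviceRegion x i)) *
      (∑ i ∈ Finset.range N, (1 + κ * ∫ y in serviceRegion x i, ‖y - x i‖))
    + κ * r * f / (N : ℝ) * ∑ i ∈ Finset.range N, inboundLength x N i

/-- The limiting average costs of layouts (those for which the limit exists). -/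
def achievableCosts (κ f r : ℝ) : Set ℝ :=
  {z | ∃ x : ℕ → Plane, IsLayout x ∧
    Filter.Tendsto (layoutCost κ f r x) Filter.atTop (nhds z)}

/-- The optimal cost of the layout problem. -/
def optimalCost (κ f r : ℝ) : ℝ := sInf (achievableCosts κ f r)

end

end Transshipment

open Transshipment

/-!
For a cyclic polygon with half angles `α, α, β, …, β` the cost per unit area at fixed area depends
only on `α`, through the scale invariant `quality n r α`, the cube of the area over the square of
the cost. The derivative of `quality` in `α` has the sign of `-H` (`hasDerivAt_quality`), and `H` is
a positive multiple of `psi`, which increases in `α` and decreases in `β`; both monotonicities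
reduce to `wfun`, `sig` and `wfun / sig` being decreasing. So `H` has a single root
(`existsUnique_root`), the quality is largest there, and its maximum is `g²` (`g_sq`,
`quality_le`), which gives `le_regionCost`.

By the envelope theorem the derivative of `g²` in `n` is `rho³ · defect(β*)` (`hasDerivAt_g_sq`).
It is positive and decreases with `n`, since both optimal angles do. Hence `g²` is concave and
increasing, and Hölder's and Jensen's inequalities yield `costBound_le_averagedCost`.

For tilings it remains to show that the mean number of sides is at most six, up to a boundary term.
No edge-to-edge assumption is available, so this is done by local areas instead of Euler's formula.
At a point `v` that is a vertex of `k` tiles, each of these fills less than half of a small disc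
about `v`, in proportion to its angle, while a tile containing `v` without having it as a vertex
fills exactly half. Hence the `k` angles add up to `2 π` with `k ≥ 3`, or to `π` with `k ≥ 2`, and
in either case to at most `2 π k / 3` (`IsRoundTiling.sum_angles_le`). Summing the angle sums
`(n_i - 2) π` of the polygons gives `∑ (n_i - 6) ≤ 0`, except for the polygons touching one outside
the family (`IsRoundTiling.sum_card_sub_six_le`). Two tiles share at most two vertices, so the
number of sides is bounded, and for large boxes or discs the boundary term is of lower order.

The cyclic hexagon with two opposite inbound triangles is centrally symmetric, and its translates by
a lattice are the Voronoi cells of the lattice points (`mem_hexagon_iff`,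
`hexagon_eq_cyclicPolygon`). Its area and first moment are computed in polar coordinates. Neighbours
in a lattice row have the minimal distance `2 R cos α`, which is the inbound distance of the optimal
polygon. The lattice is enumerated by sweeping the rows of rectangles which grow by doubling, so
that the steps other than those between horizontal neighbours, and the closing edge, contribute only
`O(√N)` to the tour through the first `N` points (`tendsto_inboundLength`).
-/

namespace Transshipment
open Real Set Filter Topology

/-! ### The one-variable functions behind `H` -/

/-- The inverse Gudermannian `log tan (π / 4 + θ / 2)`, an antiderivative of `1 / cos`. -/
noncomputable def gdInv (θ : ℝ) : ℝ := log (tan (π / 4 + θ / 2))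

/-- `w(θ) = cos² θ · gdInv θ / sin θ`. It equals `3 m(θ) / (sin θ cos θ) - 1`, where `m(θ)` is
the first moment about its apex of the triangle with apex angle `2 θ` and legs `1`. -/
noncomputable def wfun (θ : ℝ) : ℝ := cos θ ^ 2 * gdInv θ / sin θ

/-- `σ(θ) = sin θ cos θ / θ`: the ratio of the areas of a basic triangle and of its circular
sector. -/
noncomputable def sig (θ : ℝ) : ℝ := sin θ * cos θ / θ

lemma sin_pos_of_mem {θ : ℝ} (h : θ ∈ Ioo 0 (π / 2)) : 0 < sin θ :=
  sin_pos_of_pos_of_lt_pi h.1 (by linarith [h.2, pi_pos])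

lemma cos_pos_of_mem {θ : ℝ} (h : θ ∈ Ioo 0 (π / 2)) : 0 < cos θ :=
  cos_pos_of_mem_Ioo ⟨by linarith [h.1, pi_pos], h.2⟩

lemma hasDerivAt_gdInv {θ : ℝ} (h : θ ∈ Ioo (-(π / 2)) (π / 2)) :
    HasDerivAt gdInv (1 / cos θ) θ := by
  have hpi := pi_pos
  have hc : 0 < cos (π / 4 + θ / 2) :=
    cos_pos_of_mem_Ioo ⟨by linarith [h.1], by linarith [h.2]⟩
  have hs : 0 < sin (π / 4 + θ / 2) :=
    sin_pos_of_pos_of_lt_pi (by linarith [h.1]) (by linarith [h.2])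
  have h1 : HasDerivAt (fun x : ℝ => π / 4 + x / 2) (1 / 2) θ :=
    ((hasDerivAt_id θ).div_const 2).const_add _
  have h2 := (Real.hasDerivAt_tan hc.ne').comp θ h1
  have ht : tan (π / 4 + θ / 2) ≠ 0 := by rw [tan_eq_sin_div_cos]; positivity
  have h3 := h2.log ht
  refine h3.congr_deriv ?_
  have e : cos θ = 2 * sin (π / 4 + θ / 2) * cos (π / 4 + θ / 2) := by
    rw [← sin_two_mul, ← sin_pi_div_two_sub, ← sin_pi_sub]; congr 1; ring
  simp only [Function.comp]
  rw [e, tan_eq_sin_div_cos]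
  field_simp

lemma gdInv_zero : gdInv 0 = 0 := by simp [gdInv]

lemma gdInv_neg (θ : ℝ) : gdInv (-θ) = -gdInv θ := by
  unfold gdInv
  rw [← log_inv, ← tan_pi_div_two_sub]
  congr 2; ring

lemma exp_gdInv_eq {θ : ℝ} (h : θ ∈ Ioo 0 (π / 2)) : gdInv θ = log ((1 + sin θ) / cos θ) := by
  have hpi := pi_pos
  have hc : 0 < cos (π / 4 + θ / 2) :=
    cos_pos_of_mem_Ioo ⟨by linarith [h.1], by linarith [h.2]⟩
  have hs : 0 < sin (π / 4 + θ / 2) :=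
    sin_pos_of_pos_of_lt_pi (by linarith [h.1]) (by linarith [h.2])
  have e : cos θ = 2 * sin (π / 4 + θ / 2) * cos (π / 4 + θ / 2) := by
    rw [← sin_two_mul, ← sin_pi_div_two_sub, ← sin_pi_sub]; congr 1; ring
  have e' : sin θ = 2 * sin (π / 4 + θ / 2) ^ 2 - 1 := by
    rw [← cos_pi_div_two_sub, ← cos_neg]
    have : -(π / 2 - θ) = 2 * (π / 4 + θ / 2) - π := by ring
    rw [this, cos_sub_pi, cos_two_mul, cos_sq']; ring
  unfold gdInv
  rw [tan_eq_sin_div_cos]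
  congr 1
  rw [div_eq_div_iff hc.ne' (by rw [e]; positivity), e', e]; ring

/-- The truncated series `artanh s = s + s³ / 3 + s⁵ / 5 + ⋯` at `s = sin θ`. -/
lemma gdInv_lower {θ : ℝ} (h : θ ∈ Ico 0 (π / 2)) :
    sin θ + sin θ ^ 3 / 3 + sin θ ^ 5 / 5 ≤ gdInv θ := by
  have key : MonotoneOn (fun x => gdInv x - (sin x + sin x ^ 3 / 3 + sin x ^ 5 / 5))
      (Ico 0 (π / 2)) := by
    have hd : ∀ x ∈ Ico 0 (π / 2), HasDerivAt
        (fun x => gdInv x - (sin x + sin x ^ 3 / 3 + sin x ^ 5 / 5)) (sin x ^ 6 / cos x) x := by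
      intro x hx
      have hc : 0 < cos x := cos_pos_of_mem_Ioo ⟨by linarith [hx.1, pi_pos], hx.2⟩
      have h1 := hasDerivAt_gdInv (θ := x) ⟨by linarith [hx.1, pi_pos], hx.2⟩
      have h2 := hasDerivAt_sin x
      refine (h1.sub ((h2.add ((h2.pow 3).div_const 3)).add ((h2.pow 5).div_const 5))).congr_deriv
        ?_
      field_simp
      push_cast
      have := sin_sq_add_cos_sq x
      have e : cos x ^ 2 = 1 - sin x ^ 2 := by linarith
      simp only [e]
      ring
    refine monotoneOn_of_deriv_nonneg (convex_Ico _ _)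
      (fun x hx => (hd x hx).continuousAt.continuousWithinAt)
      (fun x hx => (hd x (interior_subset hx)).differentiableAt.differentiableWithinAt) ?_
    intro x hx
    have hx' := interior_subset hx
    rw [(hd x hx').deriv]
    have hc : 0 < cos x := cos_pos_of_mem_Ioo ⟨by linarith [hx'.1, pi_pos], hx'.2⟩
    have : 0 ≤ sin x ^ 6 := by rw [show sin x ^ 6 = (sin x ^ 3) ^ 2 by ring]; positivity
    positivity
  have := key (left_mem_Ico.2 (by positivity)) h h.1
  simp [gdInv_zero] at this
  linarith

lemma sin_lt_gdInv {θ : ℝ} (h : θ ∈ Ioo 0 (π / 2)) : sin θ < gdInv θ := by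
  have hs := sin_pos_of_mem h
  have := gdInv_lower ⟨h.1.le, h.2⟩
  have h3 : 0 < sin θ ^ 3 / 3 := by positivity
  have h5 : 0 < sin θ ^ 5 / 5 := by positivity
  linarith

lemma gdInv_pos {θ : ℝ} (h : θ ∈ Ioo 0 (π / 2)) : 0 < gdInv θ :=
  (sin_pos_of_mem h).trans (sin_lt_gdInv h)

lemma wfun_pos {θ : ℝ} (h : θ ∈ Ioo 0 (π / 2)) : 0 < wfun θ := by
  have := sin_pos_of_mem h; have := cos_pos_of_mem h; have := gdInv_pos h
  unfold wfun; positivity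

lemma cos_sq_le_wfun {θ : ℝ} (h : θ ∈ Ioo 0 (π / 2)) : cos θ ^ 2 ≤ wfun θ := by
  have := sin_pos_of_mem h; have := cos_pos_of_mem h
  unfold wfun
  rw [le_div_iff₀ (by positivity)]
  have := sin_lt_gdInv h
  gcongr

lemma sin_mul_wfun_le {θ : ℝ} (h : θ ∈ Ioo 0 (π / 2)) : sin θ * wfun θ ≤ 2 * cos θ := by
  have hs := sin_pos_of_mem h; have hc := cos_pos_of_mem h
  have e : sin θ * wfun θ = cos θ ^ 2 * gdInv θ := by unfold wfun; field_simp
  have h1 : gdInv θ ≤ (1 + sin θ) / cos θ := by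
    rw [exp_gdInv_eq h]
    have := log_le_sub_one_of_pos (x := (1 + sin θ) / cos θ) (by positivity)
    linarith
  rw [e]
  calc cos θ ^ 2 * gdInv θ ≤ cos θ ^ 2 * ((1 + sin θ) / cos θ) := by gcongr
    _ = cos θ * (1 + sin θ) := by field_simp
    _ ≤ cos θ * 2 := by gcongr; linarith [sin_le_one θ]
    _ = _ := by ring

/-- The derivative of `w`, in the form in which it is used. -/
lemma hasDerivAt_wfun {θ : ℝ} (h : θ ∈ Ioo 0 (π / 2)) :
    HasDerivAt wfun (cos θ / sin θ ^ 2 * (sin θ - gdInv θ * (1 + sin θ ^ 2))) θ := by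
  have hs := sin_pos_of_mem h; have hc := cos_pos_of_mem h
  have h1 := hasDerivAt_gdInv (θ := θ) ⟨by linarith [h.1, pi_pos], h.2⟩
  refine ((((hasDerivAt_cos θ).pow 2).mul h1).div (hasDerivAt_sin θ) hs.ne').congr_deriv ?_
  simp only [Pi.mul_apply, Pi.pow_apply]
  field_simp
  push_cast
  have e : cos θ ^ 2 = 1 - sin θ ^ 2 := by linarith [sin_sq_add_cos_sq θ]
  linear_combination (-(cos θ * gdInv θ)) * e

lemma deriv_wfun_neg {θ : ℝ} (h : θ ∈ Ioo 0 (π / 2)) :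
    cos θ / sin θ ^ 2 * (sin θ - gdInv θ * (1 + sin θ ^ 2)) < 0 := by
  have hs := sin_pos_of_mem h; have hc := cos_pos_of_mem h
  have h1 := sin_lt_gdInv h
  refine mul_neg_of_pos_of_neg (by positivity) ?_
  nlinarith [mul_pos (gdInv_pos h) (pow_pos hs 2)]

lemma strictAntiOn_wfun : StrictAntiOn wfun (Ioo 0 (π / 2)) := by
  refine strictAntiOn_of_deriv_neg (convex_Ioo _ _)
    (fun x hx => (hasDerivAt_wfun hx).continuousAt.continuousWithinAt) fun x hx => ?_
  rw [interior_Ioo] at hx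
  rw [(hasDerivAt_wfun hx).deriv]
  exact deriv_wfun_neg hx

lemma sin_mul_cos_lt {θ : ℝ} (h : 0 < θ) : sin θ * cos θ < θ := by
  have := sin_lt (x := 2 * θ) (by linarith)
  rw [sin_two_mul] at this; linarith

lemma sig_pos {θ : ℝ} (h : θ ∈ Ioo 0 (π / 2)) : 0 < sig θ := by
  have := sin_pos_of_mem h; have := cos_pos_of_mem h; have := h.1
  unfold sig; positivity

lemma hasDerivAt_sig {θ : ℝ} (h : 0 < θ) :
    HasDerivAt sig ((θ * (cos θ ^ 2 - sin θ ^ 2) - sin θ * cos θ) / θ ^ 2) θ := by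
  refine (((hasDerivAt_sin θ).mul (hasDerivAt_cos θ)).div (hasDerivAt_id θ) h.ne').congr_deriv ?_
  simp only [Pi.mul_apply, id]; ring

lemma mul_cos_lt_sin {x : ℝ} (h : x ∈ Ioo 0 π) : x * cos x < sin x := by
  rcases lt_or_ge x (π / 2) with h2 | h2
  · have hc := cos_pos_of_mem ⟨h.1, h2⟩
    have := lt_tan h.1 h2
    rw [tan_eq_sin_div_cos, lt_div_iff₀ hc] at this
    exact this
  · have hc : cos x ≤ 0 := cos_nonpos_of_pi_div_two_le_of_le h2 (by linarith [h.2, pi_pos])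
    have := sin_pos_of_pos_of_lt_pi h.1 h.2
    nlinarith [h.1]

lemma strictAntiOn_sig : StrictAntiOn sig (Ioo 0 (π / 2)) := by
  refine strictAntiOn_of_deriv_neg (convex_Ioo _ _)
    (fun x hx => (hasDerivAt_sig hx.1).continuousAt.continuousWithinAt) fun x hx => ?_
  rw [interior_Ioo] at hx
  rw [(hasDerivAt_sig hx.1).deriv]
  have := mul_cos_lt_sin (x := 2 * x) ⟨by linarith [hx.1], by linarith [hx.2]⟩
  rw [cos_two_mul', sin_two_mul] at this
  have h0 := hx.1
  exact div_neg_of_neg_of_pos (by linarith) (by positivity)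

/-- The Cusa-Huygens inequality. -/
lemma three_mul_sin_le {θ : ℝ} (h : θ ∈ Icc 0 (π / 2)) : 3 * sin θ ≤ θ * (2 + cos θ) := by
  have key : MonotoneOn (fun x => x * (2 + cos x) - 3 * sin x) (Icc 0 (π / 2)) := by
    have hd : ∀ x, HasDerivAt (fun x => x * (2 + cos x) - 3 * sin x)
        (2 - 2 * cos x - x * sin x) x := by
      intro x
      refine (((hasDerivAt_id x).mul ((hasDerivAt_cos x).const_add 2)).sub
        ((hasDerivAt_sin x).const_mul 3)).congr_deriv ?_
      simp only [id]; ring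
    refine monotoneOn_of_deriv_nonneg (convex_Icc _ _)
      (fun x _ => (hd x).continuousAt.continuousWithinAt)
      (fun x _ => (hd x).differentiableAt.differentiableWithinAt) fun x hx => ?_
    rw [interior_Icc] at hx
    rw [(hd x).deriv]
    have h1 := mul_cos_lt_sin (x := x / 2) ⟨by linarith [hx.1], by linarith [hx.2, pi_pos]⟩
    have hs : 0 < sin (x / 2) := sin_pos_of_mem ⟨by linarith [hx.1], by linarith [hx.2, hx.1]⟩
    have e1 : cos x = 1 - 2 * sin (x / 2) ^ 2 := by
      have := cos_two_mul' (x / 2)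
      rw [show 2 * (x / 2) = x by ring] at this
      rw [this]; linarith [sin_sq_add_cos_sq (x / 2)]
    have e2 : sin x = 2 * sin (x / 2) * cos (x / 2) := by
      rw [← sin_two_mul]; congr 1; ring
    rw [e1, e2]
    nlinarith
  have := key (left_mem_Icc.2 (by positivity)) h h.1
  simp at this
  linarith

/-- `w / σ = θ cos θ gdInv θ / sin² θ` is decreasing. This is what makes the two monotonicities of
`psi` compatible. -/
lemma antitoneOn_wfun_div_sig : AntitoneOn (fun θ => wfun θ / sig θ) (Ioo 0 (π / 2)) := by
  have e : ∀ x ∈ Ioo 0 (π / 2), x * cos x * gdInv x / sin x ^ 2 = wfun x / sig x := by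
    intro x hx
    have hs := sin_pos_of_mem hx; have hc := cos_pos_of_mem hx; have h0 := hx.1
    unfold wfun sig
    field_simp
  suffices AntitoneOn (fun x => x * cos x * gdInv x / sin x ^ 2) (Ioo 0 (π / 2)) from this.congr e
  have hd : ∀ x ∈ Ioo 0 (π / 2), HasDerivAt (fun x => x * cos x * gdInv x / sin x ^ 2)
      (((cos x * gdInv x - x * sin x * gdInv x + x) * sin x - 2 * x * cos x ^ 2 * gdInv x)
        / sin x ^ 3) x := by
    intro x hx
    have hs := sin_pos_of_mem hx; have hc := cos_pos_of_mem hx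
    have h1 := hasDerivAt_gdInv (θ := x) ⟨by linarith [hx.1, pi_pos], hx.2⟩
    refine ((((hasDerivAt_id x).mul (hasDerivAt_cos x)).mul h1).div
      ((hasDerivAt_sin x).pow 2) (pow_ne_zero 2 hs.ne')).congr_deriv ?_
    simp only [Pi.mul_apply, Pi.pow_apply, id]
    field_simp
    push_cast
    ring
  refine antitoneOn_of_deriv_nonpos (convex_Ioo _ _)
    (fun x hx => (hd x hx).continuousAt.continuousWithinAt)
    (fun x hx => (hd x (interior_subset hx)).differentiableAt.differentiableWithinAt) fun x hx => ?_
  rw [interior_Ioo] at hx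
  rw [(hd x hx).deriv]
  have hs := sin_pos_of_mem hx; have hc := cos_pos_of_mem hx; have h0 := hx.1
  refine div_nonpos_of_nonpos_of_nonneg ?_ (by positivity)
  have hL := gdInv_lower ⟨hx.1.le, hx.2⟩
  have hC := three_mul_sin_le ⟨hx.1.le, hx.2.le⟩
  have hLp := gdInv_pos hx
  have hsc : sin x ^ 2 = 1 - cos x ^ 2 := by linarith [sin_sq_add_cos_sq x]
  have hc1 := cos_le_one x
  -- the terms without `θ` are estimated by the Cusa-Huygens inequality
  have h1 : 3 * (cos x * gdInv x * sin x) ≤ x * (2 + cos x) * (cos x * gdInv x) := by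
    nlinarith [mul_pos hc hLp]
  set c := cos x with hcdef
  set s := sin x with hsdef
  -- the remaining factor of `θ` by the truncated series for `gdInv`
  have h2 : s ≤ gdInv x * (1 + c ^ 2 - (2 + c) * c / 3) := by
    have hp : 0 ≤ 1 + c ^ 2 - (2 + c) * c / 3 := by nlinarith
    refine le_trans ?_ (mul_le_mul_of_nonneg_right hL hp)
    have e1 : s + s ^ 3 / 3 + s ^ 5 / 5 = s * (1 + s ^ 2 / 3 + (s ^ 2) ^ 2 / 5) := by ring
    rw [e1, hsc]
    have h3 : 1 ≤ (1 + (1 - c ^ 2) / 3 + (1 - c ^ 2) ^ 2 / 5) * (1 + c ^ 2 - (2 + c) * c / 3) := by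
      have h4 : 0 ≤ (1 - c) ^ 2 * (31 - 30 * (1 - c) + (1 - c) ^ 2 * (47 - 30 * (1 - c))
          + 6 * (1 - c) ^ 4) := by
        have : 0 ≤ 31 - 30 * (1 - c) := by linarith
        have : 0 ≤ 47 - 30 * (1 - c) := by linarith
        positivity
      linear_combination h4 / 45
    nlinarith
  have h5 := mul_le_mul_of_nonneg_left h2 h0.le
  linear_combination h1 / 3 + h5 - x * gdInv x * hsc

/-! ### The root of `H` -/

/-- `H(n, r, α)` up to a positive factor, as a function of the two half angles `α` and `β`. -/
noncomputable def psi (r α β : ℝ) : ℝ :=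
  (wfun β - wfun α - 2 * r * cos α) / sig β - r * (π - 2 * α) / sin α

lemma psi_lt_psi_left {r α α' β : ℝ} (hr : 0 ≤ r) (hα : α ∈ Ioo 0 (π / 2))
    (hα' : α' ∈ Ioo 0 (π / 2)) (hβ : β ∈ Ioo 0 (π / 2)) (h : α < α') :
    psi r α β < psi r α' β := by
  have h1 := strictAntiOn_wfun hα hα' h
  have h2 : cos α' < cos α := cos_lt_cos_of_nonneg_of_le_pi_div_two hα.1.le hα'.2.le h
  have h3 : sin α < sin α' :=
    sin_lt_sin_of_lt_of_le_pi_div_two (by linarith [hα.1, pi_pos]) hα'.2.le h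
  have hs := sin_pos_of_mem hα
  have hσ := sig_pos hβ
  have h4 : r * (π - 2 * α') / sin α' ≤ r * (π - 2 * α) / sin α := by
    have : 0 ≤ r * (π - 2 * α) := mul_nonneg hr (by linarith [hα.2])
    gcongr
  have h5 : 2 * r * cos α' ≤ 2 * r * cos α := by gcongr
  have h6 : (wfun β - wfun α - 2 * r * cos α) / sig β
      < (wfun β - wfun α' - 2 * r * cos α') / sig β := by
    gcongr ?_ / _
    linarith
  unfold psi
  linarith

lemma psi_lt_psi_right {r α β β' : ℝ} (hr : 0 ≤ r) (hα : α ∈ Ioo 0 (π / 2))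
    (hβ : β ∈ Ioo 0 (π / 2)) (hβ' : β' ∈ Ioo 0 (π / 2)) (h : β < β') :
    psi r α β' < psi r α β := by
  have h1 := antitoneOn_wfun_div_sig hβ hβ' h.le
  have h2 := strictAntiOn_sig hβ hβ' h
  have hσ := sig_pos hβ'
  have hc : 0 < wfun α + 2 * r * cos α := by
    have := wfun_pos hα; have := cos_pos_of_mem hα; positivity
  have h3 : (wfun α + 2 * r * cos α) / sig β < (wfun α + 2 * r * cos α) / sig β' := by gcongr
  simp only at h1
  have e : ∀ x, (wfun x - wfun α - 2 * r * cos α) / sig x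
      = wfun x / sig x - (wfun α + 2 * r * cos α) / sig x := fun x => by ring
  unfold psi
  rw [e, e]
  linarith

/-- The factor is positive, and the angle constraint `(n - 2) β = π - 2 α` has been used to remove
`n` from `psi`. -/
lemma H_eq_mul_psi {n r α : ℝ} (hn : 2 < n) (hα : α ∈ Ioo 0 (π / 2))
    (hβ : otherAngle n α ∈ Ioo 0 (π / 2)) :
    H n r α = sin α * sin (otherAngle n α) * sig (otherAngle n α) * psi r α (otherAngle n α) := by
  have hs := sin_pos_of_mem hα; have hs' := sin_pos_of_mem hβ
  have hc' := cos_pos_of_mem hβ; have h0 := hβ.1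
  have e : (n - 2) * otherAngle n α = π - 2 * α := by
    unfold otherAngle; field_simp [sub_ne_zero.2 hn.ne']
  unfold H psi wfun sig
  rw [← e, sin_two_mul]
  change sin α * cos (otherAngle n α) ^ 2 * gdInv (otherAngle n α)
    - cos α ^ 2 * sin (otherAngle n α) * gdInv α - _ - _ = _
  generalize otherAngle n α = β at *
  field_simp

lemma otherAngle_pos {n α : ℝ} (hn : 2 < n) (hα : α < π / 2) : 0 < otherAngle n α :=
  div_pos (by linarith) (by linarith)

lemma otherAngle_mul {n : ℝ} (hn : 2 < n) (α : ℝ) : (n - 2) * otherAngle n α + 2 * α = π := by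
  unfold otherAngle; field_simp [sub_ne_zero.2 hn.ne']; ring

lemma otherAngle_pi_div {n : ℝ} (hn : 2 < n) : otherAngle n (π / n) = π / n := by
  have : n - 2 ≠ 0 := by linarith
  unfold otherAngle; field_simp

lemma otherAngle_le {n α : ℝ} (hn : 2 < n) (hα : π / n ≤ α) : otherAngle n α ≤ π / n := by
  rw [← otherAngle_pi_div hn]
  unfold otherAngle
  have : 0 < n - 2 := by linarith
  gcongr

lemma mem_dom_of_mem_Ico {n α : ℝ} (hn : 2 < n) (hα : α ∈ Ico (π / n) (π / 2)) :
    α ∈ Ioo 0 (π / 2) ∧ otherAngle n α ∈ Ioo 0 (π / 2) := by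
  have h1 : 0 < π / n := div_pos pi_pos (by linarith)
  have h2 : π / n < π / 2 := by gcongr
  exact ⟨⟨h1.trans_le hα.1, hα.2⟩, otherAngle_pos hn hα.2, (otherAngle_le hn hα.1).trans_lt h2⟩

lemma otherAngle_lt_otherAngle {n α α' : ℝ} (hn : 2 < n) (h : α < α') :
    otherAngle n α' < otherAngle n α := by
  unfold otherAngle
  have : 0 < n - 2 := by linarith
  gcongr

lemma psi_strictMono {n r α α' : ℝ} (hn : 2 < n) (hr : 0 ≤ r) (hα : α ∈ Ioo 0 (π / 2))
    (hβ : otherAngle n α ∈ Ioo 0 (π / 2)) (hα' : α' ∈ Ioo 0 (π / 2)) (h : α < α') :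
    psi r α (otherAngle n α) < psi r α' (otherAngle n α') := by
  have h1 := otherAngle_lt_otherAngle hn h
  have hβ' : otherAngle n α' ∈ Ioo 0 (π / 2) := ⟨otherAngle_pos hn hα'.2, h1.trans hβ.2⟩
  exact (psi_lt_psi_left hr hα hα' hβ h).trans (psi_lt_psi_right hr hα' hβ' hβ h1)

lemma psi_eq_zero_iff {n r α : ℝ} (hn : 2 < n) (hα : α ∈ Ioo 0 (π / 2))
    (hβ : otherAngle n α ∈ Ioo 0 (π / 2)) : psi r α (otherAngle n α) = 0 ↔ H n r α = 0 := by
  have := sin_pos_of_mem hα; have := sin_pos_of_mem hβ; have := sig_pos hβ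
  rw [H_eq_mul_psi hn hα hβ]
  simp [*, ne_of_gt]

lemma H_strict_sign {n r α α' : ℝ} (hn : 2 < n) (hr : 0 ≤ r) (hα : α ∈ Ioo 0 (π / 2))
    (hβ : otherAngle n α ∈ Ioo 0 (π / 2)) (hα' : α' ∈ Ioo 0 (π / 2)) (h : α < α') :
    (H n r α' = 0 → H n r α < 0) ∧ (H n r α = 0 → 0 < H n r α') := by
  have h1 := otherAngle_lt_otherAngle hn h
  have hβ' : otherAngle n α' ∈ Ioo 0 (π / 2) := ⟨otherAngle_pos hn hα'.2, h1.trans hβ.2⟩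
  have h2 := psi_strictMono hn hr hα hβ hα' h
  have p1 : 0 < sin α * sin (otherAngle n α) * sig (otherAngle n α) :=
    mul_pos (mul_pos (sin_pos_of_mem hα) (sin_pos_of_mem hβ)) (sig_pos hβ)
  have p2 : 0 < sin α' * sin (otherAngle n α') * sig (otherAngle n α') :=
    mul_pos (mul_pos (sin_pos_of_mem hα') (sin_pos_of_mem hβ')) (sig_pos hβ')
  refine ⟨fun h3 => ?_, fun h3 => ?_⟩
  · rw [← psi_eq_zero_iff hn hα' hβ'] at h3
    rw [H_eq_mul_psi hn hα hβ]
    exact mul_neg_of_pos_of_neg p1 (by linarith)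
  · rw [← psi_eq_zero_iff hn hα hβ] at h3
    rw [H_eq_mul_psi hn hα' hβ']
    exact mul_pos p2 (by linarith)

lemma continuousOn_H {n r : ℝ} (hn : 2 < n) : ContinuousOn (H n r) (Ico (π / n) (π / 2)) := by
  intro α hα
  obtain ⟨h1, h2⟩ := mem_dom_of_mem_Ico hn hα
  have c1 := (hasDerivAt_gdInv (θ := α) ⟨by linarith [h1.1, pi_pos], h1.2⟩).continuousAt
  have c2 := (hasDerivAt_gdInv (θ := otherAngle n α)
    ⟨by linarith [h2.1, pi_pos], h2.2⟩).continuousAt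
  have c0 : ContinuousAt (otherAngle n) α := by unfold otherAngle; fun_prop
  have c3 : ContinuousAt (fun α => gdInv (otherAngle n α)) α := c2.comp c0
  have : ContinuousAt (fun α => sin α * cos (otherAngle n α) ^ 2 * gdInv (otherAngle n α)
    - cos α ^ 2 * sin (otherAngle n α) * gdInv α - r * sin (2 * α) * sin (otherAngle n α)
    - r * (n - 2) * cos (otherAngle n α) * sin (otherAngle n α) ^ 2) α := by fun_prop
  exact this.continuousWithinAt

/-- Near `π / 2` the function `H` is positive: there the triangles with half angle `β` are
negligible against their outbound cost. -/
lemma exists_H_pos {n r : ℝ} (hn : 2 < n) (hr : 0 ≤ r) :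
    ∃ α ∈ Ico (π / n) (π / 2), 0 < H n r α := by
  have hcont : ContinuousAt (fun α => sin α * cos (otherAngle n α) ^ 2 - 2 * cos α
      - r * (π - 2 * α + 2 * cos α)) (π / 2) := by
    have c0 : ContinuousAt (otherAngle n) (π / 2) := by unfold otherAngle; fun_prop
    fun_prop
  have hval : 0 < (fun α => sin α * cos (otherAngle n α) ^ 2 - 2 * cos α
      - r * (π - 2 * α + 2 * cos α)) (π / 2) := by
    have : otherAngle n (π / 2) = 0 := by unfold otherAngle; simp [mul_div_cancel₀]
    simp [this]; ring_nf; simp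
  have h1 := (hcont.eventually (lt_mem_nhds hval)).filter_mono
    (nhdsWithin_le_nhds (s := Iio (π / 2)))
  have h2 : π / n < π / 2 := by have := pi_pos; gcongr
  obtain ⟨α, ha, hb⟩ := (h1.and (Ico_mem_nhdsLT h2)).exists
  refine ⟨α, hb, ?_⟩
  obtain ⟨hα, hβ⟩ := mem_dom_of_mem_Ico hn hb
  have e : H n r α = sin (otherAngle n α) * (sin α * wfun (otherAngle n α) - sin α * wfun α
      - r * (2 * sin α * cos α + (π - 2 * α) * sig (otherAngle n α))) := by
    have hs := sin_pos_of_mem hα; have hs' := sin_pos_of_mem hβ; have hσ := sig_pos hβ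
    rw [H_eq_mul_psi hn hα hβ]
    unfold psi
    field_simp
    ring
  rw [e]
  refine mul_pos (sin_pos_of_mem hβ) (ha.trans_le ?_)
  have hs := sin_pos_of_mem hα
  have hc := cos_pos_of_mem hα
  have i1 : sin α * cos (otherAngle n α) ^ 2 ≤ sin α * wfun (otherAngle n α) := by
    have := cos_sq_le_wfun hβ; gcongr
  have i2 := sin_mul_wfun_le hα
  have i3 : sig (otherAngle n α) ≤ 1 := by
    unfold sig; rw [div_le_one hβ.1]; exact (sin_mul_cos_lt hβ.1).le
  have i4 : 2 * sin α * cos α + (π - 2 * α) * sig (otherAngle n α) ≤ π - 2 * α + 2 * cos α := by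
    have : 0 ≤ π - 2 * α := by linarith [hα.2]
    have := sin_le_one α
    nlinarith
  have := mul_le_mul_of_nonneg_left i4 hr
  linarith

lemma existsUnique_root {n r : ℝ} (hn : 2 < n) (hr : 0 ≤ r) :
    ∃! α : ℝ, α ∈ Ico (π / n) (π / 2) ∧ H n r α = 0 := by
  obtain ⟨α₁, h1, h2⟩ := exists_H_pos hn hr
  have h0 : H n r (π / n) ≤ 0 := by
    have hmem : π / n ∈ Ico (π / n) (π / 2) := ⟨le_rfl, h1.1.trans_lt h1.2⟩
    obtain ⟨hα, -⟩ := mem_dom_of_mem_Ico hn hmem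
    have hs := sin_pos_of_mem hα; have hc := cos_pos_of_mem hα
    unfold H
    rw [otherAngle_pi_div hn, sin_two_mul]
    have : 0 ≤ r * (n - 2) * cos (π / n) * sin (π / n) ^ 2 := by
      have : 0 < n - 2 := by linarith
      positivity
    have : 0 ≤ r * (2 * sin (π / n) * cos (π / n)) * sin (π / n) := by positivity
    nlinarith
  have hsub : Icc (π / n) α₁ ⊆ Ico (π / n) (π / 2) := fun x hx => ⟨hx.1, hx.2.trans_lt h1.2⟩
  obtain ⟨α, hα, hH⟩ := intermediate_value_Icc h1.1 ((continuousOn_H hn).mono hsub) ⟨h0, h2.le⟩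
  refine ⟨α, ⟨hsub hα, hH⟩, ?_⟩
  rintro α' ⟨h3, h4⟩
  obtain ⟨d1, d2⟩ := mem_dom_of_mem_Ico hn (hsub hα)
  obtain ⟨d3, d4⟩ := mem_dom_of_mem_Ico hn h3
  rcases lt_trichotomy α α' with h | h | h
  · linarith [(H_strict_sign hn hr d1 d2 d3 h).1 h4]
  · exact h.symm
  · linarith [(H_strict_sign hn hr d3 d4 d1 h).1 hH]

lemma alphaStar_spec {n r : ℝ} (hn : 2 < n) (hr : 0 ≤ r) :
    alphaStar n r ∈ Ico (π / n) (π / 2) ∧ H n r (alphaStar n r) = 0 := by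
  obtain ⟨α, h1, h2⟩ := existsUnique_root hn hr
  have : rootSet n r = {α} := by
    ext x
    exact ⟨fun hx => h2 x hx, fun hx => by rw [mem_singleton_iff.1 hx]; exact h1⟩
  unfold alphaStar
  rw [this, csInf_singleton]
  exact h1

lemma alphaStar_mem {n r : ℝ} (hn : 2 < n) (hr : 0 ≤ r) : alphaStar n r ∈ Ioo 0 (π / 2) :=
  (mem_dom_of_mem_Ico hn (alphaStar_spec hn hr).1).1

lemma betaStar_mem {n r : ℝ} (hn : 2 < n) (hr : 0 ≤ r) : betaStar n r ∈ Ioo 0 (π / 2) :=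
  (mem_dom_of_mem_Ico hn (alphaStar_spec hn hr).1).2

lemma betaStar_mul {n : ℝ} (r : ℝ) (hn : 2 < n) :
    (n - 2) * betaStar n r + 2 * alphaStar n r = π :=
  otherAngle_mul hn _

lemma betaStar_le_alphaStar {n r : ℝ} (hn : 2 < n) (hr : 0 ≤ r) :
    betaStar n r ≤ alphaStar n r :=
  (otherAngle_le hn (alphaStar_spec hn hr).1.1).trans (alphaStar_spec hn hr).1.1

lemma psi_star {n r : ℝ} (hn : 2 < n) (hr : 0 ≤ r) :
    psi r (alphaStar n r) (betaStar n r) = 0 :=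
  (psi_eq_zero_iff hn (alphaStar_mem hn hr) (betaStar_mem hn hr)).2 (alphaStar_spec hn hr).2

/-- Both optimal half angles decrease with the number of sides: they increase with each other along
`psi = 0`, and `(n - 2) β + 2 α` is constant. -/
lemma star_antitone {n n' r : ℝ} (hn : 2 < n) (hr : 0 ≤ r) (h : n ≤ n') :
    alphaStar n' r ≤ alphaStar n r ∧ betaStar n' r ≤ betaStar n r := by
  have hn' := hn.trans_le h
  have a := alphaStar_mem hn hr
  have a' := alphaStar_mem hn' hr
  have b := betaStar_mem hn hr
  have b' := betaStar_mem hn' hr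
  have e := betaStar_mul r hn
  have e' := betaStar_mul r hn'
  have p := psi_star hn hr
  have p' := psi_star hn' hr
  have hb0 := b.1
  constructor
  · by_contra! hlt
    have hb : betaStar n r < betaStar n' r := by
      by_contra! hle
      have h1 := psi_lt_psi_left hr a a' b hlt
      rcases hle.eq_or_lt with h2 | h2
      · rw [h2] at p'; linarith
      · linarith [psi_lt_psi_right hr a' b' b h2]
    nlinarith
  · by_contra! hlt
    have ha : alphaStar n r < alphaStar n' r := by
      by_contra! hle
      have h1 := psi_lt_psi_right hr a b b' hlt
      rcases hle.eq_or_lt with h2 | h2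
      · rw [h2] at p'; linarith
      · linarith [psi_lt_psi_left hr a' a b' h2]
    nlinarith

/-! ### The cost of a cyclic polygon as a function of its angles -/

/-- Area of the cyclic polygon with half angles `α, α, β, …, β` and circumradius `1`. -/
noncomputable def unitArea (n α : ℝ) : ℝ :=
  sin (2 * α) + (n - 2) * cos (otherAngle n α) * sin (otherAngle n α)

/-- First moment about the apex of the isosceles triangle with apex angle `2 θ` and legs `1`. -/
noncomputable def triMoment (θ : ℝ) : ℝ := (sin θ * cos θ + cos θ ^ 3 * gdInv θ) / 3

/-- Outbound plus inbound cost (in units of `κ f`) of the polygon of circumradius `1`. -/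
noncomputable def unitCost (n r α : ℝ) : ℝ :=
  (n - 2) * triMoment (otherAngle n α) + 2 * triMoment α + 2 * r * unitArea n α * cos α

/-- The scale invariant `area³ / cost²` of a cyclic polygon. Its maximum over `α` is `g²`. -/
noncomputable def quality (n r α : ℝ) : ℝ := unitArea n α ^ 3 / unitCost n r α ^ 2

lemma unitArea_pos {n α : ℝ} (hn : 2 < n) (hα : α ∈ Ioo 0 (π / 2))
    (hβ : otherAngle n α ∈ Ioo 0 (π / 2)) : 0 < unitArea n α := by
  have := sin_pos_of_mem hα; have := sin_pos_of_mem hβ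
  have := cos_pos_of_mem hα; have := cos_pos_of_mem hβ
  have : 0 < n - 2 := by linarith
  unfold unitArea; rw [sin_two_mul]; positivity

lemma triMoment_pos {θ : ℝ} (h : θ ∈ Ioo 0 (π / 2)) : 0 < triMoment θ := by
  have := sin_pos_of_mem h; have := cos_pos_of_mem h; have := gdInv_pos h
  unfold triMoment; positivity

lemma unitCost_pos {n r α : ℝ} (hn : 2 < n) (hr : 0 ≤ r) (hα : α ∈ Ioo 0 (π / 2))
    (hβ : otherAngle n α ∈ Ioo 0 (π / 2)) : 0 < unitCost n r α := by
  have := triMoment_pos hα; have := triMoment_pos hβ; have := unitArea_pos hn hα hβ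
  have := cos_pos_of_mem hα
  have : 0 < n - 2 := by linarith
  unfold unitCost; positivity

lemma hasDerivAt_triMoment {θ : ℝ} (h : θ ∈ Ioo 0 (π / 2)) :
    HasDerivAt triMoment
      ((2 * cos θ ^ 2 - sin θ ^ 2 - 3 * cos θ ^ 2 * sin θ * gdInv θ) / 3) θ := by
  have hc := cos_pos_of_mem h
  have h1 := hasDerivAt_gdInv (θ := θ) ⟨by linarith [h.1, pi_pos], h.2⟩
  refine ((((hasDerivAt_sin θ).mul (hasDerivAt_cos θ)).add
    (((hasDerivAt_cos θ).pow 3).mul h1)).div_const 3).congr_deriv ?_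
  simp only [Pi.pow_apply]
  field_simp
  push_cast
  ring

lemma hasDerivAt_otherAngle (n α : ℝ) : HasDerivAt (otherAngle n) (-2 / (n - 2)) α := by
  refine ((((hasDerivAt_id α).const_mul 2).const_sub π).div_const (n - 2)).congr_deriv ?_
  simp

lemma hasDerivAt_otherAngle_left {n : ℝ} (hn : 2 < n) (α : ℝ) :
    HasDerivAt (fun x => otherAngle x α) (-otherAngle n α / (n - 2)) n := by
  have h0 : n - 2 ≠ 0 := by linarith
  refine ((hasDerivAt_const n (π - 2 * α)).div ((hasDerivAt_id n).sub_const 2) h0).congr_deriv ?_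
  unfold otherAngle
  simp only [id]
  field_simp
  ring

lemma hasDerivAt_unitArea {n α : ℝ} (hn : 2 < n) :
    HasDerivAt (unitArea n) (2 * (cos α ^ 2 - sin α ^ 2)
      - 2 * (cos (otherAngle n α) ^ 2 - sin (otherAngle n α) ^ 2)) α := by
  have h0 : n - 2 ≠ 0 := by linarith
  have h1 := hasDerivAt_otherAngle n α
  have h2 := ((hasDerivAt_id α).const_mul 2).sin
  refine (h2.add ((h1.cos.const_mul (n - 2)).mul h1.sin)).congr_deriv ?_
  simp only [id, cos_two_mul']
  field_simp
  ring

/-- The derivative of the quality in `α` is a negative multiple of `H`. -/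
lemma hasDerivAt_quality {n r α : ℝ} (hn : 2 < n) (hr : 0 ≤ r) (hα : α ∈ Ioo 0 (π / 2))
    (hβ : otherAngle n α ∈ Ioo 0 (π / 2)) :
    HasDerivAt (quality n r)
      (-(4 * unitArea n α ^ 2 * (2 * sin (otherAngle n α) * cos α
        + (n - 2) * cos (otherAngle n α) * sin α) / unitCost n r α ^ 3) * H n r α) α := by
  have h0 : n - 2 ≠ 0 := by linarith
  have hB := unitCost_pos hn hr hα hβ
  have d1 := hasDerivAt_otherAngle n α
  have dS := hasDerivAt_unitArea (α := α) hn
  have dB := ((((hasDerivAt_triMoment hβ).comp α d1).const_mul (n - 2)).add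
    ((hasDerivAt_triMoment hα).const_mul 2)).add
    ((dS.const_mul (2 * r)).mul (hasDerivAt_cos α))
  have dB' : HasDerivAt (unitCost n r) _ α := dB
  refine ((dS.pow 3).div (dB'.pow 2) (pow_ne_zero 2 hB.ne')).congr_deriv ?_
  simp only [Pi.pow_apply]
  have key : 3 * unitCost n r α * (2 * (cos α ^ 2 - sin α ^ 2)
      - 2 * (cos (otherAngle n α) ^ 2 - sin (otherAngle n α) ^ 2))
      - 2 * unitArea n α * ((n - 2) * (((2 * cos (otherAngle n α) ^ 2 - sin (otherAngle n α) ^ 2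
        - 3 * cos (otherAngle n α) ^ 2 * sin (otherAngle n α) * gdInv (otherAngle n α)) / 3)
          * (-2 / (n - 2)))
        + 2 * ((2 * cos α ^ 2 - sin α ^ 2 - 3 * cos α ^ 2 * sin α * gdInv α) / 3)
        + (2 * r * (2 * (cos α ^ 2 - sin α ^ 2)
      - 2 * (cos (otherAngle n α) ^ 2 - sin (otherAngle n α) ^ 2)) * cos α
        + 2 * r * unitArea n α * -sin α))
      = -(4 * (2 * sin (otherAngle n α) * cos α + (n - 2) * cos (otherAngle n α) * sin α))
        * H n r α := by
    have eH : H n r α = sin α * cos (otherAngle n α) ^ 2 * gdInv (otherAngle n α)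
      - cos α ^ 2 * sin (otherAngle n α) * gdInv α - r * sin (2 * α) * sin (otherAngle n α)
      - r * (n - 2) * cos (otherAngle n α) * sin (otherAngle n α) ^ 2 := rfl
    rw [eH]
    have e1 := sin_sq_add_cos_sq α
    have e2 := sin_sq_add_cos_sq (otherAngle n α)
    have e3 : ∀ x : ℝ, (n - 2) * (x * (-2 / (n - 2))) = -2 * x := fun x => by field_simp
    rw [e3]
    unfold unitCost unitArea triMoment
    simp only [sin_two_mul]
    generalize otherAngle n α = β at *
    generalize gdInv β = Lb at *
    generalize gdInv α = La at *
    generalize cos β = c at *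
    generalize sin β = s at *
    generalize cos α = C at *
    generalize sin α = S at *
    clear dS dB dB' hB eH e3 d1
    grind
  field_simp at key ⊢
  linear_combination unitArea n α ^ 2 * unitCost n r α * key

lemma unitCost_star {n r : ℝ} (hn : 2 < n) (hr : 0 ≤ r) :
    3 * unitCost n r (alphaStar n r)
      = unitArea n (alphaStar n r) * (1 + wfun (betaStar n r) + 4 * r * cos (alphaStar n r)) := by
  have hH := (alphaStar_spec hn hr).2
  have hs := sin_pos_of_mem (betaStar_mem hn hr)
  have eH : H n r (alphaStar n r) = sin (alphaStar n r) * cos (betaStar n r) ^ 2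
      * gdInv (betaStar n r)
      - cos (alphaStar n r) ^ 2 * sin (betaStar n r) * gdInv (alphaStar n r)
      - r * sin (2 * alphaStar n r) * sin (betaStar n r)
      - r * (n - 2) * cos (betaStar n r) * sin (betaStar n r) ^ 2 := rfl
  rw [eH, sin_two_mul] at hH
  change 3 * ((n - 2) * triMoment (betaStar n r) + 2 * triMoment (alphaStar n r)
    + 2 * r * (sin (2 * alphaStar n r) + (n - 2) * cos (betaStar n r) * sin (betaStar n r))
      * cos (alphaStar n r)) = (sin (2 * alphaStar n r) + (n - 2) * cos (betaStar n r)
        * sin (betaStar n r)) * _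
  unfold wfun triMoment
  rw [sin_two_mul]
  field_simp
  linear_combination -2 * cos (alphaStar n r) * hH

lemma one_add_wfun_pos {n r : ℝ} (hn : 2 < n) (hr : 0 ≤ r) :
    0 < 1 + wfun (betaStar n r) + 4 * r * cos (alphaStar n r) := by
  have := wfun_pos (betaStar_mem hn hr)
  have := cos_pos_of_mem (alphaStar_mem hn hr)
  positivity

lemma unitArea_star_pos {n r : ℝ} (hn : 2 < n) (hr : 0 ≤ r) : 0 < unitArea n (alphaStar n r) :=
  unitArea_pos hn (alphaStar_mem hn hr) (betaStar_mem hn hr)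

lemma g_eq {n r : ℝ} (hn : 2 < n) (hr : 0 ≤ r) :
    g n r = 3 * √(unitArea n (alphaStar n r))
      / (1 + wfun (betaStar n r) + 4 * r * cos (alphaStar n r)) := by
  have hs := sin_pos_of_mem (betaStar_mem hn hr)
  have h1 := one_add_wfun_pos hn hr
  have e : sin (betaStar n r) * (1 + wfun (betaStar n r) + 4 * r * cos (alphaStar n r))
      = sin (betaStar n r) + cos (betaStar n r) ^ 2 * gdInv (betaStar n r)
        + 4 * r * sin (betaStar n r) * cos (alphaStar n r) := by
    unfold wfun; field_simp
  have e2 : g n r = 3 * sin (betaStar n r) * √(unitArea n (alphaStar n r))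
      / (sin (betaStar n r) + cos (betaStar n r) ^ 2 * gdInv (betaStar n r)
        + 4 * r * sin (betaStar n r) * cos (alphaStar n r)) := rfl
  rw [e2, ← e]
  field_simp

lemma g_pos {n r : ℝ} (hn : 2 < n) (hr : 0 ≤ r) : 0 < g n r := by
  have := one_add_wfun_pos hn hr
  have := unitArea_star_pos hn hr
  rw [g_eq hn hr]
  positivity

lemma g_sq {n r : ℝ} (hn : 2 < n) (hr : 0 ≤ r) : g n r ^ 2 = quality n r (alphaStar n r) := by
  have h1 := one_add_wfun_pos hn hr
  have h2 := unitArea_star_pos hn hr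
  have h3 : unitCost n r (alphaStar n r) = unitArea n (alphaStar n r)
    * (1 + wfun (betaStar n r) + 4 * r * cos (alphaStar n r)) / 3 := by
    linarith [unitCost_star hn hr]
  unfold quality
  rw [g_eq hn hr, h3, div_pow, mul_pow, sq_sqrt h2.le]
  field_simp

/-- `H` is negative to the left of `α*` and positive to the right, so the quality increases up to
`α*` and decreases afterwards. -/
lemma quality_le {n r α : ℝ} (hn : 2 < n) (hr : 0 ≤ r) (hα : α ∈ Ioo 0 (π / 2))
    (hβ : otherAngle n α ∈ Ioo 0 (π / 2)) : quality n r α ≤ g n r ^ 2 := by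
  rw [g_sq hn hr]
  have hα' := alphaStar_mem hn hr
  have hβ' : otherAngle n (alphaStar n r) ∈ Ioo 0 (π / 2) := betaStar_mem hn hr
  have hH := (alphaStar_spec hn hr).2
  have hfac : ∀ x, x ∈ Ioo 0 (π / 2) → otherAngle n x ∈ Ioo 0 (π / 2) →
      0 < 4 * unitArea n x ^ 2 * (2 * sin (otherAngle n x) * cos x
        + (n - 2) * cos (otherAngle n x) * sin x) / unitCost n r x ^ 3 := by
    intro x h1 h2
    have := sin_pos_of_mem h1; have := sin_pos_of_mem h2
    have := cos_pos_of_mem h1; have := cos_pos_of_mem h2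
    have := unitArea_pos hn h1 h2; have := unitCost_pos hn hr h1 h2
    have : 0 < n - 2 := by linarith
    positivity
  rcases le_total α (alphaStar n r) with h | h
  · have hdom : ∀ x ∈ Icc α (alphaStar n r), x ∈ Ioo 0 (π / 2) ∧
        otherAngle n x ∈ Ioo 0 (π / 2) := by
      intro x hx
      have : x < π / 2 := hx.2.trans_lt hα'.2
      refine ⟨⟨hα.1.trans_le hx.1, this⟩, otherAngle_pos hn this, ?_⟩
      rcases hx.1.eq_or_lt with h1 | h1
      · rw [← h1]; exact hβ.2
      · exact (otherAngle_lt_otherAngle hn h1).trans hβ.2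
    have hd := fun x hx => hasDerivAt_quality hn hr (hdom x hx).1 (hdom x hx).2
    refine monotoneOn_of_deriv_nonneg (convex_Icc α (alphaStar n r))
      (fun x hx => (hd x hx).continuousAt.continuousWithinAt)
      (fun x hx => (hd x (interior_subset hx)).differentiableAt.differentiableWithinAt) ?_
      (left_mem_Icc.2 h) (right_mem_Icc.2 h) h
    intro x hx
    rw [(hd x (interior_subset hx)).deriv]
    obtain ⟨h1, h2⟩ := hdom x (interior_subset hx)
    rw [interior_Icc] at hx
    have := (H_strict_sign hn hr h1 h2 hα' hx.2).1 hH
    have := hfac x h1 h2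
    nlinarith
  · have hdom : ∀ x ∈ Icc (alphaStar n r) α, x ∈ Ioo 0 (π / 2) ∧
        otherAngle n x ∈ Ioo 0 (π / 2) := by
      intro x hx
      have : x < π / 2 := hx.2.trans_lt hα.2
      refine ⟨⟨hα'.1.trans_le hx.1, this⟩, otherAngle_pos hn this, ?_⟩
      rcases hx.1.eq_or_lt with h1 | h1
      · rw [← h1]; exact hβ'.2
      · exact (otherAngle_lt_otherAngle hn h1).trans hβ'.2
    have hd := fun x hx => hasDerivAt_quality hn hr (hdom x hx).1 (hdom x hx).2
    refine antitoneOn_of_deriv_nonpos (convex_Icc (alphaStar n r) α)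
      (fun x hx => (hd x hx).continuousAt.continuousWithinAt)
      (fun x hx => (hd x (interior_subset hx)).differentiableAt.differentiableWithinAt) ?_
      (left_mem_Icc.2 h) (right_mem_Icc.2 h) h
    intro x hx
    rw [(hd x (interior_subset hx)).deriv]
    obtain ⟨h1, h2⟩ := hdom x (interior_subset hx)
    rw [interior_Icc] at hx
    have := (H_strict_sign hn hr hα' hβ' h1 hx.1).2 hH
    have := hfac x h1 h2
    nlinarith

/-! ### Concavity of `g²` in the number of sides -/

/-- The factor of the derivative `rho ^ 3 * defect` of `g²` in `n` which depends on `β` only. It is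
nonnegative and increasing. -/
noncomputable def defect (θ : ℝ) : ℝ := ((1 + wfun θ) * (sin θ * cos θ) + θ * (1 - 3 * wfun θ)) / 3

/-- Area over cost of the optimal polygon of circumradius `1` with half angles `α` and `β`. -/
noncomputable def rho (r α β : ℝ) : ℝ := 3 / (1 + wfun β + 4 * r * cos α)

lemma hasDerivAt_defect {θ : ℝ} (h : θ ∈ Ioo 0 (π / 2)) :
    HasDerivAt defect
      (-(cos θ / sin θ ^ 2 * (sin θ - gdInv θ * (1 + sin θ ^ 2))) * (θ - sin θ * cos θ)) θ := by
  have hs := sin_pos_of_mem h; have hc := cos_pos_of_mem h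
  have hw := hasDerivAt_wfun h
  refine ((((hw.const_add 1).mul ((hasDerivAt_sin θ).mul (hasDerivAt_cos θ))).add
    ((hasDerivAt_id θ).mul ((hw.const_mul 3).const_sub 1))).div_const 3).congr_deriv ?_
  have e := sin_sq_add_cos_sq θ
  simp only [Pi.mul_apply, id]
  unfold wfun
  field_simp
  grind

lemma monotoneOn_defect : MonotoneOn defect (Ioo 0 (π / 2)) := by
  refine monotoneOn_of_deriv_nonneg (convex_Ioo _ _)
    (fun x hx => (hasDerivAt_defect hx).continuousAt.continuousWithinAt)
    (fun x hx => (hasDerivAt_defect (interior_subset hx)).differentiableAt.differentiableWithinAt)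
    fun x hx => ?_
  rw [interior_Ioo] at hx
  rw [(hasDerivAt_defect hx).deriv]
  have h1 := deriv_wfun_neg hx
  have h2 := sin_mul_cos_lt hx.1
  exact mul_nonneg (by linarith) (by linarith)

lemma wfun_le_one {θ : ℝ} (h : θ ∈ Ioo 0 (π / 2)) : wfun θ ≤ 1 := by
  have hs := sin_pos_of_mem h; have hc := cos_pos_of_mem h
  have key : AntitoneOn (fun x => cos x ^ 2 * gdInv x - sin x) (Ico 0 (π / 2)) := by
    have hd : ∀ x ∈ Ico 0 (π / 2), HasDerivAt (fun x => cos x ^ 2 * gdInv x - sin x)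
        (-(2 * cos x * sin x * gdInv x)) x := by
      intro x hx
      have hc : 0 < cos x := cos_pos_of_mem_Ioo ⟨by linarith [hx.1, pi_pos], hx.2⟩
      have h1 := hasDerivAt_gdInv (θ := x) ⟨by linarith [hx.1, pi_pos], hx.2⟩
      refine ((((hasDerivAt_cos x).pow 2).mul h1).sub (hasDerivAt_sin x)).congr_deriv ?_
      simp only [Pi.pow_apply]
      field_simp
      push_cast
      ring
    refine antitoneOn_of_deriv_nonpos (convex_Ico _ _)
      (fun x hx => (hd x hx).continuousAt.continuousWithinAt)
      (fun x hx => (hd x (interior_subset hx)).differentiableAt.differentiableWithinAt) ?_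
    intro x hx
    rw [(hd x (interior_subset hx)).deriv]
    rw [interior_Ico] at hx
    have := sin_pos_of_mem hx; have := cos_pos_of_mem hx; have := gdInv_pos hx
    have : 0 < 2 * cos x * sin x * gdInv x := by positivity
    linarith
  have := key (left_mem_Ico.2 (by positivity)) ⟨h.1.le, h.2⟩ h.1.le
  simp [gdInv_zero] at this
  unfold wfun
  rw [div_le_one hs]
  linarith

lemma defect_nonneg {θ : ℝ} (h : θ ∈ Ioo 0 (π / 2)) : 0 ≤ defect θ := by
  by_contra! hlt
  set ε := min (θ / 2) (-defect θ) with hε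
  have h0 := h.1
  have hε0 : 0 < ε := lt_min (by linarith) (by linarith)
  have hεθ : ε < θ := (min_le_left _ _).trans_lt (by linarith)
  have hmem : ε ∈ Ioo 0 (π / 2) := ⟨hε0, hεθ.trans h.2⟩
  have h1 := monotoneOn_defect hmem h hεθ.le
  have hs := sin_pos_of_mem hmem; have hc := cos_pos_of_mem hmem
  have hw := wfun_pos hmem
  have h2 : -(2 * ε) ≤ 3 * defect ε := by
    have h3 : 0 ≤ (1 + wfun ε) * (sin ε * cos ε) := by positivity
    have := wfun_le_one hmem
    unfold defect
    nlinarith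
  have h4 : ε ≤ -defect θ := min_le_right _ _
  linarith

lemma differentiableAt_quality {n r α : ℝ} (hn : 2 < n) (hr : 0 ≤ r) (hα : α ∈ Ioo 0 (π / 2))
    (hβ : otherAngle n α ∈ Ioo 0 (π / 2)) :
    DifferentiableAt ℝ (fun p : ℝ × ℝ => quality p.1 r p.2) (n, α) := by
  have h0 : n - 2 ≠ 0 := by linarith
  have hB := (unitCost_pos hn hr hα hβ).ne'
  have d0 : DifferentiableAt ℝ (fun p : ℝ × ℝ => otherAngle p.1 p.2) (n, α) := by
    unfold otherAngle; fun_prop (disch := exact h0)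
  have d1 : DifferentiableAt ℝ (fun p : ℝ × ℝ => triMoment (otherAngle p.1 p.2)) (n, α) :=
    DifferentiableAt.comp (n, α) (f := fun p : ℝ × ℝ => otherAngle p.1 p.2)
      (hasDerivAt_triMoment hβ).differentiableAt d0
  have d2 : DifferentiableAt ℝ (fun p : ℝ × ℝ => triMoment p.2) (n, α) :=
    DifferentiableAt.comp (n, α) (f := fun p : ℝ × ℝ => p.2)
      (hasDerivAt_triMoment hα).differentiableAt differentiableAt_snd
  have d3 : DifferentiableAt ℝ (fun p : ℝ × ℝ => unitArea p.1 p.2) (n, α) := by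
    unfold unitArea; fun_prop
  have d4 : DifferentiableAt ℝ (fun p : ℝ × ℝ => unitCost p.1 r p.2) (n, α) := by
    unfold unitCost; fun_prop
  unfold quality
  fun_prop (disch := exact pow_ne_zero 2 hB)

lemma hasDerivAt_quality_left {n r : ℝ} (hn : 2 < n) (hr : 0 ≤ r) :
    HasDerivAt (fun x => quality x r (alphaStar n r))
      (rho r (alphaStar n r) (betaStar n r) ^ 3 * defect (betaStar n r)) n := by
  have hα := alphaStar_mem hn hr
  have hβ : otherAngle n (alphaStar n r) ∈ Ioo 0 (π / 2) := betaStar_mem hn hr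
  have h0 : n - 2 ≠ 0 := by linarith
  have hS := unitArea_star_pos hn hr
  have hB := unitCost_pos hn hr hα hβ
  have hρ := one_add_wfun_pos hn hr
  have hst := unitCost_star hn hr
  have hs := sin_pos_of_mem hβ
  set α := alphaStar n r with hαdef
  have d1 := hasDerivAt_otherAngle_left hn α
  have d2 := (hasDerivAt_id n).sub_const 2
  have dS : HasDerivAt (fun x => unitArea x α) _ n :=
    ((d2.mul d1.cos).mul d1.sin).const_add (sin (2 * α))
  have dk : HasDerivAt (fun x => triMoment (otherAngle x α)) _ n :=
    HasDerivAt.comp n (hasDerivAt_triMoment hβ) d1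
  have dB : HasDerivAt (fun x => unitCost x r α) _ n :=
    ((d2.mul dk).add_const (2 * triMoment α)).add ((dS.const_mul (2 * r)).mul_const (cos α))
  refine ((dS.pow 3).div (dB.pow 2) (pow_ne_zero 2 hB.ne')).congr_deriv ?_
  simp only [Pi.pow_apply, Pi.mul_apply, id]
  change _ = rho r α (otherAngle n α) ^ 3 * defect (otherAngle n α)
  change 3 * unitCost n r α = unitArea n α * (1 + wfun (otherAngle n α) + 4 * r * cos α) at hst
  change 0 < 1 + wfun (otherAngle n α) + 4 * r * cos α at hρ
  have eL : cos (otherAngle n α) ^ 2 * gdInv (otherAngle n α)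
      = wfun (otherAngle n α) * sin (otherAngle n α) := by unfold wfun; field_simp
  have e1 := sin_sq_add_cos_sq (otherAngle n α)
  have ek : triMoment (otherAngle n α) = (sin (otherAngle n α) * cos (otherAngle n α)
      * (1 + wfun (otherAngle n α))) / 3 := by
    unfold triMoment
    linear_combination cos (otherAngle n α) * eL / 3
  have eB : unitCost n r α = unitArea n α / rho r α (otherAngle n α) := by
    unfold rho; field_simp; linarith
  have eρ : 4 * r * cos α = 3 / rho r α (otherAngle n α) - 1 - wfun (otherAngle n α) := by
    unfold rho; field_simp; ring
  have hρ' : 0 < rho r α (otherAngle n α) := by unfold rho; positivity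
  have e3 : ∀ x y : ℝ, (n - 2) * (x * (-y / (n - 2))) = -(x * y) := fun x y => by field_simp
  have e4 : ∀ x y : ℝ, (n - 2) * x * (y * (-otherAngle n α / (n - 2)))
    = -(x * y * otherAngle n α) := fun x y => by field_simp
  rw [e3, e3, ek, eB, e4]
  unfold defect
  have hr' : r * cos α = (3 / rho r α (otherAngle n α) - 1 - wfun (otherAngle n α)) / 4 := by
    linarith
  generalize rho r α (otherAngle n α) = ρ at *
  generalize otherAngle n α = β at *
  generalize wfun β = w at *
  generalize unitArea n α = S at *
  clear dS dk dB
  have e5 : 3 * cos β ^ 2 * sin β * gdInv β = 3 * (w * sin β ^ 2) := by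
    linear_combination 3 * sin β * eL
  have e6 : ∀ x : ℝ, 2 * r * x * cos α = x * (3 / ρ - 1 - w) / 2 := fun x => by
    linear_combination 2 * x * hr'
  have e7 : cos β ^ 2 = 1 - sin β ^ 2 := by linarith
  rw [e5, e6, e7]
  simp only [Nat.reduceSub, pow_one]
  field_simp
  push_cast
  linear_combination -(6 * β * ρ * (1 + w)) * e1

/-- A Lipschitz bound follows from the monotonicity of both angles and the angle constraint. -/
lemma abs_alphaStar_sub_le {n n' r : ℝ} (hn : 2 < n) (hn' : 2 < n') (hr : 0 ≤ r) :
    |alphaStar n' r - alphaStar n r| ≤ |n' - n| := by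
  wlog h : n ≤ n' generalizing n n'
  · rw [abs_sub_comm, abs_sub_comm n']
    exact this hn' hn (le_of_not_ge h)
  obtain ⟨h1, h2⟩ := star_antitone hn hr h
  have e := betaStar_mul r hn
  have e' := betaStar_mul r hn'
  have hb := betaStar_mem hn hr
  have := pi_le_four
  rw [abs_sub_comm, abs_of_nonneg (by linarith), abs_of_nonneg (by linarith)]
  have h3 : (n' - 2) * betaStar n' r ≤ (n' - 2) * betaStar n r := by gcongr
  have h4 : (n' - n) * betaStar n r ≤ (n' - n) * 2 := by
    gcongr
    linarith [hb.2]
  linarith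

/-- Envelope theorem for `g²`: the dependence of the optimal angle on `n` does not contribute, and
at the optimum the remaining partial derivative depends on `β` through `defect` only. -/
lemma hasDerivAt_g_sq {n r : ℝ} (hn : 2 < n) (hr : 0 ≤ r) :
    HasDerivAt (fun x => g x r ^ 2)
      (rho r (alphaStar n r) (betaStar n r) ^ 3 * defect (betaStar n r)) n := by
  have hα := alphaStar_mem hn hr
  have hβ : otherAngle n (alphaStar n r) ∈ Ioo 0 (π / 2) := betaStar_mem hn hr
  obtain ⟨F', hF⟩ := differentiableAt_quality hn hr hα hβ
  have p1 : F' (1, 0) = rho r (alphaStar n r) (betaStar n r) ^ 3 * defect (betaStar n r) := by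
    have h1 : HasDerivAt (fun x : ℝ => (x, alphaStar n r)) (1, 0) n :=
      (hasDerivAt_id n).prodMk (hasDerivAt_const n _)
    have h2 := HasFDerivAt.comp_hasDerivAt (f := fun x : ℝ => (x, alphaStar n r)) n hF h1
    exact h2.unique (hasDerivAt_quality_left hn hr)
  have p2 : F' (0, 1) = 0 := by
    have h1 : HasDerivAt (fun x : ℝ => (n, x)) (0, 1) (alphaStar n r) :=
      (hasDerivAt_const _ n).prodMk (hasDerivAt_id _)
    have h2 := HasFDerivAt.comp_hasDerivAt (f := fun x : ℝ => (n, x)) (alphaStar n r) hF h1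
    have h3 := h2.unique (hasDerivAt_quality hn hr hα hβ)
    rw [h3, (alphaStar_spec hn hr).2, mul_zero]
  have hev : ∀ᶠ x in 𝓝 n, 2 < x := lt_mem_nhds hn
  have hO : (fun x => (x, alphaStar x r) - (n, alphaStar n r)) =O[𝓝 n] fun x => x - n := by
    refine Asymptotics.IsBigO.of_bound 1 ?_
    filter_upwards [hev] with x hx
    rw [one_mul, Prod.mk_sub_mk, Prod.norm_mk]
    exact max_le le_rfl (abs_alphaStar_sub_le hn hx hr)
  have ht : Tendsto (fun x => (x, alphaStar x r)) (𝓝 n) (𝓝 (n, alphaStar n r)) := by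
    rw [tendsto_iff_norm_sub_tendsto_zero]
    refine (hO.trans_tendsto ?_).norm.trans (by simp)
    have : Tendsto (fun x => x - n) (𝓝 n) (𝓝 (n - n)) :=
      (continuous_id.sub continuous_const).tendsto n
    simpa using this
  rw [hasDerivAt_iff_isLittleO]
  refine ((hF.isLittleO.comp_tendsto ht).trans_isBigO hO).congr' ?_ EventuallyEq.rfl
  filter_upwards [hev] with x hx
  have e : (x, alphaStar x r) - (n, alphaStar n r)
      = (x - n) • ((1 : ℝ), (0 : ℝ)) + (alphaStar x r - alphaStar n r) • ((0 : ℝ), (1 : ℝ)) := by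
    simp
  simp only [Function.comp]
  rw [e, map_add, map_smul, map_smul, p1, p2, smul_zero, add_zero, g_sq hx hr, g_sq hn hr]

lemma deriv_g_sq_nonneg {n r : ℝ} (hn : 2 < n) (hr : 0 ≤ r) :
    0 ≤ rho r (alphaStar n r) (betaStar n r) ^ 3 * defect (betaStar n r) := by
  have := one_add_wfun_pos hn hr
  have := defect_nonneg (betaStar_mem hn hr)
  unfold rho; positivity

lemma deriv_g_sq_antitone {n n' r : ℝ} (hn : 2 < n) (hr : 0 ≤ r) (h : n ≤ n') :
    rho r (alphaStar n' r) (betaStar n' r) ^ 3 * defect (betaStar n' r)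
      ≤ rho r (alphaStar n r) (betaStar n r) ^ 3 * defect (betaStar n r) := by
  have hn' := hn.trans_le h
  obtain ⟨h1, h2⟩ := star_antitone hn hr h
  have p := one_add_wfun_pos hn hr
  have p' := one_add_wfun_pos hn' hr
  have hw := strictAntiOn_wfun.antitoneOn (betaStar_mem hn' hr) (betaStar_mem hn hr) h2
  have hc : cos (alphaStar n r) ≤ cos (alphaStar n' r) :=
    cos_le_cos_of_nonneg_of_le_pi (alphaStar_mem hn' hr).1.le
      (by linarith [(alphaStar_mem hn hr).2, pi_pos]) h1
  have hρ : rho r (alphaStar n' r) (betaStar n' r) ≤ rho r (alphaStar n r) (betaStar n r) := by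
    unfold rho; gcongr
  have hd := monotoneOn_defect (betaStar_mem hn' hr) (betaStar_mem hn hr) h2
  have h0 := defect_nonneg (betaStar_mem hn' hr)
  have h3 : 0 ≤ rho r (alphaStar n' r) (betaStar n' r) := by unfold rho; positivity
  have h4 : 0 ≤ rho r (alphaStar n r) (betaStar n r) := h3.trans hρ
  gcongr

lemma concaveOn_g_sq {r : ℝ} (hr : 0 ≤ r) : ConcaveOn ℝ (Ioi 2) fun x => g x r ^ 2 := by
  refine AntitoneOn.concaveOn_of_deriv (convex_Ioi 2)
    (fun x hx => (hasDerivAt_g_sq hx hr).continuousAt.continuousWithinAt)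
    (fun x hx => (hasDerivAt_g_sq (interior_subset hx) hr).differentiableAt.differentiableWithinAt)
    ?_
  rw [interior_Ioi]
  intro x hx y hy h
  rw [(hasDerivAt_g_sq hx hr).deriv, (hasDerivAt_g_sq hy hr).deriv]
  exact deriv_g_sq_antitone hx hr h

lemma g_sq_le_tangent {x r : ℝ} (hr : 0 ≤ r) (hx : 2 < x) :
    ∃ D, 0 ≤ D ∧ ∀ y, x ≤ y → g y r ^ 2 ≤ g x r ^ 2 + D * (y - x) := by
  refine ⟨_, deriv_g_sq_nonneg hx hr, fun y hy => ?_⟩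
  rcases hy.eq_or_lt with h | h
  · simp [h]
  · have h1 := (concaveOn_g_sq hr).slope_le_of_hasDerivAt (x := x) (y := y) hx
      (hx.trans_le hy) h (hasDerivAt_g_sq hx hr)
    rw [slope_def_field, div_le_iff₀ (by linarith)] at h1
    linarith

lemma g_mono {x y r : ℝ} (hr : 0 ≤ r) (hx : 2 < x) (h : x ≤ y) : g x r ≤ g y r := by
  have h1 : MonotoneOn (fun x => g x r ^ 2) (Ioi 2) := by
    refine monotoneOn_of_deriv_nonneg (convex_Ioi 2)
      (fun x hx => (hasDerivAt_g_sq hx hr).continuousAt.continuousWithinAt)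
      (fun x hx =>
        (hasDerivAt_g_sq (interior_subset hx) hr).differentiableAt.differentiableWithinAt)
      fun x hx => ?_
    have hx' : 2 < x := interior_subset hx
    rw [(hasDerivAt_g_sq hx' hr).deriv]
    exact deriv_g_sq_nonneg hx' hr
  have := h1 hx (hx.trans_le h) h
  exact (sq_le_sq₀ (g_pos hx hr).le (g_pos (hx.trans_le h) hr).le).1 this

/-! ### Averaged costs -/

lemma sum_g_sq_le {ι : Type} {r : ℝ} (hr : 0 ≤ r) (T : Finset ι) (n : ι → ℕ) (hT : T.Nonempty)
    (hn : ∀ i ∈ T, 3 ≤ n i) :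
    ∑ i ∈ T, g (n i) r ^ 2 ≤ T.card * g (meanSides T n) r ^ 2 := by
  have hc : 0 < (T.card : ℝ) := by exact_mod_cast hT.card_pos
  have := (concaveOn_g_sq hr).le_map_sum (t := T) (w := fun _ => 1 / (T.card : ℝ))
    (p := fun i => (n i : ℝ)) (fun _ _ => by positivity) (by simp; field_simp)
    (fun i hi => by
      have : (3 : ℝ) ≤ n i := by exact_mod_cast hn i hi
      simp only [mem_Ioi]; linarith)
  simp only [smul_eq_mul, ← Finset.mul_sum] at this
  unfold meanSides
  rw [one_div, inv_mul_le_iff₀ hc] at this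
  rwa [div_eq_inv_mul]

lemma three_le_meanSides {ι : Type} (T : Finset ι) (n : ι → ℕ) (hT : T.Nonempty)
    (hn : ∀ i ∈ T, 3 ≤ n i) : 3 ≤ meanSides T n := by
  have hc : 0 < (T.card : ℝ) := by exact_mod_cast hT.card_pos
  unfold meanSides
  rw [le_div_iff₀ hc]
  calc (3 : ℝ) * T.card = ∑ i ∈ T, (3 : ℝ) := by simp [mul_comm]
    _ ≤ _ := Finset.sum_le_sum fun i hi => by exact_mod_cast hn i hi

/-- Hölder's inequality combines the areas with the weights `g(n_i)`, and Jensen's inequality for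
the concave function `g²` replaces the `n_i` by their mean. -/
lemma costBound_le_averagedCost {ι : Type} {r : ℝ} (hr : 0 ≤ r) (T : Finset ι) (n : ι → ℕ)
    (a : ι → ℝ) (hT : T.Nonempty) (hn : ∀ i ∈ T, 3 ≤ n i) (ha : ∀ i ∈ T, 0 < a i) :
    costBound r T a (meanSides T n) ≤ averagedCost r T n a := by
  have hc : 0 < (T.card : ℝ) := by exact_mod_cast hT.card_pos
  have hA : 0 < ∑ i ∈ T, a i := Finset.sum_pos ha hT
  have hg : ∀ i ∈ T, 0 < g (n i) r := fun i hi => g_pos (by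
    have : (3 : ℝ) ≤ n i := by exact_mod_cast hn i hi
    linarith) hr
  have hm : 0 < g (meanSides T n) r := g_pos (by linarith [three_le_meanSides T n hT hn]) hr
  set G := g (meanSides T n) r with hG
  set A := ∑ i ∈ T, a i with hAdef
  set X := ∑ i ∈ T, a i ^ (3 / 2 : ℝ) / g (n i) r with hX
  have hXpos : 0 < X := Finset.sum_pos (fun i hi => by
    have := ha i hi; have := hg i hi; positivity) hT
  have hHol : A ≤ X ^ (2 / 3 : ℝ) * (∑ i ∈ T, g (n i) r ^ 2) ^ (1 / 3 : ℝ) := by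
    have h := Real.inner_le_Lp_mul_Lq_of_nonneg T (p := 3 / 2) (q := 3)
      (f := fun i => a i * g (n i) r ^ (-(2 / 3) : ℝ)) (g := fun i => g (n i) r ^ (2 / 3 : ℝ))
      (by constructor <;> norm_num)
      (fun i hi => by have := ha i hi; have := hg i hi; positivity)
      (fun i hi => by have := hg i hi; positivity)
    have e1 : ∑ i ∈ T, a i * g (n i) r ^ (-(2 / 3) : ℝ) * g (n i) r ^ (2 / 3 : ℝ) = A := by
      refine Finset.sum_congr rfl fun i hi => ?_
      rw [mul_assoc, ← rpow_add (hg i hi)]; simp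
    have e2 : ∑ i ∈ T, (a i * g (n i) r ^ (-(2 / 3) : ℝ)) ^ (3 / 2 : ℝ) = X := by
      refine Finset.sum_congr rfl fun i hi => ?_
      have := hg i hi
      rw [mul_rpow (ha i hi).le (by positivity), ← rpow_mul this.le]
      norm_num [rpow_neg_one, div_eq_mul_inv]
    have e3 : ∑ i ∈ T, (g (n i) r ^ (2 / 3 : ℝ)) ^ (3 : ℝ) = ∑ i ∈ T, g (n i) r ^ 2 := by
      refine Finset.sum_congr rfl fun i hi => ?_
      rw [← rpow_mul (hg i hi).le]; norm_num
    rw [e1, e2, e3] at h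
    convert h using 2
    norm_num
  have hJ := sum_g_sq_le hr T n hT hn
  have h1 : A ≤ X ^ (2 / 3 : ℝ) * (T.card * G ^ 2) ^ (1 / 3 : ℝ) := by
    exact hHol.trans (mul_le_mul_of_nonneg_left (rpow_le_rpow
      (Finset.sum_nonneg fun i _ => sq_nonneg _) hJ (by norm_num)) (rpow_nonneg hXpos.le _))
  have h2 : A ^ 3 ≤ X ^ 2 * (T.card * G ^ 2) := by
    calc A ^ 3 ≤ (X ^ (2 / 3 : ℝ) * (T.card * G ^ 2) ^ (1 / 3 : ℝ)) ^ 3 :=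
          pow_le_pow_left₀ hA.le h1 3
      _ = _ := by
        rw [mul_pow, ← rpow_natCast, ← rpow_natCast, ← rpow_mul hXpos.le,
          ← rpow_mul (by positivity)]
        norm_num
  have h3 : averagedCost r T n a = X / A := by
    unfold averagedCost
    rw [hX, Finset.sum_div]
    exact Finset.sum_congr rfl fun i _ => by rw [div_div, mul_comm]
  rw [h3]
  unfold costBound
  refine le_of_sq_le_sq ?_ (by positivity)
  rw [div_pow, mul_pow, sq_sqrt hA.le, sq_sqrt hc.le, div_pow,
    div_le_div_iff₀ (by positivity) (by positivity)]
  calc A * A ^ 2 = A ^ 3 := by ring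
    _ ≤ _ := h2

/-! ### The minimal cost of a cyclic polygon -/

lemma integral_inv_cos_cube {θ : ℝ} (h : θ ∈ Ioo 0 (π / 2)) :
    ∫ t in (-θ)..θ, 1 / cos t ^ 3 = sin θ / cos θ ^ 2 + gdInv θ := by
  have hmem : ∀ t ∈ uIcc (-θ) θ, t ∈ Ioo (-(π / 2)) (π / 2) := by
    intro t ht
    rw [uIcc_of_le (by linarith [h.1])] at ht
    exact ⟨by linarith [ht.1, h.2], by linarith [ht.2, h.2]⟩
  have hd : ∀ t ∈ uIcc (-θ) θ,
      HasDerivAt (fun t => (sin t / cos t ^ 2 + gdInv t) / 2) (1 / cos t ^ 3) t := by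
    intro t ht
    have hc := cos_pos_of_mem_Ioo (hmem t ht)
    refine ((((hasDerivAt_sin t).div ((hasDerivAt_cos t).pow 2) (pow_ne_zero 2 hc.ne')).add
      (hasDerivAt_gdInv (hmem t ht))).div_const 2).congr_deriv ?_
    simp only [Pi.pow_apply]
    have e := sin_sq_add_cos_sq t
    field_simp
    push_cast
    linear_combination 2 * cos t * e
  have hint : IntervalIntegrable (fun t => 1 / cos t ^ 3) MeasureTheory.volume (-θ) θ := by
    refine ContinuousOn.intervalIntegrable ?_
    exact continuousOn_const.div (by fun_prop) fun t ht =>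
      pow_ne_zero 3 (cos_pos_of_mem_Ioo (hmem t ht)).ne'
  rw [intervalIntegral.integral_eq_sub_of_hasDerivAt hd hint, gdInv_neg, sin_neg, cos_neg]
  ring

lemma cos_cube_mul_integral {θ : ℝ} (h : θ ∈ Ioo 0 (π / 2)) :
    cos θ ^ 3 * ∫ t in (-θ)..θ, 1 / cos t ^ 3 = 3 * triMoment θ := by
  have := cos_pos_of_mem h
  rw [integral_inv_cos_cube h]
  unfold triMoment
  field_simp

lemma sqrt_quality {n r α : ℝ} (hn : 2 < n) (hr : 0 ≤ r) (hα : α ∈ Ioo 0 (π / 2))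
    (hβ : otherAngle n α ∈ Ioo 0 (π / 2)) :
    √(quality n r α) = unitArea n α * √(unitArea n α) / unitCost n r α := by
  have h1 := unitArea_pos hn hα hβ
  have h2 := unitCost_pos hn hr hα hβ
  rw [sqrt_eq_iff_mul_self_eq (by unfold quality; positivity) (by positivity)]
  unfold quality
  have := mul_self_sqrt h1.le
  field_simp
  rw [sq, this]

lemma g_eq_sqrt {n r : ℝ} (hn : 2 < n) (hr : 0 ≤ r) :
    g n r = √(quality n r (alphaStar n r)) := by
  rw [← g_sq hn hr, sqrt_sq (g_pos hn hr).le]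

lemma IsAdmissible.eq_otherAngle {n : ℕ} {A α β R : ℝ} (h : IsAdmissible n A α β R)
    (hn : 3 ≤ n) : β = otherAngle n α := by
  have hn' : (3 : ℝ) ≤ n := by exact_mod_cast hn
  have := h.angle_sum
  unfold otherAngle
  rw [eq_div_iff (by linarith)]
  linarith

/-- The cost of a cyclic polygon of given area depends on its shape through `quality` only. -/
lemma regionCost_eq {κ f r : ℝ} {n : ℕ} {A α β R : ℝ} (hn : 3 ≤ n) (hr : 0 ≤ r)
    (h : IsAdmissible n A α β R) :
    regionCost κ f r n A α β R = κ * f * √A / √(quality n r α) := by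
  have hn' : (2 : ℝ) < n := by
    have : (3 : ℝ) ≤ n := by exact_mod_cast hn
    linarith
  obtain ⟨hα, hβ⟩ := mem_dom_of_mem_Ico hn' h.angle_mem
  have hS := unitArea_pos hn' hα hβ
  have hB := unitCost_pos hn' hr hα hβ
  have hR := h.radius_pos
  have hA : A = R ^ 2 * unitArea n α := by
    rw [← h.area_eq, h.eq_otherAngle hn]
    unfold unitArea
    rw [sin_two_mul (otherAngle n α)]; ring
  have hk := cos_cube_mul_integral hα
  have hk' := cos_cube_mul_integral hβ
  have e : regionCost κ f r n A α β R = κ * f * (R ^ 3 * unitCost n r α) / A := by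
    rw [h.eq_otherAngle hn]
    unfold regionCost unitCost
    rw [mul_comm (1 / A), mul_one_div]
    congr 1
    rw [hA]
    linear_combination (1 / 3 * (n - 2) * κ * f * R ^ 3) * hk' + (2 / 3 * κ * f * R ^ 3) * hk
  rw [e, sqrt_quality hn' hr hα hβ, hA, sqrt_mul (by positivity), sqrt_sq hR.le]
  have := sqrt_pos.2 hS
  field_simp

lemma isAdmissible_star {n : ℕ} {r A : ℝ} (hn : 3 ≤ n) (hr : 0 ≤ r) (hA : 0 < A) :
    IsAdmissible n A (alphaStar n r) (betaStar n r) (radiusStar n r A) := by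
  have hn' : (2 : ℝ) < n := by
    have : (3 : ℝ) ≤ n := by exact_mod_cast hn
    linarith
  have hS := unitArea_star_pos hn' hr
  have e : (n - 2) * sin (betaStar n r) * cos (betaStar n r) + sin (2 * alphaStar n r)
      = unitArea n (alphaStar n r) := by
    unfold unitArea betaStar; ring
  have hR : radiusStar n r A = √A / √(unitArea n (alphaStar n r)) := by
    unfold radiusStar; rw [e]
  refine ⟨(alphaStar_spec hn' hr).1, (betaStar_mem hn' hr).1, betaStar_mul r hn', ?_, ?_⟩
  · rw [hR]
    have := sqrt_pos.2 hA; have := sqrt_pos.2 hS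
    positivity
  · have e2 : ((n : ℝ) - 2) / 2 * radiusStar n r A ^ 2 * sin (2 * betaStar n r)
        + radiusStar n r A ^ 2 * sin (2 * alphaStar n r)
        = radiusStar n r A ^ 2 * unitArea n (alphaStar n r) := by
      rw [← e, sin_two_mul (betaStar n r)]; ring
    rw [e2, hR, div_pow, sq_sqrt hA.le, sq_sqrt hS.le]
    field_simp

lemma regionCost_star {κ f r A : ℝ} {n : ℕ} (hn : 3 ≤ n) (hr : 0 ≤ r) (hA : 0 < A) :
    regionCost κ f r n A (alphaStar n r) (betaStar n r) (radiusStar n r A)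
      = κ * f * √A / g n r := by
  have hn' : (2 : ℝ) < n := by
    have : (3 : ℝ) ≤ n := by exact_mod_cast hn
    linarith
  rw [regionCost_eq hn hr (isAdmissible_star hn hr hA), g_eq_sqrt hn' hr]

lemma le_regionCost {κ f r A α β R : ℝ} {n : ℕ} (hκ : 0 < κ) (hf : 0 < f) (hn : 3 ≤ n)
    (hr : 0 ≤ r) (h : IsAdmissible n A α β R) :
    κ * f * √A / g n r ≤ regionCost κ f r n A α β R := by
  have hn' : (2 : ℝ) < n := by
    have : (3 : ℝ) ≤ n := by exact_mod_cast hn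
    linarith
  obtain ⟨hα, hβ⟩ := mem_dom_of_mem_Ico hn' h.angle_mem
  rw [regionCost_eq hn hr h]
  have h1 : 0 < quality n r α :=
    div_pos (pow_pos (unitArea_pos hn' hα hβ) 3) (pow_pos (unitCost_pos hn' hr hα hβ) 2)
  have h2 : √(quality n r α) ≤ g n r :=
    sqrt_le_iff.2 ⟨(g_pos hn' hr).le, quality_le hn' hr hα hβ⟩
  have := sqrt_pos.2 h1
  gcongr

/-! ### The trade-off between set-up and transportation costs -/

lemma zUb_pos {κ f r : ℝ} (hκ : 0 < κ) (hf : 0 < f) (hr : 0 ≤ r) : 0 < zUb κ f r := by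
  have := g_pos (n := 6) (by norm_num) hr
  unfold zUb; positivity

/-- The inequality of arithmetic and geometric means for one set-up and two halves of the
transportation cost. -/
lemma zUb_le {κ f r a : ℝ} (hκ : 0 < κ) (hf : 0 < f) (hr : 0 ≤ r) (ha : 0 < a) :
    zUb κ f r ≤ f / a + κ * f * √a / g 6 r := by
  have hg := g_pos (n := 6) (by norm_num) hr
  set x := f / a with hx
  set y := κ * f * √a / (2 * g 6 r) with hy
  have hx0 : 0 < x := by positivity
  have hy0 : 0 < y := by have := sqrt_pos.2 ha; positivity
  have e1 : κ ^ 2 * f ^ 3 / (4 * g 6 r ^ 2) = x * y ^ 2 := by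
    rw [hx, hy, div_pow, mul_pow, mul_pow, mul_pow, sq_sqrt ha.le]; field_simp; ring
  have e2 : f / a + κ * f * √a / g 6 r = x + 2 * y := by rw [hx, hy]; field_simp
  rw [e2]
  unfold zUb
  rw [e1]
  have ht : ((x * y ^ 2) ^ (1 / 3 : ℝ)) ^ 3 = x * y ^ 2 := by
    rw [← rpow_natCast, ← rpow_mul (by positivity)]; norm_num
  set t := (x * y ^ 2) ^ (1 / 3 : ℝ)
  refine le_of_pow_le_pow_left₀ (n := 3) (by norm_num) (by positivity) ?_
  rw [mul_pow, ht]
  have : 0 ≤ (x - y) ^ 2 * (x + 8 * y) := by positivity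
  linear_combination this

lemma hexArea_pos {κ r : ℝ} (hκ : 0 < κ) (hr : 0 ≤ r) : 0 < hexArea κ r := by
  have := g_pos (n := 6) (by norm_num) hr
  unfold hexArea; positivity

lemma hexArea_mul_sqrt {κ r : ℝ} (hκ : 0 < κ) (hr : 0 ≤ r) :
    hexArea κ r * √(hexArea κ r) = 2 * g 6 r / κ := by
  have hg := g_pos (n := 6) (by norm_num) hr
  have h := hexArea_pos hκ hr
  have e : hexArea κ r * √(hexArea κ r) = hexArea κ r ^ (3 / 2 : ℝ) := by
    rw [sqrt_eq_rpow, ← rpow_one_add' h.le (by norm_num)]; norm_num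
  rw [e]
  unfold hexArea
  rw [mul_rpow (by positivity) (by positivity), ← rpow_mul (by positivity), ← rpow_mul hg.le]
  norm_num [rpow_neg_one]
  field_simp

lemma hexArea_cost {κ f r : ℝ} (hκ : 0 < κ) (hf : 0 < f) (hr : 0 ≤ r) :
    f / hexArea κ r + κ * f * √(hexArea κ r) / g 6 r = zUb κ f r := by
  have hg := g_pos (n := 6) (by norm_num) hr
  have h := hexArea_pos hκ hr
  have h1 := hexArea_mul_sqrt hκ hr
  have hs := sqrt_pos.2 h
  -- at the optimal area the transportation cost is twice the set-up cost
  have e1 : κ * f * √(hexArea κ r) / g 6 r = 2 * (f / hexArea κ r) := by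
    field_simp at h1 ⊢
    linarith
  have e2 : κ ^ 2 * f ^ 3 / (4 * g 6 r ^ 2) = (f / hexArea κ r) ^ 3 := by
    have e3 : hexArea κ r ^ 3 = 4 * g 6 r ^ 2 / κ ^ 2 := by
      have := sq_sqrt h.le
      calc hexArea κ r ^ 3 = (hexArea κ r * √(hexArea κ r)) ^ 2 := by rw [mul_pow, this]; ring
        _ = _ := by rw [h1]; ring
    rw [div_pow, e3]; field_simp
  unfold zUb
  rw [e1, e2, ← rpow_natCast, ← rpow_mul (by positivity)]
  norm_num
  ring

lemma totalCost_eq {ι : Type} (κ f r : ℝ) (T : Finset ι) (n : ι → ℕ) (a : ι → ℝ) :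
    totalCost κ f r T n a
      = T.card * f / (∑ i ∈ T, a i) + κ * f * averagedCost r T n a := by
  unfold totalCost averagedCost
  rw [Finset.mul_sum]
  congr 1
  exact Finset.sum_congr rfl fun i _ => by ring

lemma costBound_eq {ι : Type} (r : ℝ) (T : Finset ι) (a : ι → ℝ) (x : ℝ)
    (ha : 0 ≤ ∑ i ∈ T, a i) : costBound r T a x = √((∑ i ∈ T, a i) / T.card) / g x r := by
  unfold costBound
  rw [sqrt_div ha, div_div]

/-- A bound on the mean number of sides bounds the total cost; `ε` may exceed `1`, in which case the
left side is not positive. -/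
lemma le_totalCost {ι : Type} {κ f r ε : ℝ} (hκ : 0 < κ) (hf : 0 < f) (hr : 0 ≤ r) (hε : 0 ≤ ε)
    (T : Finset ι) (n : ι → ℕ) (a : ι → ℝ) (hT : T.Nonempty) (hn : ∀ i ∈ T, 3 ≤ n i)
    (ha : ∀ i ∈ T, 0 < a i)
    (h : (1 - ε) * costBound r T a 6 ≤ costBound r T a (meanSides T n)) :
    (1 - ε) * zUb κ f r ≤ totalCost κ f r T n a := by
  have hc : 0 < (T.card : ℝ) := by exact_mod_cast hT.card_pos
  have hA : 0 < ∑ i ∈ T, a i := Finset.sum_pos ha hT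
  have h1 := costBound_le_averagedCost hr T n a hT hn ha
  have h2 : 0 ≤ costBound r T a (meanSides T n) := by
    have := g_pos (n := meanSides T n) (by linarith [three_le_meanSides T n hT hn]) hr
    unfold costBound; positivity
  rw [totalCost_eq]
  have hx : 0 ≤ T.card * f / (∑ i ∈ T, a i) := by positivity
  rcases le_total 1 ε with h3 | h3
  · have h4 := zUb_pos hκ hf hr
    have h5 : 0 ≤ κ * f * averagedCost r T n a :=
      mul_nonneg (by positivity) (h2.trans h1)
    nlinarith
  · have h4 := zUb_le (a := (∑ i ∈ T, a i) / T.card) hκ hf hr (by positivity)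
    have e1 : f / ((∑ i ∈ T, a i) / T.card) = T.card * f / (∑ i ∈ T, a i) := by field_simp
    have e2 : κ * f * √((∑ i ∈ T, a i) / T.card) / g 6 r = κ * f * costBound r T a 6 := by
      rw [costBound_eq r T a 6 hA.le]; ring
    rw [e1, e2] at h4
    have h5 := mul_le_mul_of_nonneg_left h4 (sub_nonneg.2 h3)
    have h6 := mul_le_mul_of_nonneg_left (h.trans h1) (mul_pos hκ hf).le
    have h7 : (1 - ε) * (T.card * f / (∑ i ∈ T, a i)) ≤ T.card * f / (∑ i ∈ T, a i) := by
      nlinarith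
    linarith

lemma costBound_anti {ι : Type} {r x y : ℝ} (hr : 0 ≤ r) (T : Finset ι) (a : ι → ℝ)
    (hT : T.Nonempty) (hx : 2 < x) (h : x ≤ y) : costBound r T a y ≤ costBound r T a x := by
  have hc : 0 < (T.card : ℝ) := by exact_mod_cast hT.card_pos
  have := g_pos hx hr
  have := g_mono hr hx h
  unfold costBound
  gcongr

/-- If the mean number of sides hardly exceeds `6`, then the cost bound hardly falls below its
value for hexagons. -/
lemma exists_costBound_le {r ε : ℝ} (hr : 0 ≤ r) (hε : 0 < ε) :
    ∃ δ > 0, ∀ (ι : Type) (T : Finset ι) (a : ι → ℝ) (x : ℝ), T.Nonempty → 2 < x → x ≤ 6 + δ →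
      (1 - ε) * costBound r T a 6 ≤ costBound r T a x := by
  have hg := g_pos (n := 6) (by norm_num) hr
  -- the tangent at `6` to the concave function `g²` bounds its growth
  obtain ⟨D, hD, h⟩ := g_sq_le_tangent (x := 6) hr (by norm_num)
  refine ⟨2 * ε * g 6 r ^ 2 / (D + 1), by positivity, fun ι T a x hT hx hxδ => ?_⟩
  have hc : 0 < (T.card : ℝ) := by exact_mod_cast hT.card_pos
  have hgx := g_pos hx hr
  have key : (1 - ε) * g x r ≤ g 6 r := by
    rcases le_total 1 ε with h1 | h1
    · nlinarith
    rcases le_total x 6 with h6 | h6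
    · have := g_mono hr hx h6
      nlinarith
    · have h2 := h x h6
      have h3 : D * (x - 6) ≤ 2 * ε * g 6 r ^ 2 := by
        calc D * (x - 6) ≤ (D + 1) * (2 * ε * g 6 r ^ 2 / (D + 1)) := by
              gcongr
              · linarith
              · linarith
          _ = _ := by field_simp
      refine le_of_sq_le_sq ?_ hg.le
      have h4 : (1 - ε) ^ 2 * (1 + 2 * ε) ≤ 1 := by nlinarith [sq_nonneg ε]
      calc ((1 - ε) * g x r) ^ 2 = (1 - ε) ^ 2 * g x r ^ 2 := by ring
        _ ≤ (1 - ε) ^ 2 * (g 6 r ^ 2 * (1 + 2 * ε)) := by gcongr; linarith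
        _ = (1 - ε) ^ 2 * (1 + 2 * ε) * g 6 r ^ 2 := by ring
        _ ≤ 1 * g 6 r ^ 2 := by gcongr
        _ = _ := one_mul _
  unfold costBound
  rw [mul_div_assoc', div_le_div_iff₀ (by positivity) (by positivity)]
  have : 0 ≤ √(∑ i ∈ T, a i) * √(T.card : ℝ) := by positivity
  calc (1 - ε) * √(∑ i ∈ T, a i) * (√(T.card : ℝ) * g x r)
      = √(∑ i ∈ T, a i) * √(T.card : ℝ) * ((1 - ε) * g x r) := by ring
    _ ≤ √(∑ i ∈ T, a i) * √(T.card : ℝ) * g 6 r := by gcongr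
    _ = _ := by ring

lemma hexagons_equality {κ f r : ℝ} (hκ : 0 < κ) (hf : 0 < f) (hr : 0 ≤ r) (N : ℕ)
    (n : Fin N → ℕ) (a : Fin N → ℝ) (hN : 1 ≤ N) (hn : ∀ i, n i = 6) (ha : ∀ i, 0 < a i) :
    costBound r Finset.univ a (meanSides Finset.univ n) = costBound r Finset.univ a 6 ∧
      ((∀ i j, a i = a j) →
        averagedCost r Finset.univ n a = costBound r Finset.univ a 6) ∧
      ((∀ i, a i = hexArea κ r) → totalCost κ f r Finset.univ n a = zUb κ f r) := by
  have hN' : 0 < (N : ℝ) := by exact_mod_cast hN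
  have hg := g_pos (n := 6) (by norm_num) hr
  have hmean : meanSides Finset.univ n = 6 := by
    unfold meanSides; simp [hn]; field_simp
  have havg : ∀ b : ℝ, 0 < b → (∀ i, a i = b) → averagedCost r Finset.univ n a = √b / g 6 r := by
    intro b hb h
    unfold averagedCost
    have e : b ^ (3 / 2 : ℝ) = b * √b := by
      rw [sqrt_eq_rpow, ← rpow_one_add' hb.le (by norm_num)]; norm_num
    simp only [h, hn, Finset.sum_const, Finset.card_univ, Fintype.card_fin, nsmul_eq_mul, e]
    push_cast
    field_simp
  refine ⟨by rw [hmean], fun h => ?_, fun h => ?_⟩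
  · have i0 : Fin N := ⟨0, hN⟩
    have hb := ha i0
    rw [havg (a i0) hb fun i => h i i0, costBound_eq]
    · simp only [h _ i0, Finset.sum_const, Finset.card_univ, Fintype.card_fin, nsmul_eq_mul]
      congr 2
      field_simp
    · exact Finset.sum_nonneg fun i _ => (ha i).le
  · rw [totalCost_eq, havg _ (hexArea_pos hκ hr) h, ← hexArea_cost hκ hf hr]
    have := hexArea_pos hκ hr
    simp only [h, Finset.sum_const, Finset.card_univ, Fintype.card_fin, nsmul_eq_mul]
    field_simp
end Transshipment

namespace Transshipment
open Real Set Filter Topology MeasureTheory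

/-! ### Areas of sectors and half discs -/

/-- The unit vector in direction `ψ`. -/
noncomputable def dir (ψ : ℝ) : Plane := !₂[cos ψ, sin ψ]

lemma plane_ext {x y : Plane} (h0 : x 0 = y 0) (h1 : x 1 = y 1) : x = y := by
  ext i; fin_cases i <;> assumption

lemma inner_plane (x y : Plane) : inner ℝ x y = x 0 * y 0 + x 1 * y 1 := by
  rw [PiLp.inner_apply]; simp [Fin.sum_univ_two, mul_comm]

lemma norm_sq_plane (x : Plane) : ‖x‖ ^ 2 = x 0 ^ 2 + x 1 ^ 2 := by
  rw [← real_inner_self_eq_norm_sq, inner_plane]; ring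

lemma inner_dir (a b : ℝ) : inner ℝ (dir a) (dir b) = cos (a - b) := by
  rw [inner_plane, cos_sub]; rfl

@[simp] lemma norm_dir (a : ℝ) : ‖dir a‖ = 1 := by
  rw [← sq_eq_sq₀ (norm_nonneg _) zero_le_one, ← real_inner_self_eq_norm_sq, inner_dir]; simp

@[simp] lemma dir_add_two_pi (a : ℝ) : dir (a + 2 * π) = dir a := by
  unfold dir; simp

lemma dir_add_int_mul (a : ℝ) (k : ℤ) : dir (a + k * (2 * π)) = dir a := by
  unfold dir; simp

lemma exists_dir (x : Plane) : ∃ ψ, x = ‖x‖ • dir ψ := by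
  let z : ℂ := ⟨x 0, x 1⟩
  have hz : ‖z‖ = ‖x‖ := by
    rw [← sq_eq_sq₀ (norm_nonneg _) (norm_nonneg _), norm_sq_plane, Complex.sq_norm,
      Complex.normSq_apply]
    simp only [z]; ring
  refine ⟨z.arg, plane_ext ?_ ?_⟩
  · change x 0 = ‖x‖ * cos z.arg
    rw [← hz, Complex.norm_mul_cos_arg]
  · change x 1 = ‖x‖ * sin z.arg
    rw [← hz, Complex.norm_mul_sin_arg]

/-- A direction between two others is a positive combination of them. -/
lemma dir_eq_combination {a b ψ : ℝ} (h : sin (b - a) ≠ 0) :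
    dir ψ = (sin (b - ψ) / sin (b - a)) • dir a + (sin (ψ - a) / sin (b - a)) • dir b := by
  refine plane_ext ?_ ?_
  · change cos ψ = sin (b - ψ) / sin (b - a) * cos a + sin (ψ - a) / sin (b - a) * cos b
    field_simp
    rw [sin_sub, sin_sub, sin_sub]; ring
  · change sin ψ = sin (b - ψ) / sin (b - a) * sin a + sin (ψ - a) / sin (b - a) * sin b
    field_simp
    rw [sin_sub, sin_sub, sin_sub]; ring

/-- The complex plane as the Euclidean plane. -/
noncomputable def ofComplex : ℂ ≃ₗᵢ[ℝ] Plane := Complex.orthonormalBasisOneI.repr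

lemma ofComplex_apply (z : ℂ) : ofComplex z = !₂[z.re, z.im] := by
  ext i
  unfold ofComplex
  rw [Complex.orthonormalBasisOneI_repr_apply]

lemma ofComplex_polar (p : ℝ × ℝ) : ofComplex (Complex.polarCoord.symm p) = p.1 • dir p.2 := by
  rw [ofComplex_apply, Complex.polarCoord_symm_apply]
  refine plane_ext ?_ ?_
  · simp; exact Or.inl (Complex.cos_ofReal_re _)
  · simp; exact Or.inl (Complex.sin_ofReal_re _)

lemma lintegral_polar (F : Plane → ENNReal) :
    ∫⁻ p in polarCoord.target, ENNReal.ofReal p.1 * F (p.1 • dir p.2) = ∫⁻ y, F y := by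
  rw [← ofComplex.measurePreserving.lintegral_comp_emb
    ofComplex.toHomeomorph.measurableEmbedding F, ← Complex.lintegral_comp_polarCoord_symm]
  simp only [ofComplex_polar, smul_eq_mul]

lemma integral_polar (F : Plane → ℝ) :
    ∫ p in polarCoord.target, p.1 * F (p.1 • dir p.2) = ∫ y, F y := by
  rw [← ofComplex.measurePreserving.integral_comp
    ofComplex.toHomeomorph.measurableEmbedding F, ← Complex.integral_comp_polarCoord_symm]
  simp only [ofComplex_polar, smul_eq_mul]

/-- Rotation of the plane by the angle `γ`. -/
noncomputable def rot (γ : ℝ) : Plane ≃ₗᵢ[ℝ] Plane :=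
  ofComplex.symm.trans ((rotation (Circle.exp γ)).trans ofComplex)

lemma rot_dir (γ ψ : ℝ) : rot γ (dir ψ) = dir (ψ + γ) := by
  have h : ∀ a : ℝ, ofComplex (Complex.exp (a * Complex.I)) = dir a := by
    intro a
    rw [ofComplex_apply]
    refine plane_ext ?_ ?_
    · exact Complex.exp_ofReal_mul_I_re a
    · exact Complex.exp_ofReal_mul_I_im a
  unfold rot
  rw [← h, ← h]
  simp [Circle.coe_exp, ← Complex.exp_add, add_mul, add_comm]

/-- A set containing the sector of radius `δ` between the directions `-w` and `w` has at least its
area. -/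
lemma volume_sector_zero {w δ : ℝ} (hw : w ≤ π) (hδ : 0 ≤ δ) (A : Set Plane)
    (hA : ∀ ρ ∈ Ioo 0 δ, ∀ ψ ∈ Ioo (-w) w, ρ • dir ψ ∈ A) :
    ENNReal.ofReal (w * δ ^ 2) ≤ volume A := by
  rcases lt_or_ge w 0 with hw0 | hw0
  · rw [ENNReal.ofReal_of_nonpos (by nlinarith [sq_nonneg δ])]; exact zero_le
  have hM := measurableSet_toMeasurable volume A
  rw [← measure_toMeasurable, ← lintegral_indicator_one hM, ← lintegral_polar]
  have hsub : Ioo 0 δ ×ˢ Ioo (-w) w ⊆ polarCoord.target := by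
    rintro ⟨ρ, ψ⟩ ⟨h1, h2⟩
    exact ⟨h1.1, by linarith [h2.1], by linarith [h2.2]⟩
  refine le_trans ?_ (lintegral_mono_set hsub)
  have h1 : ∫⁻ p in Ioo 0 δ ×ˢ Ioo (-w) w, ENNReal.ofReal p.1 * 1
      ≤ ∫⁻ p in Ioo 0 δ ×ˢ Ioo (-w) w, ENNReal.ofReal p.1
        * (toMeasurable volume A).indicator 1 (p.1 • dir p.2) := by
    refine setLIntegral_mono' (measurableSet_Ioo.prod measurableSet_Ioo) ?_
    rintro ⟨ρ, ψ⟩ ⟨h1, h2⟩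
    simp only
    rw [indicator_of_mem (subset_toMeasurable _ _ (hA ρ h1 ψ h2))]
    simp
  refine le_trans (le_of_eq ?_) h1
  have h2 : ∫⁻ ρ in Ioo 0 δ, ENNReal.ofReal ρ = ENNReal.ofReal (δ ^ 2 / 2) := by
    rw [← ofReal_integral_eq_lintegral_ofReal]
    · rw [← integral_Ioc_eq_integral_Ioo, ← intervalIntegral.integral_of_le hδ, integral_id]
      simp
    · exact (continuous_id.integrableOn_Icc (a := 0) (b := δ)).mono_set Ioo_subset_Icc_self
    · filter_upwards [ae_restrict_mem measurableSet_Ioo] with ρ hρ using hρ.1.le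
  rw [Measure.volume_eq_prod, ← Measure.prod_restrict,
    lintegral_prod_mul (f := fun ρ => ENNReal.ofReal ρ) (g := fun _ => 1) (by fun_prop)
      (by fun_prop),
    h2]
  simp only [lintegral_const, Measure.restrict_apply MeasurableSet.univ, univ_inter, volume_Ioo,
    one_mul]
  rw [← ENNReal.ofReal_mul (by positivity)]
  congr 1; ring

/-- A set containing a circular sector has at least the area of the sector. -/
lemma volume_sector {ψ₁ ψ₂ δ : ℝ} (hψ : ψ₂ - ψ₁ ≤ 2 * π) (hδ : 0 ≤ δ) (v : Plane) (A : Set Plane)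
    (hA : ∀ ρ ∈ Ioo 0 δ, ∀ ψ ∈ Ioo ψ₁ ψ₂, v + ρ • dir ψ ∈ A) :
    ENNReal.ofReal ((ψ₂ - ψ₁) / 2 * δ ^ 2) ≤ volume A := by
  let γ := (ψ₁ + ψ₂) / 2
  have h1 : volume ((rot γ) ⁻¹' ((fun y => v + y) ⁻¹' A)) = volume A := by
    rw [(rot γ).measurePreserving.measure_preimage_emb (rot γ).toHomeomorph.measurableEmbedding,
      measure_preimage_add]
  rw [← h1]
  refine volume_sector_zero (by linarith) hδ _ fun ρ hρ ψ hψ => ?_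
  simp only [mem_preimage, map_smul, rot_dir]
  refine hA ρ hρ _ ⟨?_, ?_⟩ <;> simp only [γ] <;> linarith [hψ.1, hψ.2]

lemma volume_real_ball (v : Plane) {δ : ℝ} (hδ : 0 ≤ δ) :
    volume.real (Metric.ball v δ) = π * δ ^ 2 := by
  rw [measureReal_def, EuclideanSpace.volume_ball_fin_two, ENNReal.toReal_mul, ENNReal.toReal_pow,
    ENNReal.toReal_ofReal hδ, ENNReal.toReal_ofReal pi_pos.le, mul_comm]

/-- The point reflection in `v` preserves areas. -/
lemma volume_real_reflect (v : Plane) (A : Set Plane) :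
    volume.real ((fun y => (v + v) - y) ⁻¹' A) = volume.real A := by
  have := (Measure.measurePreserving_sub_left volume (v + v)).measure_preimage_emb
    (Homeomorph.subLeft (v + v)).measurableEmbedding A
  simp only [measureReal_def, this]

lemma reflect_mem_ball {v y : Plane} {δ : ℝ} (h : y ∈ Metric.ball v δ) :
    (v + v) - y ∈ Metric.ball v δ := by
  rw [Metric.mem_ball, dist_eq_norm] at h ⊢
  rw [show v + v - y - v = -(y - v) by abel, norm_neg]; exact h

/-- A set meeting each pair of opposite points of a disc has at least half its area. -/
lemma half_ball_le {v : Plane} {δ : ℝ} {A : Set Plane}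
    (h : ∀ y ∈ Metric.ball v δ, y ∈ A ∨ (v + v) - y ∈ A) (hA : volume A ≠ ⊤) :
    volume.real (Metric.ball v δ) / 2 ≤ volume.real A := by
  have h1 : volume.real (Metric.ball v δ)
      ≤ volume.real (A ∪ (fun y => (v + v) - y) ⁻¹' A) := by
    refine measureReal_mono (fun y hy => h y hy) ?_
    refine (measure_union_lt_top hA.lt_top ?_).ne
    rw [(Measure.measurePreserving_sub_left volume (v + v)).measure_preimage_emb
      (Homeomorph.subLeft (v + v)).measurableEmbedding A]
    exact hA.lt_top
  have h2 := measureReal_union_le (μ := volume) A ((fun y => (v + v) - y) ⁻¹' A)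
  rw [volume_real_reflect] at h2
  linarith

/-- If `A` is disjoint from its reflection in the centre and `B` is disjoint from both, then `A`,
its reflection and `B` are disjoint parts of the disc. -/
lemma le_half_ball {v : Plane} {δ : ℝ} {A B : Set Plane} (hA : MeasurableSet A)
    (hB : MeasurableSet B) (hAb : A ⊆ Metric.ball v δ) (hBb : B ⊆ Metric.ball v δ)
    (h : ∀ y ∈ A, (v + v) - y ∉ A) (h1 : ∀ y ∈ A, y ∉ B) (h2 : ∀ y ∈ A, (v + v) - y ∉ B) :
    volume.real A + volume.real B / 2 ≤ volume.real (Metric.ball v δ) / 2 := by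
  have hA' : MeasurableSet ((fun y => (v + v) - y) ⁻¹' A) :=
    (Measure.measurePreserving_sub_left volume (v + v)).measurable hA
  have hfin : volume (Metric.ball v δ) < ⊤ := measure_ball_lt_top
  have hAf : volume A ≠ ⊤ := ((measure_mono hAb).trans_lt hfin).ne
  have hBf : volume B ≠ ⊤ := ((measure_mono hBb).trans_lt hfin).ne
  have hA'b : (fun y => (v + v) - y) ⁻¹' A ⊆ Metric.ball v δ := by
    intro y hy
    have := reflect_mem_ball (hAb hy)
    simpa using this
  have hA'f := ((measure_mono (μ := volume) hA'b).trans_lt hfin).ne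
  have e1 : volume.real (A ∪ (fun y => (v + v) - y) ⁻¹' A) = volume.real A + volume.real A := by
    rw [measureReal_union _ hA' hAf hA'f, volume_real_reflect]
    rw [Set.disjoint_left]
    exact fun y hy hy' => h y hy hy'
  have e2 : volume.real ((A ∪ (fun y => (v + v) - y) ⁻¹' A) ∪ B)
      = volume.real A + volume.real A + volume.real B := by
    rw [measureReal_union _ hB (measure_union_lt_top hAf.lt_top hA'f.lt_top).ne hBf, e1]
    rw [Set.disjoint_left]
    rintro y (hy | hy) hyB
    · exact h1 y hy hyB
    · refine h2 _ hy ?_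
      simpa using hyB
  have h3 : volume.real ((A ∪ (fun y => (v + v) - y) ⁻¹' A) ∪ B)
      ≤ volume.real (Metric.ball v δ) :=
    measureReal_mono (union_subset (union_subset hAb hA'b) hBb) hfin.ne
  linarith

/-! ### The area of a polygon near one of its points -/

lemma volume_real_interior_inter {P : Set Plane} (hP : Convex ℝ P) (B : Set Plane) :
    volume.real (P ∩ B) ≤ volume.real (interior P ∩ B) := by
  have h1 : volume (P ∩ B) ≤ volume (interior P ∩ B) := by
    have : P ∩ B ⊆ (interior P ∩ B) ∪ frontier P := by
      rintro y ⟨h1, h2⟩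
      by_cases h : y ∈ interior P
      · exact Or.inl ⟨h, h2⟩
      · exact Or.inr ⟨subset_closure h1, h⟩
    calc volume (P ∩ B) ≤ volume ((interior P ∩ B) ∪ frontier P) := measure_mono this
      _ ≤ volume (interior P ∩ B) + volume (frontier P) := measure_union_le _ _
      _ = _ := by rw [hP.addHaar_frontier volume, add_zero]
  rcases eq_or_ne (volume (interior P ∩ B)) ⊤ with h | h
  · have : volume (P ∩ B) = ⊤ := by
      rw [eq_top_iff, ← h]
      exact measure_mono (inter_subset_inter_left _ interior_subset)
    rw [measureReal_def, measureReal_def, this, h]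
  · exact ENNReal.toReal_mono h h1

/-- A convex set fills at most half of a disc about a point which is not in its interior. -/
lemma volume_real_inter_ball_le_half {P : Set Plane} (hP : Convex ℝ P) {v : Plane}
    (hv : v ∉ interior P) (δ : ℝ) :
    volume.real (P ∩ Metric.ball v δ) ≤ volume.real (Metric.ball v δ) / 2 := by
  obtain ⟨ℓ, hℓ⟩ := geometric_hahn_banach_open_point hP.interior isOpen_interior hv
  refine (volume_real_interior_inter hP _).trans ?_
  have := le_half_ball (v := v) (δ := δ) (A := interior P ∩ Metric.ball v δ) (B := ∅)
    (isOpen_interior.measurableSet.inter Metric.isOpen_ball.measurableSet) MeasurableSet.empty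
    inter_subset_right (empty_subset _) ?_ (by simp) (by simp)
  · simpa using this
  · rintro y ⟨h1, -⟩ ⟨h2, -⟩
    have h3 := hℓ y h1
    have h4 := hℓ _ h2
    rw [map_sub, map_add] at h4
    linarith

/-- A convex set inside a disc fills less than half of a small disc about a point of the circle. -/
lemma volume_real_inter_ball_lt_half {P : Set Plane} (hP : Convex ℝ P) {p v : Plane} {R δ : ℝ}
    (hPR : P ⊆ Metric.closedBall p R) (hR : 0 < R) (hv : dist v p = R) (hδ : 0 < δ) :
    volume.real (P ∩ Metric.ball v δ) < volume.real (Metric.ball v δ) / 2 := by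
  refine (volume_real_interior_inter hP _).trans_lt ?_
  have hint : interior P ⊆ Metric.ball p R := by
    rw [← interior_closedBall p hR.ne']
    exact interior_mono hPR
  let B : Set Plane := Metric.ball v δ ∩ ((Metric.closedBall p R)ᶜ
    ∩ (fun y => (v + v) - y) ⁻¹' (Metric.closedBall p R)ᶜ)
  have hBo : IsOpen B := Metric.isOpen_ball.inter (Metric.isClosed_closedBall.isOpen_compl.inter
    (Metric.isClosed_closedBall.isOpen_compl.preimage (by fun_prop)))
  -- the tangent at `v` meets the disc in `v` only
  have hBn : B.Nonempty := by
    obtain ⟨φ, hφ⟩ := exists_dir (v - p)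
    have hn : ‖v - p‖ = R := by rw [← dist_eq_norm, hv]
    rw [hn] at hφ
    have key : ∀ t : ℝ, t ≠ 0 → v + t • dir (φ + π / 2) ∉ Metric.closedBall p R := by
      intro t ht hmem
      rw [Metric.mem_closedBall, dist_eq_norm] at hmem
      have e : v + t • dir (φ + π / 2) - p = R • dir φ + t • dir (φ + π / 2) := by
        rw [← hφ]; abel
      rw [e] at hmem
      have h1 : ‖R • dir φ + t • dir (φ + π / 2)‖ ^ 2 = R ^ 2 + t ^ 2 := by
        rw [norm_add_sq_real, inner_smul_left, inner_smul_right, inner_dir, norm_smul, norm_smul]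
        simp
      have h2 : 0 < t ^ 2 := by positivity
      nlinarith [norm_nonneg (R • dir φ + t • dir (φ + π / 2))]
    refine ⟨v + (δ / 2) • dir (φ + π / 2), ?_, key _ (by positivity), ?_⟩
    · rw [Metric.mem_ball, dist_eq_norm, add_sub_cancel_left, norm_smul, norm_dir]
      simp [abs_of_pos hδ]; linarith
    · have e : v + v - (v + (δ / 2) • dir (φ + π / 2)) = v + (-(δ / 2)) • dir (φ + π / 2) := by
        rw [neg_smul]; abel
      simp only [mem_preimage, e]
      exact key _ (by simpa using hδ.ne')
  have hBfin : volume B ≠ ⊤ := ((measure_mono inter_subset_left).trans_lt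
    (measure_ball_lt_top (x := v) (r := δ))).ne
  have hBpos : 0 < volume.real B :=
    ENNReal.toReal_pos (hBo.measure_pos volume hBn).ne' hBfin
  have := le_half_ball (v := v) (δ := δ) (A := interior P ∩ Metric.ball v δ) (B := B)
    (isOpen_interior.measurableSet.inter Metric.isOpen_ball.measurableSet) hBo.measurableSet
    inter_subset_right inter_subset_left ?_ ?_ ?_
  · linarith
  · rintro y ⟨h1, -⟩ ⟨h2, -⟩
    have h3 : (1 / 2 : ℝ) • y + (1 / 2 : ℝ) • (v + v - y) ∈ Metric.ball p R :=
      (convex_ball p R : Convex ℝ (Metric.ball p R)) (hint h1) (hint h2) (by norm_num)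
        (by norm_num) (by norm_num)
    have e : (1 / 2 : ℝ) • y + (1 / 2 : ℝ) • (v + v - y) = v := by module
    rw [e, Metric.mem_ball, hv] at h3
    exact lt_irrefl _ h3
  · rintro y ⟨h1, -⟩ ⟨-, h2, -⟩
    exact h2 (Metric.ball_subset_closedBall (hint h1))
  · rintro y ⟨h1, -⟩ ⟨-, -, h2⟩
    refine h2 ?_
    simp only [sub_sub_cancel]
    exact Metric.ball_subset_closedBall (hint h1)

/-- The cross product of two plane vectors. -/
noncomputable def cross (x : Plane) : Plane →L[ℝ] ℝ :=
  x 0 • EuclideanSpace.proj 1 - x 1 • EuclideanSpace.proj 0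

lemma cross_apply (x y : Plane) : cross x y = x 0 * y 1 - x 1 * y 0 := by
  simp [cross]

/-- A convex set with nonempty interior fills at least half of any small disc about a point in the
relative interior of a segment of the set. -/
lemma half_le_volume_real_inter_ball {P : Set Plane} (hP : Convex ℝ P)
    (hint : (interior P).Nonempty) (hfin : volume P ≠ ⊤) {v : Plane} (hvP : v ∈ P)
    (hv : v ∉ extremePoints ℝ P) :
    ∃ δ₀ > 0, ∀ δ, 0 < δ → δ ≤ δ₀ →
      volume.real (Metric.ball v δ) / 2 ≤ volume.real (P ∩ Metric.ball v δ) := by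
  -- `v` is strictly between `a` and `b`
  obtain ⟨a, ha, b, hb, ⟨s, t, hs, ht, hst, hvab⟩, hne⟩ : ∃ a ∈ P, ∃ b ∈ P,
      v ∈ openSegment ℝ a b ∧ a ≠ v := by
    by_contra! hcon
    refine hv ⟨hvP, fun x hx y hy hxy => ?_⟩
    exact hcon x hx y hy hxy
  set d := b - a with hd
  have hd0 : d ≠ 0 := by
    intro h0
    have : b = a := sub_eq_zero.1 h0
    rw [this, ← add_smul, hst, one_smul] at hvab
    exact hne hvab
  have ea : a = v + (-t) • d := by
    rw [hd, ← hvab]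
    have : s = 1 - t := by linarith
    rw [this]; module
  have eb : b = v + s • d := by
    rw [hd, ← hvab]
    have : t = 1 - s := by linarith
    rw [this]; module
  have hseg : ∀ σ : ℝ, |σ| ≤ min s t → v + σ • d ∈ P := by
    intro σ hσ
    obtain ⟨h1, h2⟩ := abs_le.1 hσ
    have h3 := min_le_left s t
    have h4 := min_le_right s t
    have := hP ha hb (a := s - σ) (b := t + σ) (by linarith) (by linarith) (by linarith)
    convert this using 1
    rw [ea, eb]
    have : s = 1 - t := by linarith
    rw [this]; module
  have hd2 : 0 < ‖d‖ ^ 2 := by have := norm_pos_iff.2 hd0; positivity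
  -- and `c` is off the line through `a` and `b`
  obtain ⟨c, hc, hK⟩ : ∃ c ∈ P, cross d (c - v) ≠ 0 := by
    by_contra! hcon
    obtain ⟨c, hc⟩ := hint
    let e : Plane := !₂[-d 1, d 0]
    have ht : Tendsto (fun ε : ℝ => c + ε • e) (𝓝 0) (𝓝 (c + (0 : ℝ) • e)) :=
      Continuous.tendsto (by fun_prop) 0
    rw [zero_smul, add_zero] at ht
    have hev := (ht.eventually (mem_interior_iff_mem_nhds.1 hc)).filter_mono
      (nhdsWithin_le_nhds (s := Ioi 0))
    obtain ⟨ε, h1, h2⟩ := (hev.and self_mem_nhdsWithin).exists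
    have h3 := hcon _ h1
    have h4 := hcon c (interior_subset hc)
    have h5 : cross d e = ‖d‖ ^ 2 := by
      rw [norm_sq_plane, cross_apply]; simp [e]; ring
    rw [add_sub_right_comm, map_add, h4, map_smul, h5, zero_add, smul_eq_mul] at h3
    exact (mul_pos h2 hd2).ne' h3
  set K := cross d (c - v) with hKdef
  let τ : Plane → ℝ := fun y => cross d (y - v) / K
  let σ : Plane → ℝ := fun y => inner ℝ d (y - v - τ y • (c - v)) / ‖d‖ ^ 2
  have hτc : Continuous τ := by fun_prop
  have hσc : Continuous σ := by fun_prop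
  have hτ0 : τ v = 0 := by simp [τ]
  have hσ0 : σ v = 0 := by simp [σ, hτ0]
  have hdec : ∀ y, y = v + σ y • d + τ y • (c - v) := by
    intro y
    set e := y - v - τ y • (c - v) with he
    have h1 : cross d e = 0 := by
      rw [he, map_sub, map_smul, smul_eq_mul, ← hKdef]
      simp only [τ]; field_simp; ring
    have h2 : e = σ y • d := by
      have h3 : σ y * ‖d‖ ^ 2 = inner ℝ d e := by simp only [σ, ← he]; field_simp
      rw [inner_plane] at h3
      rw [cross_apply] at h1
      have h4 := norm_sq_plane d
      refine plane_ext ?_ ?_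
      · refine mul_right_cancel₀ hd2.ne' ?_
        change e 0 * _ = σ y * d 0 * _
        linear_combination e 0 * h4 - d 0 * h3 - d 1 * h1
      · refine mul_right_cancel₀ hd2.ne' ?_
        change e 1 * _ = σ y * d 1 * _
        linear_combination e 1 * h4 - d 1 * h3 + d 0 * h1
    have h5 : y = v + e + τ y • (c - v) := by rw [he]; abel
    rw [← h2]; exact h5
  have hm : 0 < min s t / 2 := by have := lt_min hs ht; positivity
  have hev : ∀ᶠ y in 𝓝 v, τ y < 1 / 2 ∧ |σ y| < min s t / 2 := by
    refine (hτc.continuousAt.eventually (gt_mem_nhds ?_)).and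
      (hσc.abs.continuousAt.eventually (gt_mem_nhds ?_))
    · rw [hτ0]; norm_num
    · simp only [hσ0, abs_zero]; exact hm
  obtain ⟨δ₀, hδ₀, hball⟩ := Metric.eventually_nhds_iff_ball.1 hev
  have hmem : ∀ y ∈ Metric.ball v δ₀, 0 ≤ τ y → y ∈ P := by
    intro y hy h0
    obtain ⟨h1, h2⟩ := hball y hy
    have h3 : 0 < 1 - τ y := by linarith
    have h4 : v + (σ y / (1 - τ y)) • d ∈ P := by
      refine hseg _ ?_
      rw [abs_div, abs_of_pos h3, div_le_iff₀ h3]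
      nlinarith
    have h5 := hP h4 hc h3.le h0 (by ring)
    convert h5 using 1
    nth_rewrite 1 [hdec y]
    rw [smul_add, smul_smul, mul_div_cancel₀ _ h3.ne']
    module
  refine ⟨δ₀, hδ₀, fun δ _ hδ => half_ball_le ?_ ((measure_mono inter_subset_left).trans_lt
    hfin.lt_top).ne⟩
  intro y hy
  have hsub := Metric.ball_subset_ball (x := v) hδ
  rcases le_total 0 (τ y) with h | h
  · exact Or.inl ⟨hmem y (hsub hy) h, hy⟩
  · have hy' := reflect_mem_ball hy
    refine Or.inr ⟨hmem _ (hsub hy') ?_, hy'⟩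
    have : τ (v + v - y) = -τ y := by
      simp only [τ]
      rw [show v + v - y - v = -(y - v) by abel, map_neg, neg_div]
    linarith

/-! ### Cyclic polygons -/

/-- What the counting of sides uses about a polygon `P`: it is the convex hull of the finite set `V`
of points of a circle, and at each `v ∈ V` it contains a sector of angle `θ v`, where these angles
add up to at least the angle sum of a polygon. -/
structure IsRoundTile (P : Set Plane) (V : Finset Plane) (p : Plane) (R : ℝ) (θ : Plane → ℝ) :
    Prop where
  hull_eq : P = convexHull ℝ (V : Set Plane)
  radius_pos : 0 < R
  sphere : ∀ v ∈ V, dist v p = R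
  interior_nonempty : (interior P).Nonempty
  angle_pos : ∀ v ∈ V, 0 < θ v
  angle_sum : ((V.card : ℝ) - 2) * π ≤ ∑ v ∈ V, θ v
  sector : ∀ v ∈ V, ∃ δ₀ > 0, ∀ δ, 0 < δ → δ ≤ δ₀ →
    θ v / 2 * δ ^ 2 ≤ volume.real (P ∩ Metric.ball v δ)

/-- Direction of the `j`-th vertex of `cyclicPolygon p R φ β`. -/
noncomputable def vertexAngle {n : ℕ} (φ : ℝ) (β : Fin n → ℝ) (j : ℕ) : ℝ :=
  φ + 2 * ∑ i : Fin n with i.val < j, β i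

lemma vertexAngle_zero {n : ℕ} (φ : ℝ) (β : Fin n → ℝ) : vertexAngle φ β 0 = φ := by
  simp [vertexAngle]

lemma vertexAngle_succ {n : ℕ} (φ : ℝ) (β : Fin n → ℝ) (k : Fin n) :
    vertexAngle φ β (k.val + 1) = vertexAngle φ β k.val + 2 * β k := by
  unfold vertexAngle
  have : (Finset.univ.filter fun i : Fin n => i.val < k.val + 1)
      = insert k (Finset.univ.filter fun i : Fin n => i.val < k.val) := by
    ext i; simp [Fin.ext_iff]; omega
  rw [this, Finset.sum_insert (by simp)]
  ring

lemma vertexAngle_total {n : ℕ} (φ : ℝ) (β : Fin n → ℝ) (h : ∑ i, β i = π) :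
    vertexAngle φ β n = φ + 2 * π := by
  unfold vertexAngle
  rw [Finset.filter_true_of_mem (fun i _ => i.isLt), h]

/-- The `k`-th vertex of `cyclicPolygon p R φ β`. -/
noncomputable def vertex {n : ℕ} (p : Plane) (R φ : ℝ) (β : Fin n → ℝ) (k : Fin n) : Plane :=
  p + R • dir (vertexAngle φ β k.val)

lemma cyclicPolygon_eq {n : ℕ} (p : Plane) (R φ : ℝ) (β : Fin n → ℝ) :
    cyclicPolygon p R φ β = convexHull ℝ (range (vertex p R φ β)) := by
  have : ∀ k : Fin n, Finset.Iio k = Finset.univ.filter fun i : Fin n => i.val < k.val := by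
    intro k; ext i; simp
  unfold cyclicPolygon vertex vertexAngle dir
  simp only [this]

lemma vertexAngle_lt {n : ℕ} {φ : ℝ} {β : Fin n → ℝ} (hβ : ∀ i, 0 < β i) {j k : ℕ} (hk : k ≤ n)
    (h : j < k) : vertexAngle φ β j < vertexAngle φ β k := by
  unfold vertexAngle
  have : ∑ i : Fin n with i.val < j, β i < ∑ i : Fin n with i.val < k, β i := by
    refine Finset.sum_lt_sum_of_subset (i := (⟨j, by omega⟩ : Fin n)) ?_ (by simpa) (by simp)
      (hβ _) (fun i _ _ => (hβ i).le)
    intro i; simp; omega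
  linarith

lemma vertex_injective {n : ℕ} {p : Plane} {R φ : ℝ} {β : Fin n → ℝ} (hR : 0 < R)
    (hβ : ∀ i, 0 < β i) (hsum : ∑ i, β i = π) : Function.Injective (vertex p R φ β) := by
  have key : ∀ j k : Fin n, j < k → vertex p R φ β j ≠ vertex p R φ β k := by
    intro j k hjk h
    have h1 := smul_right_injective Plane hR.ne' (add_left_cancel h)
    have h2 : cos (vertexAngle φ β k.val - vertexAngle φ β j.val) = 1 := by
      rw [← inner_dir, ← h1, inner_dir, sub_self, cos_zero]
    have h3 := vertexAngle_lt (φ := φ) hβ k.isLt.le hjk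
    have h4 := vertexAngle_lt (φ := φ) hβ le_rfl k.isLt
    rw [vertexAngle_total φ β hsum] at h4
    have h5 : φ ≤ vertexAngle φ β j.val := by
      rcases Nat.eq_zero_or_pos j.val with h0 | h0
      · rw [h0, vertexAngle_zero]
      · have h6 := vertexAngle_lt (φ := φ) hβ j.isLt.le h0
        rw [vertexAngle_zero] at h6
        exact h6.le
    obtain ⟨m, hm⟩ := (cos_eq_one_iff _).1 h2
    have hpi := pi_pos
    have hm0 : (0 : ℝ) < m := by
      by_contra! hle
      nlinarith
    have hm1 : (m : ℝ) < 1 := by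
      by_contra! hle
      nlinarith
    have : (0 : ℤ) < m := by exact_mod_cast hm0
    have : m < (1 : ℤ) := by exact_mod_cast hm1
    omega
  intro j k h
  rcases lt_trichotomy j k with h1 | h1 | h1
  · exact absurd h (key j k h1)
  · exact h1
  · exact absurd h.symm (key k j h1)

/-- The next vertex, where the last vertex is followed by the vertex `0`. -/
lemma vertex_finRotate {n : ℕ} (p : Plane) (R φ : ℝ) (β : Fin (n + 1) → ℝ) (hsum : ∑ i, β i = π)
    (k : Fin (n + 1)) :
    vertex p R φ β (finRotate (n + 1) k) = p + R • dir (vertexAngle φ β k.val + 2 * β k) := by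
  rw [← vertexAngle_succ]
  unfold vertex
  rcases eq_or_ne k (Fin.last n) with h | h
  · rw [h, finRotate_last]
    simp only [Fin.val_zero, Fin.val_last, vertexAngle_zero]
    rw [vertexAngle_total φ β hsum, dir_add_two_pi]
  · rw [coe_finRotate_of_ne_last h]

lemma dir_add_pi (x : ℝ) : dir (x + π) = -dir x :=
  plane_ext (cos_add_pi x) (sin_add_pi x)

lemma dir_sub_dir (x y : ℝ) : dir (x + 2 * y) - dir x = (2 * sin y) • dir (x + y + π / 2) := by
  refine plane_ext ?_ ?_
  · change cos (x + 2 * y) - cos x = 2 * sin y * cos (x + y + π / 2)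
    rw [cos_sub_cos, cos_add_pi_div_two]
    ring_nf
  · change sin (x + 2 * y) - sin x = 2 * sin y * sin (x + y + π / 2)
    rw [sin_sub_sin, sin_add_pi_div_two]
    ring_nf

/-- The sector of the inscribed angle at a vertex: `β₁` and `β₂` are the half angles of the sides
before and after the vertex, so the polygon has the angle `π - β₁ - β₂` there. -/
lemma sector_mem_hull {P : Set Plane} (hP : Convex ℝ P) {p : Plane} {R x β₁ β₂ : ℝ} (hR : 0 < R)
    (h1 : β₁ ∈ Ioo 0 (π / 2)) (h2 : β₂ ∈ Ioo 0 (π / 2)) (hv : p + R • dir x ∈ P)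
    (hv1 : p + R • dir (x - 2 * β₁) ∈ P) (hv2 : p + R • dir (x + 2 * β₂) ∈ P) :
    ∃ δ₀ > 0, ∀ δ, 0 < δ → δ ≤ δ₀ → (π - β₁ - β₂) / 2 * δ ^ 2
      ≤ volume.real (P ∩ Metric.ball (p + R • dir x) δ) := by
  have hs1 := sin_pos_of_mem h1
  have hs2 := sin_pos_of_mem h2
  set a := x + β₂ + π / 2 with ha
  set b := x - β₁ + 3 * (π / 2) with hb
  have hba : b - a = π - β₁ - β₂ := by rw [ha, hb]; ring
  have hsin : 0 < sin (b - a) := by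
    rw [hba]; exact sin_pos_of_pos_of_lt_pi (by linarith [h1.2, h2.2]) (by linarith [h1.1, h2.1])
  have e2 : p + R • dir (x + 2 * β₂) = (p + R • dir x) + (2 * R * sin β₂) • dir a := by
    have := dir_sub_dir x β₂
    rw [sub_eq_iff_eq_add'.1 this, smul_add, smul_smul, ha]
    rw [show R * (2 * sin β₂) = 2 * R * sin β₂ by ring]
    exact (add_assoc _ _ _).symm
  have e1 : p + R • dir (x - 2 * β₁) = (p + R • dir x) + (2 * R * sin β₁) • dir b := by
    have := dir_sub_dir x (-β₁)
    have e3 : dir (x + -β₁ + π / 2) = -dir b := by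
      rw [hb, show x - β₁ + 3 * (π / 2) = x + -β₁ + π / 2 + π by ring, dir_add_pi, neg_neg]
    rw [show x - 2 * β₁ = x + 2 * -β₁ by ring, sub_eq_iff_eq_add'.1 this, smul_add, smul_smul, e3,
      sin_neg, smul_neg, ← neg_smul]
    rw [show -(R * (2 * -sin β₁)) = 2 * R * sin β₁ by ring]
    exact (add_assoc _ _ _).symm
  set v := p + R • dir x with hvdef
  set δ₀ := min (R * sin β₁ * sin (b - a)) (R * sin β₂ * sin (b - a)) with hδ₀
  have hδ₀pos : 0 < δ₀ := lt_min (by positivity) (by positivity)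
  refine ⟨δ₀, hδ₀pos, fun δ hδ hδδ => ?_⟩
  have hmem : ∀ ρ ∈ Ioo 0 δ, ∀ ψ ∈ Ioo a b, v + ρ • dir ψ ∈ P ∩ Metric.ball v δ := by
    intro ρ hρ ψ hψ
    constructor
    · have k1 : 0 < sin (b - ψ) := sin_pos_of_pos_of_lt_pi (by linarith [hψ.2])
        (by linarith [hψ.1, h1.1, h2.1])
      have k2 : 0 < sin (ψ - a) := sin_pos_of_pos_of_lt_pi (by linarith [hψ.1])
        (by linarith [hψ.2, h1.1, h2.1])
      rw [dir_eq_combination (a := a) (b := b) (ψ := ψ) hsin.ne']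
      set s := ρ * sin (b - ψ) / (2 * R * sin β₂ * sin (b - a)) with hs
      set t := ρ * sin (ψ - a) / (2 * R * sin β₁ * sin (b - a)) with ht
      have hρ0 := hρ.1
      have hs0 : 0 ≤ s := by positivity
      have ht0 : 0 ≤ t := by positivity
      have hs1' : s ≤ 1 / 2 := by
        rw [hs, div_le_iff₀ (by positivity)]
        have := min_le_right (R * sin β₁ * sin (b - a)) (R * sin β₂ * sin (b - a))
        nlinarith [hρ.2, sin_le_one (b - ψ)]
      have ht1' : t ≤ 1 / 2 := by
        rw [ht, div_le_iff₀ (by positivity)]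
        have := min_le_left (R * sin β₁ * sin (b - a)) (R * sin β₂ * sin (b - a))
        nlinarith [hρ.2, sin_le_one (ψ - a)]
      have hcomb : v + ρ • ((sin (b - ψ) / sin (b - a)) • dir a +
          (sin (ψ - a) / sin (b - a)) • dir b)
          = (1 - s - t) • v + s • (v + (2 * R * sin β₂) • dir a)
            + t • (v + (2 * R * sin β₁) • dir b) := by
        have f1 : ρ * (sin (b - ψ) / sin (b - a)) = s * (2 * R * sin β₂) := by
          rw [hs]; field_simp
        have f2 : ρ * (sin (ψ - a) / sin (b - a)) = t * (2 * R * sin β₁) := by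
          rw [ht]; field_simp
        rw [smul_add, smul_smul, smul_smul, f1, f2]
        module
      rw [hcomb]
      rw [← e1, ← e2]
      have := hP.sum_mem (t := Finset.univ) (w := ![1 - s - t, s, t])
        (z := ![v, p + R • dir (x + 2 * β₂), p + R • dir (x - 2 * β₁)])
        (by intro i _; fin_cases i <;> simp <;> linarith) (by simp [Fin.sum_univ_three]; ring)
        (by intro i _; fin_cases i <;> simp <;> assumption)
      simpa [Fin.sum_univ_three] using this
    · rw [Metric.mem_ball, dist_eq_norm, add_sub_cancel_left, norm_smul, norm_dir, mul_one,
        norm_eq_abs, abs_of_pos hρ.1]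
      exact hρ.2
  have h3 := volume_sector (ψ₁ := a) (ψ₂ := b) (by linarith [h1.1, h2.1, pi_pos]) hδ.le v _ hmem
  rw [hba] at h3
  have hfin : volume (P ∩ Metric.ball v δ) ≠ ⊤ :=
    ((measure_mono inter_subset_right).trans_lt (measure_ball_lt_top (x := v) (r := δ))).ne
  exact (ENNReal.ofReal_le_iff_le_toReal hfin).1 h3

lemma dir_add_congr {a b : ℝ} (h : dir a = dir b) (c : ℝ) : dir (a + c) = dir (b + c) := by
  rw [← rot_dir, ← rot_dir, h]

/-- Each direction `ψ` lies within `γ` of the direction of a vertex, if no side is seen under an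
angle larger than `2 γ`. -/
lemma exists_vertex_near {n : ℕ} {p : Plane} {R φ γ : ℝ} {β : Fin (n + 1) → ℝ} (hR : 0 < R)
    (hβγ : ∀ i, β i ≤ γ) (hγ : γ ≤ π) (hsum : ∑ i, β i = π) (ψ : ℝ) :
    ∃ y ∈ range (vertex p R φ β), R * cos γ ≤ inner ℝ (dir ψ) (y - p) := by
  set ψ' := toIcoMod two_pi_pos φ ψ with hψ'
  have hmem := toIcoMod_mem_Ico two_pi_pos φ ψ
  rw [← hψ'] at hmem
  have hdir : dir ψ = dir ψ' := by
    have := self_sub_toIcoMod two_pi_pos φ ψ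
    rw [← hψ', zsmul_eq_mul, sub_eq_iff_eq_add'] at this
    rw [this, dir_add_int_mul]
  -- the side that is crossed by the ray in direction `ψ`
  have hfind : ∀ j ≤ n + 1, ψ' < vertexAngle φ β j → ∃ k : Fin (n + 1),
      vertexAngle φ β k.val ≤ ψ' ∧ ψ' < vertexAngle φ β (k.val + 1) := by
    intro j
    induction j with
    | zero =>
      intro _ h
      rw [vertexAngle_zero] at h
      exact absurd h (not_lt.2 hmem.1)
    | succ j ih =>
      intro hj h
      rcases lt_or_ge ψ' (vertexAngle φ β j) with h1 | h1
      · exact ih (by omega) h1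
      · exact ⟨⟨j, by omega⟩, h1, h⟩
  obtain ⟨k, hk1, hk2⟩ := hfind (n + 1) le_rfl (by rw [vertexAngle_total φ β hsum]; exact hmem.2)
  rw [vertexAngle_succ] at hk2
  have hcos : ∀ d : ℝ, |d| ≤ β k → cos γ ≤ cos d := by
    intro d hd
    rw [← cos_abs d]
    exact cos_le_cos_of_nonneg_of_le_pi (abs_nonneg d) hγ (hd.trans (hβγ k))
  rcases le_total (ψ' - vertexAngle φ β k.val) (β k) with h | h
  · refine ⟨_, ⟨k, rfl⟩, ?_⟩
    unfold vertex
    rw [add_sub_cancel_left, inner_smul_right, hdir, inner_dir]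
    gcongr
    exact hcos _ (by rw [abs_of_nonneg (by linarith)]; exact h)
  · refine ⟨_, ⟨finRotate (n + 1) k, rfl⟩, ?_⟩
    rw [vertex_finRotate p R φ β hsum, add_sub_cancel_left, inner_smul_right, hdir, inner_dir]
    gcongr
    exact hcos _ (by rw [abs_of_nonpos (by linarith)]; linarith)

lemma isCompact_cyclicPolygon {n : ℕ} (p : Plane) (R φ : ℝ) (β : Fin n → ℝ) :
    IsCompact (cyclicPolygon p R φ β) := by
  rw [cyclicPolygon_eq]
  exact (finite_range _).isCompact_convexHull ℝ

/-- A cyclic polygon contains the disc touching its longest side; this is a separation argument with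
`exists_vertex_near`. -/
lemma ball_subset_cyclicPolygon {n : ℕ} {p : Plane} {R φ γ : ℝ} {β : Fin (n + 1) → ℝ} (hR : 0 < R)
    (hβγ : ∀ i, β i ≤ γ) (hγ : γ ≤ π) (hsum : ∑ i, β i = π) :
    Metric.ball p (R * cos γ) ⊆ cyclicPolygon p R φ β := by
  intro y hy
  by_contra hyP
  have hclosed := (isCompact_cyclicPolygon p R φ β).isClosed
  rw [cyclicPolygon_eq] at hyP hclosed
  obtain ⟨f, u, hf, hfy⟩ := geometric_hahn_banach_closed_point (convex_convexHull ℝ _) hclosed hyP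
  obtain ⟨w, hw⟩ := (InnerProductSpace.toDual ℝ Plane).surjective f
  have hfw : ∀ x, f x = inner ℝ w x := fun x => by
    rw [← hw, InnerProductSpace.toDual_apply_apply]
  obtain ⟨ψ, hψ⟩ := exists_dir w
  obtain ⟨z, hz, hzi⟩ := exists_vertex_near (p := p) (φ := φ) hR hβγ hγ hsum ψ
  have h1 := hf z (subset_convexHull ℝ _ hz)
  have h2 : inner ℝ w (z - p) < inner ℝ w (y - p) := by
    rw [inner_sub_right, inner_sub_right, ← hfw z, ← hfw y]; linarith
  have h3 : ‖w‖ * (R * cos γ) ≤ inner ℝ w (z - p) := by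
    nth_rewrite 2 [hψ]
    rw [real_inner_smul_left]
    gcongr
  have h4 := real_inner_le_norm w (y - p)
  rw [Metric.mem_ball, dist_eq_norm] at hy
  have h5 : ‖w‖ * ‖y - p‖ ≤ ‖w‖ * (R * cos γ) := by gcongr
  linarith

lemma exists_isRoundTile {n : ℕ} {p : Plane} {R φ γ : ℝ} {β : Fin (n + 1) → ℝ} (hR : 0 < R)
    (hβ : ∀ i, 0 < β i) (hβγ : ∀ i, β i ≤ γ) (hγ : γ < π / 2) (hsum : ∑ i, β i = π) :
    ∃ V θ, V.card = n + 1 ∧ IsRoundTile (cyclicPolygon p R φ β) V p R θ := by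
  classical
  have hinj := vertex_injective (p := p) (φ := φ) hR hβ hsum
  have hpi := pi_pos
  let σ := finRotate (n + 1)
  let ang : Fin (n + 1) → ℝ := fun k => π - β (σ.symm k) - β k
  have hext : ∀ k, Function.extend (vertex p R φ β) ang 0 (vertex p R φ β k) = ang k :=
    fun k => hinj.extend_apply ang 0 k
  have hcard : (Finset.univ.image (vertex p R φ β)).card = n + 1 := by
    rw [Finset.card_image_of_injective _ hinj]; simp
  refine ⟨Finset.univ.image (vertex p R φ β), Function.extend (vertex p R φ β) ang 0, hcard, ?_⟩
  have hconv : Convex ℝ (cyclicPolygon p R φ β) := convex_convexHull ℝ _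
  have hvert : ∀ k, vertex p R φ β k ∈ cyclicPolygon p R φ β := by
    intro k
    rw [cyclicPolygon_eq]
    exact subset_convexHull ℝ _ ⟨k, rfl⟩
  refine ⟨?_, hR, ?_, ?_, ?_, ?_, ?_⟩
  · rw [cyclicPolygon_eq]; simp
  · intro v hv
    obtain ⟨k, -, rfl⟩ := Finset.mem_image.1 hv
    unfold vertex
    rw [dist_eq_norm, add_sub_cancel_left, norm_smul, norm_dir, mul_one, norm_eq_abs, abs_of_pos hR]
  · refine ⟨p, interior_maximal (ball_subset_cyclicPolygon hR hβγ (by linarith) hsum)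
      Metric.isOpen_ball (Metric.mem_ball_self (mul_pos hR (cos_pos_of_mem_Ioo ⟨?_, hγ⟩)))⟩
    linarith [hβ 0, hβγ 0]
  · intro v hv
    obtain ⟨k, -, rfl⟩ := Finset.mem_image.1 hv
    rw [hext]
    simp only [ang]
    linarith [hβγ (σ.symm k), hβγ k]
  · rw [Finset.sum_image (fun a _ b _ h => hinj h), hcard]
    simp only [hext, ang, Finset.sum_sub_distrib]
    rw [Equiv.sum_comp σ.symm β, hsum]
    simp
    linarith
  · intro v hv
    obtain ⟨k, -, rfl⟩ := Finset.mem_image.1 hv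
    rw [hext]
    have hlt : ∀ i, β i ∈ Ioo 0 (π / 2) := fun i => ⟨hβ i, (hβγ i).trans_lt hγ⟩
    refine sector_mem_hull hconv hR (hlt _) (hlt _) (hvert k) ?_ ?_
    · have h1 := vertex_finRotate p R φ β hsum (σ.symm k)
      have h2 : finRotate (n + 1) (σ.symm k) = k := σ.apply_symm_apply k
      rw [h2] at h1
      have h3 := smul_right_injective Plane hR.ne' (add_left_cancel h1)
      have h4 := dir_add_congr h3 (-(2 * β (σ.symm k)))
      rw [add_neg_cancel_right] at h4
      rw [sub_eq_add_neg, h4]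
      exact hvert (σ.symm k)
    · rw [← vertex_finRotate p R φ β hsum k]
      exact hvert _

/-- The bound `α*(3)` serves all numbers of sides, since `α*(n)` decreases with `n`. -/
lemma optimalAngles_spec {r : ℝ} {n : ℕ} (hr : 0 ≤ r) (hn : 3 ≤ n) {j k : Fin n} (hjk : j ≠ k) :
    (∀ i, 0 < optimalAngles r n j k i) ∧ (∀ i, optimalAngles r n j k i ≤ alphaStar 3 r) ∧
      ∑ i, optimalAngles r n j k i = π := by
  have hn' : (3 : ℝ) ≤ n := by exact_mod_cast hn
  have ha := alphaStar_mem (n := n) (by linarith) hr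
  have hb := betaStar_mem (n := n) (by linarith) hr
  have hab := betaStar_le_alphaStar (n := n) (by linarith) hr
  have h3 := (star_antitone (n := 3) (by norm_num) hr hn').1
  refine ⟨fun i => ?_, fun i => ?_, ?_⟩
  · unfold optimalAngles; split_ifs
    · exact ha.1
    · exact hb.1
  · unfold optimalAngles; split_ifs
    · exact h3
    · exact hab.trans h3
  · have e : ∀ i, optimalAngles r n j k i = betaStar n r
        + (if i = j then alphaStar n r - betaStar n r else 0)
        + (if i = k then alphaStar n r - betaStar n r else 0) := by
      intro i
      unfold optimalAngles
      by_cases h1 : i = j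
      · simp [h1, hjk]
      · by_cases h2 : i = k
        · subst h2; simp [h1]
        · simp [h1, h2]
    simp only [e, Finset.sum_add_distrib, Finset.sum_ite_eq', Finset.mem_univ, if_true,
      Finset.sum_const, Finset.card_univ, Fintype.card_fin, nsmul_eq_mul]
    linarith [betaStar_mul r (n := n) (by linarith)]

lemma exists_isRoundTile_of_optimal {r : ℝ} {n : ℕ} {S : Set Plane} (hr : 0 ≤ r) (hn : 3 ≤ n)
    (h : IsOptimalCyclicPolygon r n S) : ∃ V p R θ, V.card = n ∧ IsRoundTile S V p R θ ∧
      Metric.ball p (R * cos (alphaStar 3 r)) ⊆ S := by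
  obtain ⟨p, R, φ, j, k, hR, hjk, rfl⟩ := h
  obtain ⟨h1, h2, h3⟩ := optimalAngles_spec hr hn hjk
  obtain ⟨m, rfl⟩ : ∃ m, n = m + 1 := ⟨n - 1, by omega⟩
  have ha := alphaStar_mem (n := 3) (by norm_num) hr
  obtain ⟨V, θ, hV, hT⟩ := exists_isRoundTile (p := p) (φ := φ) hR h1 h2 ha.2 h3
  exact ⟨V, p, R, θ, hV, hT, ball_subset_cyclicPolygon hR h2 (by linarith [ha.2, pi_pos]) h3⟩

lemma image_add_right_cyclicPolygon {n : ℕ} (p w : Plane) (R φ : ℝ) (β : Fin n → ℝ) :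
    (fun y => y + w) '' cyclicPolygon p R φ β = cyclicPolygon (p + w) R φ β := by
  rw [cyclicPolygon_eq, cyclicPolygon_eq]
  have e : (fun y => y + w) = (AffineEquiv.constVAdd ℝ Plane w).toAffineMap := by
    funext y
    exact add_comm y w
  rw [e, AffineMap.image_convexHull, ← e, ← range_comp]
  congr 2
  funext k
  simp only [Function.comp, vertex]
  abel

lemma IsOptimalCyclicPolygon.translate {r : ℝ} {n : ℕ} {S : Set Plane} (w : Plane)
    (h : IsOptimalCyclicPolygon r n S) : IsOptimalCyclicPolygon r n ((fun y => y + w) '' S) := by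
  obtain ⟨p, R, φ, j, k, hR, hjk, rfl⟩ := h
  exact ⟨p + w, R, φ, j, k, hR, hjk, image_add_right_cyclicPolygon p w R φ _⟩

/-! ### Counting sides in a tiling -/

namespace IsRoundTile

variable {P : Set Plane} {V : Finset Plane} {p : Plane} {R : ℝ} {θ : Plane → ℝ}

lemma convex (h : IsRoundTile P V p R θ) : Convex ℝ P := by
  rw [h.hull_eq]; exact convex_convexHull ℝ _

lemma isCompact (h : IsRoundTile P V p R θ) : IsCompact P := by
  rw [h.hull_eq]; exact V.finite_toSet.isCompact_convexHull ℝ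

lemma subset_closedBall (h : IsRoundTile P V p R θ) : P ⊆ Metric.closedBall p R := by
  rw [h.hull_eq]
  exact convexHull_min (fun v hv => Metric.mem_closedBall.2 (h.sphere v hv).le)
    (convex_closedBall p R)

lemma mem (h : IsRoundTile P V p R θ) {v : Plane} (hv : v ∈ V) : v ∈ P := by
  rw [h.hull_eq]; exact subset_convexHull ℝ _ hv

lemma lt_half (h : IsRoundTile P V p R θ) {v : Plane} (hv : v ∈ V) {δ : ℝ} (hδ : 0 < δ) :
    volume.real (P ∩ Metric.ball v δ) < volume.real (Metric.ball v δ) / 2 :=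
  volume_real_inter_ball_lt_half h.convex h.subset_closedBall h.radius_pos (h.sphere v hv) hδ

lemma not_mem_interior (h : IsRoundTile P V p R θ) {v : Plane} (hv : v ∈ V) :
    v ∉ interior P := by
  intro hi
  obtain ⟨δ, hδ, hb⟩ := Metric.mem_nhds_iff.1 (mem_interior_iff_mem_nhds.1 hi)
  have h1 := h.lt_half hv hδ
  rw [inter_eq_right.2 hb, volume_real_ball v hδ.le] at h1
  have := pi_pos
  have : 0 < π * δ ^ 2 := by positivity
  linarith

/-- A vertex is a point of the circumcircle, so the polygon fills less than half of a disc about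
it. -/
lemma angle_lt_pi (h : IsRoundTile P V p R θ) {v : Plane} (hv : v ∈ V) : θ v < π := by
  obtain ⟨δ, hδ, hs⟩ := h.sector v hv
  have h1 := hs δ hδ le_rfl
  have h2 := h.lt_half hv hδ
  rw [volume_real_ball v hδ.le] at h2
  have h3 : θ v / 2 * δ ^ 2 < π / 2 * δ ^ 2 := by linarith
  have := lt_of_mul_lt_mul_right h3 (by positivity)
  linarith

end IsRoundTile

/-- A partition of the plane into round tiles of bounded circumradius, with areas bounded away
from `0`. -/
structure IsRoundTiling {ι : Type} (P : ι → Set Plane) (V : ι → Finset Plane) (p : ι → Plane)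
    (R : ι → ℝ) (θ : ι → Plane → ℝ) (c D : ℝ) : Prop where
  tile : ∀ i, IsRoundTile (P i) (V i) (p i) (R i) (θ i)
  partition : IsPlanePartition P
  area_lower_pos : 0 < c
  area_lower : ∀ i, c ≤ volume.real (P i)
  radius_le : ∀ i, R i ≤ D
  radius_bound_pos : 0 < D

namespace IsRoundTiling

variable {ι : Type} {P : ι → Set Plane} {V : ι → Finset Plane} {p : ι → Plane}
    {R : ι → ℝ} {θ : ι → Plane → ℝ} {c D : ℝ}

lemma dist_le (h : IsRoundTiling P V p R θ c D) {i : ι} {x y : Plane} (hx : x ∈ P i)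
    (hy : y ∈ P i) : dist x y ≤ 2 * D := by
  have h1 := (h.tile i).subset_closedBall hx
  have h2 := (h.tile i).subset_closedBall hy
  rw [Metric.mem_closedBall] at h1 h2
  have := dist_triangle_right x y (p i)
  linarith [h.radius_le i]

lemma sum_volume_inter_le (h : IsRoundTiling P V p R θ c D) (s : Finset ι) {E : Set Plane}
    (hE : MeasurableSet E) (hfin : volume E ≠ ⊤) :
    ∑ i ∈ s, volume.real (P i ∩ E) ≤ volume.real E := by
  calc ∑ i ∈ s, volume.real (P i ∩ E) ≤ ∑ i ∈ s, volume.real (interior (P i) ∩ E) :=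
        Finset.sum_le_sum fun i _ => volume_real_interior_inter (h.tile i).convex E
    _ = volume.real (⋃ i ∈ s, interior (P i) ∩ E) := by
        rw [measureReal_biUnion_finset]
        · intro i _ j _ hij
          exact (h.partition.2 hij).mono inter_subset_left inter_subset_left
        · exact fun i _ => isOpen_interior.measurableSet.inter hE
    _ ≤ volume.real E := measureReal_mono (iUnion₂_subset fun i _ => inter_subset_right) hfin

lemma card_mul_le (h : IsRoundTiling P V p R θ c D) (s : Finset ι) {E : Set Plane}
    (hE : MeasurableSet E) (hfin : volume E ≠ ⊤) (hs : ∀ i ∈ s, P i ⊆ E) :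
    s.card * c ≤ volume.real E := by
  refine le_trans ?_ (h.sum_volume_inter_le s hE hfin)
  rw [← nsmul_eq_mul]
  refine Finset.card_nsmul_le_sum _ _ _ fun i hi => ?_
  rw [inter_eq_left.2 (hs i hi)]
  exact h.area_lower i

lemma card_meeting_le (h : IsRoundTiling P V p R θ c D) (x : Plane) {ρ : ℝ} (hρ : 0 ≤ ρ)
    (s : Finset ι) (hs : ∀ i ∈ s, (P i ∩ Metric.closedBall x ρ).Nonempty) :
    s.card * c ≤ π * (ρ + 2 * D + 1) ^ 2 := by
  have hD := h.radius_bound_pos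
  rw [← volume_real_ball x (by linarith)]
  refine h.card_mul_le s Metric.isOpen_ball.measurableSet measure_ball_lt_top.ne fun i hi y hy => ?_
  obtain ⟨z, hz, hzx⟩ := hs i hi
  rw [Metric.mem_closedBall] at hzx
  rw [Metric.mem_ball]
  linarith [dist_triangle y z x, h.dist_le hy hz]

lemma finite_meeting (h : IsRoundTiling P V p R θ c D) (x : Plane) {ρ : ℝ} (hρ : 0 ≤ ρ) :
    {i | (P i ∩ Metric.closedBall x ρ).Nonempty}.Finite := by
  by_contra hinf
  obtain ⟨m, hm⟩ := exists_nat_gt (π * (ρ + 2 * D + 1) ^ 2 / c)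
  obtain ⟨s, hs, hcard⟩ := Set.Infinite.exists_subset_card_eq hinf m
  have := h.card_meeting_le x hρ s fun i hi => hs hi
  rw [hcard, ← le_div_iff₀ h.area_lower_pos] at this
  linarith

/-- The tiles near a point are the tiles containing it. -/
lemma exists_ball_meets (h : IsRoundTiling P V p R θ c D) (v : Plane) :
    ∃ δ > 0, ∀ j, (P j ∩ Metric.ball v δ).Nonempty → v ∈ P j := by
  have hfin := h.finite_meeting v zero_le_one
  have hclosed : IsClosed (⋃ j ∈ {i | (P i ∩ Metric.closedBall v 1).Nonempty} ∩ {j | v ∉ P j},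
      P j) := (hfin.inter_of_left _).isClosed_biUnion fun j _ => (h.tile j).isCompact.isClosed
  have hv : v ∉ ⋃ j ∈ {i | (P i ∩ Metric.closedBall v 1).Nonempty} ∩ {j | v ∉ P j}, P j := by
    simp only [mem_iUnion, not_exists]
    rintro j ⟨-, h2⟩ h3
    exact h2 h3
  obtain ⟨δ, hδ, hb⟩ := Metric.mem_nhds_iff.1 (hclosed.isOpen_compl.mem_nhds hv)
  refine ⟨min δ 1, by positivity, fun j ⟨y, hy, hyb⟩ => ?_⟩
  by_contra hvj
  refine hb (Metric.ball_subset_ball (min_le_left _ _) hyb) ?_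
  simp only [mem_iUnion]
  exact ⟨j, ⟨⟨y, hy, Metric.ball_subset_closedBall
    (Metric.ball_subset_ball (min_le_right _ _) hyb)⟩, hvj⟩, hy⟩

lemma finite_containing (h : IsRoundTiling P V p R θ c D) (v : Plane) : {j | v ∈ P j}.Finite :=
  (h.finite_meeting v zero_le_one).subset fun _ hj =>
    ⟨v, hj, Metric.mem_closedBall_self zero_le_one⟩

lemma exists_mem_ne (h : IsRoundTiling P V p R θ c D) {i : ι} {v : Plane} (hv : v ∈ V i) :
    ∃ j ≠ i, v ∈ P j := by
  by_contra! hcon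
  obtain ⟨δ, hδ, hb⟩ := h.exists_ball_meets v
  refine (h.tile i).not_mem_interior hv (mem_interior_iff_mem_nhds.2
    (Filter.mem_of_superset (Metric.ball_mem_nhds v hδ) fun y hy => ?_))
  have hy' : y ∈ ⋃ j, P j := by rw [h.partition.1]; trivial
  obtain ⟨j, hj⟩ := mem_iUnion.1 hy'
  by_cases hji : j = i
  · rwa [hji] at hj
  · exact absurd (hb j ⟨y, hj, hy⟩) (hcon j hji)

/-- Two tiles share at most two points of the circumcircle of one of them, since three points of a
circle span a triangle. -/
lemma card_shared_le_two (h : IsRoundTiling P V p R θ c D) {i j : ι} (hij : j ≠ i)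
    [DecidablePred fun v => v ∈ P j] : ((V i).filter fun v => v ∈ P j).card ≤ 2 := by
  by_contra! hcon
  obtain ⟨a, b, d, ha, hb, hd, hab, had, hbd⟩ := Finset.two_lt_card_iff.1 hcon
  simp only [Finset.mem_filter] at ha hb hd
  have hco : EuclideanGeometry.Cospherical ({a, b, d} : Set Plane) := by
    refine ⟨p i, R i, ?_⟩
    rintro x (rfl | rfl | rfl)
    · exact (h.tile i).sphere _ ha.1
    · exact (h.tile i).sphere _ hb.1
    · exact (h.tile i).sphere _ hd.1
  have hrange : range ![a, b, d] = {a, b, d} := by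
    ext x; simp [eq_comm]; tauto
  have hAI := hco.affineIndependent (p := ![a, b, d]) hrange.le (by
    intro x y hxy
    fin_cases x <;> fin_cases y <;> simp_all)
  have hspan : affineSpan ℝ (range ![a, b, d]) = ⊤ :=
    hAI.affineSpan_eq_top_iff_card_eq_finrank_add_one.2 (by simp)
  obtain ⟨x, hx⟩ := interior_convexHull_nonempty_iff_affineSpan_eq_top.2 hspan
  rw [hrange] at hx
  have hsub : ∀ Q : Set Plane, Convex ℝ Q → a ∈ Q → b ∈ Q → d ∈ Q →
      convexHull ℝ {a, b, d} ⊆ Q := by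
    intro Q hQ h1 h2 h3
    refine convexHull_min ?_ hQ
    rintro x (rfl | rfl | rfl) <;> assumption
  have h1 := interior_mono (hsub _ (h.tile i).convex ((h.tile i).mem ha.1) ((h.tile i).mem hb.1)
    ((h.tile i).mem hd.1)) hx
  have h2 := interior_mono (hsub _ (h.tile j).convex ha.2 hb.2 hd.2) hx
  exact Set.disjoint_left.1 (h.partition.2 hij) h2 h1

/-- The number of sides is bounded by the number of neighbours, hence by a packing argument. -/
lemma card_vertices_le (h : IsRoundTiling P V p R θ c D) (i : ι) :
    ((V i).card : ℝ) ≤ 2 * (π * (3 * D + 1) ^ 2 / c) := by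
  classical
  have hD := h.radius_bound_pos
  set J := (h.finite_meeting (p i) hD.le).toFinset.erase i with hJ
  have h1 : V i ⊆ J.biUnion fun j => (V i).filter fun v => v ∈ P j := by
    intro v hv
    obtain ⟨j, hji, hvj⟩ := h.exists_mem_ne hv
    simp only [Finset.mem_biUnion, Finset.mem_filter]
    refine ⟨j, ?_, hv, hvj⟩
    simp only [hJ, Finset.mem_erase, Finite.mem_toFinset, mem_ofPred_eq]
    refine ⟨hji, v, hvj, Metric.mem_closedBall.2 ?_⟩
    rw [(h.tile i).sphere v hv]
    exact h.radius_le i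
  have h2 := (Finset.card_le_card h1).trans (Finset.card_biUnion_le_card_mul J _ 2 fun j hj =>
    h.card_shared_le_two (Finset.ne_of_mem_erase hj))
  have h3 := h.card_meeting_le (p i) hD.le J fun j hj => by
    have := Finset.mem_of_mem_erase hj
    simpa using this
  rw [← le_div_iff₀ h.area_lower_pos] at h3
  have h4 : ((V i).card : ℝ) ≤ J.card * 2 := by exact_mod_cast h2
  rw [show D + 2 * D + 1 = 3 * D + 1 by ring] at h3
  linarith

/-- The angles at a point average to at most `2 π / 3`. If `e` tiles contain the point but do not
have it as a vertex, then each of these fills half a disc, and the other tiles fill less than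
half a disc each. -/
lemma sum_angles_le (h : IsRoundTiling P V p R θ c D) (v : Plane) (K : Finset ι)
    (hK : ∀ i, i ∈ K ↔ v ∈ V i) : ∑ i ∈ K, θ i v ≤ 2 * π / 3 * K.card := by
  classical
  rcases K.eq_empty_or_nonempty with rfl | hKn
  · simp
  obtain ⟨δ₁, hδ₁, hmeet⟩ := h.exists_ball_meets v
  set J := (h.finite_containing v).toFinset with hJ
  have hJmem : ∀ i, i ∈ J ↔ v ∈ P i := by simp [hJ]
  have hKJ : K ⊆ J := fun i hi => (hJmem i).2 ((h.tile i).mem ((hK i).1 hi))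
  -- no tile has the point in its interior
  have hnint : ∀ i, v ∉ interior (P i) := by
    intro i hi
    obtain ⟨k, hk⟩ := hKn
    have hkV := (hK k).1 hk
    have hik : i ≠ k := by
      rintro rfl
      exact (h.tile i).not_mem_interior hkV hi
    have h1 : v ∈ closure (interior (P k)) := by
      rw [(h.tile k).convex.closure_interior_eq_closure_of_nonempty_interior
        (h.tile k).interior_nonempty]
      exact subset_closure ((h.tile k).mem hkV)
    obtain ⟨y, hy1, hy2⟩ := mem_closure_iff.1 h1 _ isOpen_interior hi
    exact Set.disjoint_left.1 (h.partition.2 hik) hy1 hy2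
  have hnonext : ∀ i, i ∈ J \ K → ∃ δ₀ > 0, ∀ δ, 0 < δ → δ ≤ δ₀ →
      volume.real (Metric.ball v δ) / 2 ≤ volume.real (P i ∩ Metric.ball v δ) := by
    intro i hi
    rw [Finset.mem_sdiff, hJmem, hK] at hi
    refine half_le_volume_real_inter_ball (h.tile i).convex (h.tile i).interior_nonempty
      (h.tile i).isCompact.measure_lt_top.ne hi.1 fun hext => hi.2 ?_
    rw [(h.tile i).hull_eq] at hext
    exact extremePoints_convexHull_subset hext
  have hex : ∀ i, ∃ δ₀ > 0, (i ∈ J \ K → ∀ δ, 0 < δ → δ ≤ δ₀ →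
      volume.real (Metric.ball v δ) / 2 ≤ volume.real (P i ∩ Metric.ball v δ)) ∧
      (i ∈ K → ∀ δ, 0 < δ → δ ≤ δ₀ →
        θ i v / 2 * δ ^ 2 ≤ volume.real (P i ∩ Metric.ball v δ)) := by
    intro i
    by_cases hiK : i ∈ K
    · obtain ⟨δ₀, h1, h2⟩ := (h.tile i).sector v ((hK i).1 hiK)
      exact ⟨δ₀, h1, fun hi => absurd hiK (Finset.mem_sdiff.1 hi).2, fun _ => h2⟩
    · by_cases hiJ : i ∈ J \ K
      · obtain ⟨δ₀, h1, h2⟩ := hnonext i hiJ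
        exact ⟨δ₀, h1, fun _ => h2, fun hi => absurd hi hiK⟩
      · exact ⟨1, one_pos, fun hi => absurd hi hiJ, fun hi => absurd hi hiK⟩
  choose d hd0 hd1 hd2 using hex
  obtain ⟨δ, hδ, hδ₁', hδJ⟩ : ∃ δ > 0, δ ≤ δ₁ ∧ ∀ i ∈ J, δ ≤ d i := by
    have hJn : J.Nonempty := hKn.mono hKJ
    refine ⟨min δ₁ (J.inf' hJn d), lt_min hδ₁ ?_, min_le_left _ _, fun i hi =>
      (min_le_right _ _).trans (Finset.inf'_le d hi)⟩
    rw [Finset.lt_inf'_iff]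
    exact fun i _ => hd0 i
  set m : ι → ℝ := fun i => volume.real (P i ∩ Metric.ball v δ) with hm
  have hball := volume_real_ball v hδ.le
  set x := volume.real (Metric.ball v δ) with hx
  have hx0 : 0 < x := by have := pi_pos; rw [hball]; positivity
  have hbfin : volume (Metric.ball v δ) ≠ ⊤ := measure_ball_lt_top.ne
  -- the tiles containing the point fill a small disc exactly once
  have hsum : ∑ i ∈ J, m i = x := by
    refine le_antisymm (h.sum_volume_inter_le J Metric.isOpen_ball.measurableSet hbfin) ?_
    have hcov : Metric.ball v δ ⊆ ⋃ i ∈ J, P i ∩ Metric.ball v δ := by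
      intro y hy
      have hy' : y ∈ ⋃ j, P j := by rw [h.partition.1]; trivial
      obtain ⟨j, hj⟩ := mem_iUnion.1 hy'
      exact mem_biUnion ((hJmem j).2 (hmeet j ⟨y, hj, Metric.ball_subset_ball hδ₁' hy⟩)) ⟨hj, hy⟩
    refine (measureReal_mono hcov ?_).trans (measureReal_biUnion_finset_le J _)
    exact ((measure_mono (iUnion₂_subset fun i _ => inter_subset_right)).trans_lt hbfin.lt_top).ne
  have hsplit : ∑ i ∈ J \ K, m i + ∑ i ∈ K, m i = x := by
    rw [Finset.sum_sdiff hKJ, hsum]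
  have hupper : ∀ i ∈ K, m i < x / 2 := fun i hi => (h.tile i).lt_half ((hK i).1 hi) hδ
  have hupper' : ∀ i ∈ J \ K, m i ≤ x / 2 := fun i _ =>
    volume_real_inter_ball_le_half (h.tile i).convex (hnint i) δ
  have hlower : ∀ i ∈ K, θ i v / 2 * δ ^ 2 ≤ m i := fun i hi =>
    hd2 i hi δ hδ (hδJ i (hKJ hi))
  have hlower' : ∀ i ∈ J \ K, x / 2 ≤ m i := fun i hi =>
    hd1 i hi δ hδ (hδJ i (Finset.sdiff_subset hi))
  have hpos : 0 < ∑ i ∈ K, m i := Finset.sum_pos (fun i hi =>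
    (by have := (h.tile i).angle_pos v ((hK i).1 hi); positivity :
      0 < θ i v / 2 * δ ^ 2).trans_le (hlower i hi)) hKn
  have hltK : ∑ i ∈ K, m i < K.card * (x / 2) := by
    rw [← nsmul_eq_mul, ← Finset.sum_const]
    exact Finset.sum_lt_sum_of_nonempty hKn hupper
  have he1 : (J \ K).card * (x / 2) ≤ ∑ i ∈ J \ K, m i := by
    rw [← nsmul_eq_mul]
    exact Finset.card_nsmul_le_sum _ _ _ hlower'
  have he2 : ∑ i ∈ J \ K, m i ≤ (J \ K).card * (x / 2) := by
    rw [← nsmul_eq_mul]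
    exact Finset.sum_le_card_nsmul _ _ _ hupper'
  -- the number of tiles in `J \ K` is `0` or `1`, and then `K` has at least three or two elements
  have hkey : ∑ i ∈ K, m i ≤ K.card * (x / 3) := by
    generalize (J \ K).card = e at *
    generalize K.card = k at *
    generalize ∑ i ∈ K, m i = SK at *
    generalize ∑ i ∈ J \ K, m i = SE at *
    rcases Nat.lt_or_ge e 2 with he | he
    · interval_cases e
      · have hk : 2 < k := by
          by_contra! hk
          have : (k : ℝ) ≤ 2 := by exact_mod_cast hk
          push_cast at *
          nlinarith
        have : (3 : ℝ) ≤ k := by exact_mod_cast hk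
        push_cast at *
        nlinarith
      · have hk : 1 < k := by
          by_contra! hk
          have : (k : ℝ) ≤ 1 := by exact_mod_cast hk
          push_cast at *
          nlinarith
        have : (2 : ℝ) ≤ k := by exact_mod_cast hk
        push_cast at *
        nlinarith
    · have : (2 : ℝ) ≤ e := by exact_mod_cast he
      nlinarith
  have hfin : (∑ i ∈ K, θ i v) / 2 * δ ^ 2 ≤ 2 * π / 3 * K.card / 2 * δ ^ 2 := by
    calc (∑ i ∈ K, θ i v) / 2 * δ ^ 2 = ∑ i ∈ K, θ i v / 2 * δ ^ 2 := by
          rw [Finset.sum_div, Finset.sum_mul]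
      _ ≤ ∑ i ∈ K, m i := Finset.sum_le_sum hlower
      _ ≤ _ := hkey
      _ = _ := by rw [hball]; ring
  have := le_of_mul_le_mul_right hfin (by positivity)
  linarith

/-- Summation of the angles of finitely many tiles. Only the tiles touching another tile outside
the family can contribute to an excess of the mean number of sides over `6`. -/
lemma sum_card_sub_six_le (h : IsRoundTiling P V p R θ c D) (T B : Finset ι) (hBT : B ⊆ T)
    (hB : ∀ i ∈ T, ∀ j, j ∉ T → (P i ∩ P j).Nonempty → i ∈ B) :
    ∑ i ∈ T, (((V i).card : ℝ) - 6) ≤ ∑ i ∈ B, ((V i).card : ℝ) := by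
  classical
  have hpi := pi_pos
  set W := T.biUnion V with hW
  have hswap : ∀ (S : Finset ι), S ⊆ T → ∀ F : ι → Plane → ℝ, ∑ i ∈ S, ∑ v ∈ V i, F i v
      = ∑ v ∈ W, ∑ i ∈ S with v ∈ V i, F i v := by
    intro S hS F
    refine Finset.sum_comm' fun i v => ?_
    simp only [Finset.mem_filter, hW, Finset.mem_biUnion]
    exact ⟨fun ⟨h1, h2⟩ => ⟨⟨h1, h2⟩, i, hS h1, h2⟩, fun ⟨h1, _⟩ => h1⟩
  have hcard : ∀ (S : Finset ι), S ⊆ T → ∑ i ∈ S, ((V i).card : ℝ)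
      = ∑ v ∈ W, ((S.filter fun i => v ∈ V i).card : ℝ) := by
    intro S hS
    have := hswap S hS fun _ _ => 1
    simpa using this
  have h1 : ∑ i ∈ T, (((V i).card : ℝ) - 2) * π ≤ ∑ i ∈ T, ∑ v ∈ V i, θ i v :=
    Finset.sum_le_sum fun i _ => (h.tile i).angle_sum
  -- at a point that only tiles of the family contain the mean angle is at most `2 π / 3`; at any
  -- other point all tiles with a vertex there belong to `B`, and each angle is less than `π`
  have h2 : ∀ v ∈ W, ∑ i ∈ T with v ∈ V i, θ i v
      ≤ 2 * π / 3 * (T.filter fun i => v ∈ V i).card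
        + π / 3 * (B.filter fun i => v ∈ V i).card := by
    intro v _
    by_cases hgood : ∀ j, v ∈ P j → j ∈ T
    · have := h.sum_angles_le v (T.filter fun i => v ∈ V i) fun i => by
        simp only [Finset.mem_filter, and_iff_right_iff_imp]
        exact fun hi => hgood i ((h.tile i).mem hi)
      have h3 : 0 ≤ π / 3 * ((B.filter fun i => v ∈ V i).card : ℝ) := by positivity
      linarith
    · push Not at hgood
      obtain ⟨j, hvj, hjT⟩ := hgood
      have hsub : (T.filter fun i => v ∈ V i) = B.filter fun i => v ∈ V i := by
        ext i
        simp only [Finset.mem_filter]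
        exact ⟨fun ⟨h3, h4⟩ => ⟨hB i h3 j hjT ⟨v, (h.tile i).mem h4, hvj⟩, h4⟩,
          fun ⟨h3, h4⟩ => ⟨hBT h3, h4⟩⟩
      have h3 : ∑ i ∈ T with v ∈ V i, θ i v ≤ (T.filter fun i => v ∈ V i).card • π :=
        Finset.sum_le_card_nsmul _ _ _ fun i hi =>
          ((h.tile i).angle_lt_pi (Finset.mem_filter.1 hi).2).le
      rw [nsmul_eq_mul] at h3
      rw [← hsub]
      linarith
  have h3 := Finset.sum_le_sum h2
  rw [← hswap T subset_rfl, Finset.sum_add_distrib, ← Finset.mul_sum, ← Finset.mul_sum,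
    ← hcard T subset_rfl, ← hcard B hBT] at h3
  rw [← Finset.sum_mul] at h1
  have h4 := h1.trans h3
  rw [Finset.sum_sub_distrib] at h4 ⊢
  simp only [Finset.sum_const, nsmul_eq_mul] at h4 ⊢
  have h5 : (∑ i ∈ T, ((V i).card : ℝ) - T.card * 6) * (π / 3)
      ≤ (∑ i ∈ B, ((V i).card : ℝ)) * (π / 3) := by linarith
  exact le_of_mul_le_mul_right h5 (by positivity)

end IsRoundTiling

/-! ### The mean number of sides in a tiling by optimal polygons -/

/-- A bound on the areas bounds the circumradii, because each tile contains a disc of radius at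
least `R cos α*(3)`. -/
lemma exists_isRoundTiling {r : ℝ} (hr : 0 ≤ r) {ι : Type} {n : ι → ℕ} {P : ι → Set Plane}
    {c C : ℝ} (hn : ∀ i, 3 ≤ n i) (hP : ∀ i, IsOptimalCyclicPolygon r (n i) (P i)) (hc : 0 < c)
    (hA : ∀ i, c ≤ area (P i) ∧ area (P i) ≤ C) (hpart : IsPlanePartition P) :
    ∃ V p R θ D, IsRoundTiling P V p R θ c D ∧ ∀ i, (V i).card = n i := by
  choose V p R θ hcard htile hball using fun i => exists_isRoundTile_of_optimal hr (hn i) (hP i)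
  have hγ := cos_pos_of_mem (alphaStar_mem (n := 3) (by norm_num) hr)
  set γ := cos (alphaStar 3 r)
  refine ⟨V, p, R, θ, √(C / (π * γ ^ 2)) + 1, ⟨htile, hpart, hc, fun i => (hA i).1, fun i => ?_,
    by positivity⟩, hcard⟩
  have hR := (htile i).radius_pos
  have h1 : π * (R i * γ) ^ 2 ≤ C := by
    rw [← volume_real_ball (p i) (by positivity)]
    exact (measureReal_mono (hball i) (htile i).isCompact.measure_lt_top.ne).trans (hA i).2
  have h2 : R i ≤ √(C / (π * γ ^ 2)) := by
    refine le_sqrt_of_sq_le ?_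
    have := pi_pos
    rw [le_div_iff₀ (by positivity)]
    linarith
  linarith

lemma meanSides_le {ι : Type} {T : Finset ι} {n : ι → ℕ} {δ : ℝ} (hT : T.Nonempty)
    (h : ∑ i ∈ T, ((n i : ℝ) - 6) ≤ δ * T.card) : meanSides T n ≤ 6 + δ := by
  have hc : 0 < (T.card : ℝ) := by exact_mod_cast hT.card_pos
  rw [Finset.sum_sub_distrib, Finset.sum_const, nsmul_eq_mul] at h
  unfold meanSides
  rw [div_le_iff₀ hc]
  linarith

/-- In large discs the tiles near the boundary are few compared to all tiles. -/
lemma exists_disc_mean_le {ι : Type} {P : ι → Set Plane} {V : ι → Finset Plane} {p : ι → Plane}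
    {R : ι → ℝ} {θ : ι → Plane → ℝ} {c C D δ : ℝ} (h : IsRoundTiling P V p R θ c D)
    (hC : ∀ i, volume.real (P i) ≤ C) (hδ : 0 < δ) :
    ∃ ρ₀ : ℝ, ∀ ρ : ℝ, ρ₀ ≤ ρ → ∃ T : Finset ι, (∀ i, i ∈ T ↔ P i ⊆ Metric.closedBall 0 ρ) ∧
      T.Nonempty ∧ ∑ i ∈ T, (((V i).card : ℝ) - 6) ≤ δ * T.card := by
  classical
  have hD := h.radius_bound_pos
  have hc := h.area_lower_pos
  have hpi := pi_pos
  have hcov : ∀ y, ∃ j, y ∈ P j := by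
    intro y
    have hy : y ∈ ⋃ j, P j := by rw [h.partition.1]; trivial
    exact mem_iUnion.1 hy
  have hC0 : 0 < C := by
    obtain ⟨j, -⟩ := hcov 0
    exact hc.trans_le ((h.area_lower j).trans (hC j))
  set M := 2 * (π * (3 * D + 1) ^ 2 / c) with hM
  have hM0 : 0 < M := by positivity
  refine ⟨max (4 * D) (32 * D * M * C / (c * δ)), fun ρ hρ => ?_⟩
  have hρ1 : 4 * D ≤ ρ := (le_max_left _ _).trans hρ
  have hρ2 : 32 * D * M * C / (c * δ) ≤ ρ := (le_max_right _ _).trans hρ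
  have hρ0 : 0 < ρ := by linarith
  have hfin : {i | P i ⊆ Metric.closedBall 0 ρ}.Finite := by
    refine (h.finite_meeting 0 hρ0.le).subset fun i hi => ?_
    obtain ⟨y, hy⟩ := (h.tile i).interior_nonempty
    exact ⟨y, interior_subset hy, hi (interior_subset hy)⟩
  set T := hfin.toFinset with hT
  have hTmem : ∀ i, i ∈ T ↔ P i ⊆ Metric.closedBall 0 ρ := by simp [hT]
  -- the tiles inside the disc cover a slightly smaller disc
  have hTC : π * (ρ - 2 * D) ^ 2 ≤ T.card * C := by
    rw [← volume_real_ball (0 : Plane) (by linarith)]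
    have hsub : Metric.ball (0 : Plane) (ρ - 2 * D) ⊆ ⋃ i ∈ T, P i := by
      intro y hy
      obtain ⟨j, hj⟩ := hcov y
      refine mem_biUnion ((hTmem j).2 fun z hz => ?_) hj
      rw [Metric.mem_ball] at hy
      rw [Metric.mem_closedBall]
      linarith [dist_triangle z y 0, h.dist_le hz hj]
    have hlt : volume (⋃ i ∈ T, P i) < ⊤ :=
      measure_biUnion_lt_top T.finite_toSet fun i _ => (h.tile i).isCompact.measure_lt_top
    calc volume.real (Metric.ball (0 : Plane) (ρ - 2 * D)) ≤ volume.real (⋃ i ∈ T, P i) :=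
          measureReal_mono hsub hlt.ne
      _ ≤ ∑ i ∈ T, volume.real (P i) := measureReal_biUnion_finset_le T _
      _ ≤ T.card • C := Finset.sum_le_card_nsmul _ _ _ fun i _ => hC i
      _ = _ := nsmul_eq_mul _ _
  have hTn : T.Nonempty := by
    rw [← Finset.card_pos]
    have h1 : 0 < ρ - 2 * D := by linarith
    have h2 : 0 < (T.card : ℝ) * C := lt_of_lt_of_le (by positivity) hTC
    exact_mod_cast pos_of_mul_pos_left h2 hC0.le
  refine ⟨T, hTmem, hTn, ?_⟩
  set B := T.filter fun i => ∃ j, j ∉ T ∧ (P i ∩ P j).Nonempty with hB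
  have h1 := h.sum_card_sub_six_le T B (Finset.filter_subset _ _) fun i hi j hj hij =>
    Finset.mem_filter.2 ⟨hi, j, hj, hij⟩
  -- tiles touching a tile which leaves the disc lie in an annulus
  have hBc : B.card * c ≤ π * (8 * D * ρ) := by
    have h2 := h.card_mul_le B (E := Metric.closedBall 0 ρ \ Metric.ball 0 (ρ - 4 * D))
      (Metric.isClosed_closedBall.measurableSet.diff Metric.isOpen_ball.measurableSet)
      ((measure_mono sdiff_subset).trans_lt measure_closedBall_lt_top).ne ?_
    · refine h2.trans ?_
      rw [measureReal_sdiff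
        (Metric.ball_subset_closedBall.trans (Metric.closedBall_subset_closedBall (by linarith)))
        Metric.isOpen_ball.measurableSet measure_closedBall_lt_top.ne, measureReal_def,
        Measure.addHaar_closedBall_eq_addHaar_ball, ← measureReal_def, volume_real_ball _ hρ0.le,
        volume_real_ball _ (by linarith)]
      nlinarith [mul_pos hpi (mul_pos hD hD)]
    · intro i hi x hx
      obtain ⟨hiT, j, hjT, z, hzi, hzj⟩ := Finset.mem_filter.1 hi
      refine ⟨(hTmem i).1 hiT hx, fun hxb => hjT ((hTmem j).2 fun y hy => ?_)⟩
      rw [Metric.mem_ball] at hxb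
      rw [Metric.mem_closedBall]
      linarith [dist_triangle y z 0, dist_triangle z x 0, h.dist_le hy hzj, h.dist_le hzi hx]
  have h3 : ∑ i ∈ B, ((V i).card : ℝ) ≤ B.card * M := by
    rw [← nsmul_eq_mul]
    exact Finset.sum_le_card_nsmul _ _ _ fun i _ => h.card_vertices_le i
  have h4 : (B.card : ℝ) ≤ π * (8 * D * ρ) / c := by rwa [le_div_iff₀ hc]
  have h5 : π * (ρ ^ 2 / 4) / C ≤ T.card := by
    rw [div_le_iff₀ hC0]
    refine le_trans ?_ hTC
    gcongr
    nlinarith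
  have h6 : π * (8 * D * ρ) / c * M ≤ δ * (π * (ρ ^ 2 / 4) / C) := by
    rw [div_le_iff₀ (by positivity)] at hρ2
    rw [div_mul_eq_mul_div, mul_div_assoc', div_le_div_iff₀ hc hC0]
    have := mul_le_mul_of_nonneg_left hρ2 (by positivity : 0 ≤ π * ρ / 4)
    linarith
  calc _ ≤ _ := h1
    _ ≤ B.card * M := h3
    _ ≤ π * (8 * D * ρ) / c * M := by gcongr
    _ ≤ δ * (π * (ρ ^ 2 / 4) / C) := h6
    _ ≤ δ * T.card := by gcongr

lemma partition_bounds {κ f r : ℝ} (hκ : 0 < κ) (hf : 0 < f) (hr : 0 ≤ r) (ι : Type) (n : ι → ℕ)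
    (P : ι → Set Plane) (c C : ℝ) (hn : ∀ i, 3 ≤ n i)
    (hP : ∀ i, IsOptimalCyclicPolygon r (n i) (P i)) (hc : 0 < c)
    (hA : ∀ i, c ≤ area (P i) ∧ area (P i) ≤ C) (hpart : IsPlanePartition P) (ε : ℝ) (hε : 0 < ε) :
    ∃ ρ₀ : ℝ, ∀ ρ : ℝ, ρ₀ ≤ ρ →
      ∃ T : Finset ι, (∀ i, i ∈ T ↔ P i ⊆ Metric.closedBall 0 ρ) ∧ T.Nonempty ∧
        costBound r T (fun i => area (P i)) (meanSides T n)
          ≤ averagedCost r T n (fun i => area (P i)) ∧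
        (1 - ε) * costBound r T (fun i => area (P i)) 6
          ≤ costBound r T (fun i => area (P i)) (meanSides T n) ∧
        (1 - ε) * zUb κ f r ≤ totalCost κ f r T n (fun i => area (P i)) := by
  obtain ⟨V, p, R, θ, D, htil, hcard⟩ := exists_isRoundTiling hr hn hP hc hA hpart
  obtain ⟨δ, hδ, hbound⟩ := exists_costBound_le hr hε
  obtain ⟨ρ₀, hρ₀⟩ := exists_disc_mean_le htil (fun i => (hA i).2) hδ
  refine ⟨ρ₀, fun ρ hρ => ?_⟩
  obtain ⟨T, hT, hTn, hsum⟩ := hρ₀ ρ hρ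
  simp only [hcard] at hsum
  have hpos : ∀ i ∈ T, 0 < area (P i) := fun i _ => hc.trans_le (hA i).1
  have h1 := hbound ι T (fun i => area (P i)) (meanSides T n) hTn
    (by linarith [three_le_meanSides T n hTn fun i _ => hn i]) (meanSides_le hTn hsum)
  exact ⟨T, hT, hTn, costBound_le_averagedCost hr T n _ hTn (fun i _ => hn i) hpos, h1,
    le_totalCost hκ hf hr hε.le T n _ hTn (fun i _ => hn i) hpos h1⟩

lemma volume_real_translate (w : Plane) (S : Set Plane) :
    volume.real ((fun y => y + w) '' S) = volume.real S := by
  rw [Set.image_add_right, measureReal_def, measureReal_def, measure_preimage_add_right]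

lemma area_optimal_pos {r : ℝ} {n : ℕ} {S : Set Plane} (hr : 0 ≤ r) (hn : 3 ≤ n)
    (h : IsOptimalCyclicPolygon r n S) : 0 < area S := by
  obtain ⟨V, p, R, θ, -, hT, -⟩ := exists_isRoundTile_of_optimal hr hn h
  refine ENNReal.toReal_pos (ne_of_gt ?_) hT.isCompact.measure_lt_top.ne
  exact (isOpen_interior.measure_pos volume hT.interior_nonempty).trans_le
    (measure_mono interior_subset)

/-- In a periodic tiling the mean number of sides is at most `6`: in a box of `(2 L + 1)²` periods
the excess over `6` grows with the area of the box, but is bounded by its perimeter. -/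
lemma periodic_sum_le {r : ℝ} (hr : 0 ≤ r) (N : ℕ) (n : Fin N → ℕ)
    (P : Fin N → Set Plane) (u v : Plane) (hN : 1 ≤ N) (hn : ∀ i, 3 ≤ n i)
    (hP : ∀ i, IsOptimalCyclicPolygon r (n i) (P i))
    (hpart : IsPlanePartition (fun q : Fin N × ℤ × ℤ =>
        (fun y => y + ((q.2.1 : ℝ) • u + (q.2.2 : ℝ) • v)) '' P q.1)) :
    ∑ q, ((n q : ℝ) - 6) ≤ 0 := by
  classical
  set Q : Fin N × ℤ × ℤ → Set Plane := fun q =>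
    (fun y => y + ((q.2.1 : ℝ) • u + (q.2.2 : ℝ) • v)) '' P q.1 with hQ
  have : Nonempty (Fin N) := ⟨⟨0, hN⟩⟩
  have hpos : ∀ q, 0 < area (P q) := fun q => area_optimal_pos hr (hn q) (hP q)
  have harea : ∀ q, area (Q q) = area (P q.1) := fun q => volume_real_translate _ _
  obtain ⟨q₀, hq₀⟩ := Finite.exists_min fun q => area (P q)
  obtain ⟨q₁, hq₁⟩ := Finite.exists_max fun q => area (P q)
  obtain ⟨V, p, R, θ, D, htil, hcard⟩ := exists_isRoundTiling (n := fun q => n q.1) hr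
    (fun q => hn q.1) (fun q => (hP q.1).translate _) (hpos q₀)
    (fun q => by
      rw [harea]
      exact ⟨hq₀ q.1, hq₁ q.1⟩) hpart
  have hD := htil.radius_bound_pos
  -- tiles in contact have lattice positions at bounded distance
  obtain ⟨K, hK⟩ : ∃ K : ℕ, ∀ q q' : Fin N × ℤ × ℤ, (Q q ∩ Q q').Nonempty →
      (q'.2.1 - q.2.1).natAbs ≤ K ∧ (q'.2.2 - q.2.2).natAbs ≤ K := by
    have hfin : (⋃ q : Fin N, {q' | (Q q' ∩ Metric.closedBall (p (q, 0, 0)) D).Nonempty}).Finite :=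
      finite_iUnion fun q => htil.finite_meeting _ hD.le
    obtain ⟨K, hK⟩ := (hfin.image fun q' => max q'.2.1.natAbs q'.2.2.natAbs).bddAbove
    refine ⟨K, ?_⟩
    rintro ⟨q, s, t⟩ ⟨q', s', t'⟩ ⟨y, ⟨z, hz, hzy⟩, z', hz', hzy'⟩
    simp only at hz hz' hzy hzy'
    have h1 : z ∈ Q (q, 0, 0) := ⟨z, hz, by simp⟩
    have h2 : z ∈ Q (q', s' - s, t' - t) := by
      refine ⟨z', hz', ?_⟩
      simp only
      have : z = z' + ((s' : ℝ) • u + (t' : ℝ) • v) - ((s : ℝ) • u + (t : ℝ) • v) := by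
        rw [hzy', ← hzy]; abel
      rw [this]
      push_cast
      module
    have h3 : (q', s' - s, t' - t) ∈
        ⋃ q : Fin N, {q' | (Q q' ∩ Metric.closedBall (p (q, 0, 0)) D).Nonempty} := by
      refine mem_iUnion.2 ⟨q, z, h2, ?_⟩
      exact Metric.closedBall_subset_closedBall (htil.radius_le _)
        ((htil.tile (q, 0, 0)).subset_closedBall h1)
    have h4 := hK ⟨_, h3, rfl⟩
    exact max_le_iff.1 h4
  set M := 2 * (π * (3 * D + 1) ^ 2 / area (P q₀)) with hM
  have hM0 : 0 ≤ M := by have := hpos q₀; have := pi_pos; positivity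
  let T : ℕ → Finset (Fin N × ℤ × ℤ) := fun L =>
    Finset.univ ×ˢ (Finset.Icc (-(L : ℤ)) L ×ˢ Finset.Icc (-(L : ℤ)) L)
  have hTcard : ∀ L, ((T L).card : ℝ) = N * (2 * L + 1) ^ 2 := by
    intro L
    simp only [T, Finset.card_product, Finset.card_univ, Fintype.card_fin, Int.card_Icc]
    have : ((L : ℤ) + 1 - -(L : ℤ)).toNat = 2 * L + 1 := by omega
    rw [this]
    push_cast
    ring
  have hsumT : ∀ L, ∑ q ∈ T L, ((n q.1 : ℝ) - 6) = (2 * L + 1) ^ 2 * ∑ q, ((n q : ℝ) - 6) := by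
    intro L
    simp only [T]
    rw [Finset.sum_product, Finset.mul_sum]
    refine Finset.sum_congr rfl fun q _ => ?_
    change ∑ _y ∈ Finset.Icc (-(L : ℤ)) L ×ˢ Finset.Icc (-(L : ℤ)) L, ((n q : ℝ) - 6) = _
    rw [Finset.sum_const, Finset.card_product, Int.card_Icc, nsmul_eq_mul]
    have : ((L : ℤ) + 1 - -(L : ℤ)).toNat = 2 * L + 1 := by omega
    rw [this]
    push_cast
    ring
  have hTmono : ∀ L, T L ⊆ T (L + K) := by
    intro L q
    simp only [T, Finset.mem_product, Finset.mem_univ, Finset.mem_Icc, true_and]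
    push_cast
    omega
  have hmain : ∀ L : ℕ, (2 * ((L + K : ℕ) : ℝ) + 1) * ∑ q, ((n q : ℝ) - 6) ≤ 4 * K * N * M := by
    intro L
    have h1 := htil.sum_card_sub_six_le (T (L + K)) (T (L + K) \ T L) Finset.sdiff_subset ?_
    · simp only [hcard] at h1
      rw [hsumT] at h1
      have h2 : ∑ q ∈ T (L + K) \ T L, (n q.1 : ℝ) ≤ (T (L + K) \ T L).card * M := by
        rw [← nsmul_eq_mul]
        refine Finset.sum_le_card_nsmul _ _ _ fun q _ => ?_
        rw [← hcard]
        exact htil.card_vertices_le q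
      have h3 : ((T (L + K) \ T L).card : ℝ) =
          N * (2 * (L + K : ℕ) + 1) ^ 2 - N * (2 * L + 1) ^ 2 := by
        rw [Finset.cast_card_sdiff (hTmono L), hTcard, hTcard]
      rw [h3] at h2
      have h4 : (0 : ℝ) < 2 * ((L + K : ℕ) : ℝ) + 1 := by positivity
      have h5 : ((N : ℝ) * (2 * (L + K : ℕ) + 1) ^ 2 - N * (2 * L + 1) ^ 2)
          ≤ (2 * ((L + K : ℕ) : ℝ) + 1) * (4 * K * N) := by
        have : (0 : ℝ) ≤ (N : ℝ) * (K : ℝ) ^ 2 := by positivity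
        push_cast
        nlinarith
      have h6 := mul_le_mul_of_nonneg_right h5 hM0
      refine le_of_mul_le_mul_left ?_ h4
      calc _ = (2 * ((L + K : ℕ) : ℝ) + 1) ^ 2 * ∑ q, ((n q : ℝ) - 6) := by ring
        _ ≤ _ := h1.trans (h2.trans h6)
        _ = _ := by ring
    · intro q hq q' hq' hqq'
      refine Finset.mem_sdiff.2 ⟨hq, fun hqL => hq' ?_⟩
      have := hK q q' hqq'
      simp only [T, Finset.mem_product, Finset.mem_univ, Finset.mem_Icc, true_and] at hqL ⊢
      push_cast
      omega
  by_contra! hS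
  obtain ⟨L, hL⟩ := exists_nat_gt (4 * K * N * M / ∑ q, ((n q : ℝ) - 6))
  rw [div_lt_iff₀ hS] at hL
  have h1 := hmain L
  have h2 : (L : ℝ) * ∑ q, ((n q : ℝ) - 6) ≤
      (2 * ((L + K : ℕ) : ℝ) + 1) * ∑ q, ((n q : ℝ) - 6) := by
    gcongr
    push_cast
    have : (0 : ℝ) ≤ L := by positivity
    have : (0 : ℝ) ≤ K := by positivity
    linarith
  linarith

lemma periodic_bounds {κ f r : ℝ} (hκ : 0 < κ) (hf : 0 < f) (hr : 0 ≤ r) (N : ℕ) (n : Fin N → ℕ)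
    (P : Fin N → Set Plane) (u v : Plane) (hN : 1 ≤ N) (hn : ∀ i, 3 ≤ n i)
    (hP : ∀ i, IsOptimalCyclicPolygon r (n i) (P i))
    (hpart : IsPlanePartition (fun q : Fin N × ℤ × ℤ =>
        (fun y => y + ((q.2.1 : ℝ) • u + (q.2.2 : ℝ) • v)) '' P q.1)) :
    costBound r Finset.univ (fun i => area (P i)) (meanSides Finset.univ n)
        ≤ averagedCost r Finset.univ n (fun i => area (P i)) ∧
      costBound r Finset.univ (fun i => area (P i)) 6
        ≤ costBound r Finset.univ (fun i => area (P i)) (meanSides Finset.univ n) ∧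
      zUb κ f r ≤ totalCost κ f r Finset.univ n (fun i => area (P i)) := by
  have hne : (Finset.univ : Finset (Fin N)).Nonempty := ⟨⟨0, hN⟩, Finset.mem_univ _⟩
  have hpos : ∀ i ∈ Finset.univ, 0 < area (P i) := fun i _ => area_optimal_pos hr (hn i) (hP i)
  have hmean := meanSides_le (δ := 0) hne
    (by rw [zero_mul]; exact periodic_sum_le hr N n P u v hN hn hP hpart)
  rw [add_zero] at hmean
  have h1 := costBound_anti hr Finset.univ (fun i => area (P i)) hne
    (by linarith [three_le_meanSides Finset.univ n hne fun i _ => hn i]) hmean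
  refine ⟨costBound_le_averagedCost hr _ n _ hne (fun i _ => hn i) hpos, h1, ?_⟩
  have := le_totalCost (ε := 0) hκ hf hr le_rfl Finset.univ n (fun i => area (P i)) hne
    (fun i _ => hn i) hpos (by linarith)
  linarith

/-! ### A boustrophedon enumeration of `ℤ × ℤ` -/

/-- The left end, up to sign, of an interval of length `2 ^ a`. The interval of length `2 ^ (a + 1)`
extends it to the right if `a` is even and to the left if `a` is odd. -/
def offset : ℕ → ℤ
  | 0 => 0
  | a + 1 => if Even a then offset a else offset a + 2 ^ a

lemma offset_bounds (a : ℕ) : 0 ≤ offset a ∧ offset a < 2 ^ a := by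
  induction a with
  | zero => simp [offset]
  | succ a ih =>
    have h : (2 : ℤ) ^ (a + 1) = 2 * 2 ^ a := by ring
    rw [offset]
    split_ifs <;> lia

lemma le_offset_two_mul (k : ℕ) :
    (k : ℤ) ≤ offset (2 * k) ∧ (k : ℤ) < 2 ^ (2 * k) - offset (2 * k) := by
  induction k with
  | zero => simp [offset]
  | succ k ih =>
    have h1 : (2 : ℤ) ^ (2 * (k + 1)) = 4 * 2 ^ (2 * k) := by ring
    have h2 : (2 : ℤ) ^ (2 * k + 1) = 2 * 2 ^ (2 * k) := by ring
    have h3 : (0 : ℤ) < 2 ^ (2 * k) := by positivity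
    have h4 : offset (2 * (k + 1)) = offset (2 * k) + 2 ^ (2 * k + 1) := by
      rw [show 2 * (k + 1) = 2 * k + 1 + 1 by ring, offset, if_neg (by simp), offset,
        if_pos (by simp)]
    push_cast
    lia

/-- A rectangle with `2 ^ m` lattice points whose sides are equal or in ratio two. -/
noncomputable def box (m : ℕ) : Finset (ℤ × ℤ) :=
  Finset.Ico (-offset ((m + 1) / 2)) (2 ^ ((m + 1) / 2) - offset ((m + 1) / 2)) ×ˢ
    Finset.Ico (-offset (m / 2)) (2 ^ (m / 2) - offset (m / 2))

lemma mem_box_two_mul {a : ℕ} {q : ℤ × ℤ} : q ∈ box (2 * a) ↔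
    (-offset a ≤ q.1 ∧ q.1 < 2 ^ a - offset a) ∧ -offset a ≤ q.2 ∧ q.2 < 2 ^ a - offset a := by
  rw [box, show (2 * a + 1) / 2 = a by omega, show 2 * a / 2 = a by omega]
  simp

lemma mem_box_two_mul_add_one {a : ℕ} {q : ℤ × ℤ} : q ∈ box (2 * a + 1) ↔
    (-offset (a + 1) ≤ q.1 ∧ q.1 < 2 * 2 ^ a - offset (a + 1)) ∧
      -offset a ≤ q.2 ∧ q.2 < 2 ^ a - offset a := by
  rw [box, show (2 * a + 1 + 1) / 2 = a + 1 by omega, show (2 * a + 1) / 2 = a by omega, pow_succ']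
  simp

lemma card_box (m : ℕ) : (box m).card = 2 ^ m := by
  rw [box, Finset.card_product, Int.card_Ico, Int.card_Ico]
  have h : ∀ k : ℕ, ((2 : ℤ) ^ k - offset k - -offset k).toNat = 2 ^ k := by
    intro k
    rw [sub_neg_eq_add, sub_add_cancel]
    exact Int.toNat_pow_of_nonneg (by norm_num) k
  rw [h, h, ← pow_add]
  congr 1
  omega

lemma box_subset_succ (m : ℕ) : box m ⊆ box (m + 1) := by
  intro q hq
  rcases Nat.even_or_odd' m with ⟨a, rfl | rfl⟩
  · rw [mem_box_two_mul] at hq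
    rw [mem_box_two_mul_add_one, offset]
    have : (0 : ℤ) < 2 ^ a := by positivity
    split_ifs <;> lia
  · rw [mem_box_two_mul_add_one] at hq
    rw [show 2 * a + 1 + 1 = 2 * (a + 1) by ring, mem_box_two_mul, pow_succ']
    nth_rw 3 4 [offset]
    have : (0 : ℤ) < 2 ^ a := by positivity
    split_ifs <;> lia

lemma box_mono : Monotone box := monotone_nat_of_le_succ box_subset_succ

lemma exists_mem_box (q : ℤ × ℤ) : ∃ m, q ∈ box m := by
  set k := q.1.natAbs + q.2.natAbs with hk
  refine ⟨2 * (2 * k), mem_box_two_mul.2 ?_⟩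
  have := le_offset_two_mul k
  omega

lemma natAbs_add_natAbs_le {m : ℕ} {q : ℤ × ℤ} (h : q ∈ box m) :
    q.1.natAbs + q.2.natAbs ≤ 2 * 2 ^ ((m + 1) / 2) := by
  rw [box, Finset.mem_product, Finset.mem_Ico, Finset.mem_Ico] at h
  have h1 := offset_bounds ((m + 1) / 2)
  have h2 := offset_bounds (m / 2)
  have h3 : (2 : ℤ) ^ (m / 2) ≤ 2 ^ ((m + 1) / 2) :=
    pow_le_pow_right₀ (by norm_num) (by omega)
  zify
  rcases abs_cases q.1 with h | h <;> rcases abs_cases q.2 with h' | h' <;> lia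

/-- The `j`-th point of the rectangle `box (m + 1) \ box m`, which is traversed row by row from its
lower left corner, to the right in even rows and to the left in odd ones. -/
def snake (m j : ℕ) : ℤ × ℤ :=
  (-offset ((m + 1) / 2) + (if Even m then (-2) ^ (m / 2) else 0) +
      (if Even (j / 2 ^ ((m + 1) / 2)) then (j % 2 ^ ((m + 1) / 2) : ℕ)
        else 2 ^ ((m + 1) / 2) - 1 - (j % 2 ^ ((m + 1) / 2) : ℕ)),
    -offset (m / 2) + (if Even m then 0 else (-2) ^ (m / 2)) + (j / 2 ^ ((m + 1) / 2) : ℕ))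

lemma neg_two_pow (a : ℕ) : (-2 : ℤ) ^ a = if Even a then 2 ^ a else -2 ^ a := by
  split_ifs with h
  · exact h.neg_pow 2
  · exact (Nat.not_even_iff_odd.1 h).neg_pow 2

lemma snake_mem {m j : ℕ} (hj : j < 2 ^ m) : snake m j ∈ box (m + 1) ∧ snake m j ∉ box m := by
  have hmod := Nat.mod_lt j (show 0 < 2 ^ ((m + 1) / 2) by positivity)
  have hdiv : j / 2 ^ ((m + 1) / 2) < 2 ^ (m / 2) := by
    rw [Nat.div_lt_iff_lt_mul (by positivity), ← pow_add, show m / 2 + (m + 1) / 2 = m by omega]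
    exact hj
  zify at hmod hdiv
  have h0 : (0 : ℤ) ≤ (j : ℤ) / 2 ^ ((m + 1) / 2) := by positivity
  have h1 : (0 : ℤ) ≤ (j : ℤ) % 2 ^ ((m + 1) / 2) := Int.emod_nonneg _ (by positivity)
  unfold snake
  push_cast
  have hx := offset_bounds (m / 2)
  rcases Nat.even_or_odd' m with ⟨a, rfl | rfl⟩
  · rw [mem_box_two_mul, mem_box_two_mul_add_one]
    simp only [show (2 * a + 1) / 2 = a by omega, show 2 * a / 2 = a by omega, even_two_mul,
      if_true, neg_two_pow, offset] at *
    have : (0 : ℤ) < 2 ^ a := by positivity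
    split_ifs <;> lia
  · rw [mem_box_two_mul_add_one, show 2 * a + 1 + 1 = 2 * (a + 1) by ring, mem_box_two_mul]
    simp only [show 2 * (a + 1) / 2 = a + 1 by omega, show (2 * a + 1) / 2 = a by omega,
      show (2 * a + 1 + 1) / 2 = a + 1 by omega, show ¬ Even (2 * a + 1) by simp,
      if_false, neg_two_pow, offset] at *
    have h3 : (2 : ℤ) ^ (a + 1) = 2 * 2 ^ a := by ring
    have : (0 : ℤ) < 2 ^ a := by positivity
    split_ifs <;> lia

lemma snake_injective {m j k : ℕ} (h : snake m j = snake m k) : j = k := by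
  unfold snake at h
  obtain ⟨h1, h2⟩ := Prod.mk.inj h
  have h2' : j / 2 ^ ((m + 1) / 2) = k / 2 ^ ((m + 1) / 2) := by
    have := add_left_cancel h2
    exact_mod_cast this
  rw [h2'] at h1
  have h3 : j % 2 ^ ((m + 1) / 2) = k % 2 ^ ((m + 1) / 2) := by
    split_ifs at h1 <;> omega
  rw [← Nat.div_add_mod j (2 ^ ((m + 1) / 2)), h2', h3, Nat.div_add_mod]

/-- The enumeration of the lattice which exhausts the rectangles `box m` in turn. -/
def enum (n : ℕ) : ℤ × ℤ := if n = 0 then (0, 0) else snake (Nat.log 2 n) (n - 2 ^ Nat.log 2 n)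

lemma enum_two_pow_add {m j : ℕ} (hj : j < 2 ^ m) : enum (2 ^ m + j) = snake m j := by
  have hlog : Nat.log 2 (2 ^ m + j) = m :=
    Nat.log_eq_of_pow_le_of_lt_pow (by omega) (by rw [pow_succ]; omega)
  have h0 : 2 ^ m + j ≠ 0 := by positivity
  rw [enum, if_neg h0, hlog, Nat.add_sub_cancel_left]

lemma exists_eq_two_pow_add {n : ℕ} (hn : n ≠ 0) : ∃ m j, j < 2 ^ m ∧ n = 2 ^ m + j := by
  have h1 := Nat.pow_log_le_self 2 hn
  have h2 := Nat.lt_pow_succ_log_self (b := 2) (by norm_num) n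
  rw [pow_succ] at h2
  exact ⟨Nat.log 2 n, n - 2 ^ Nat.log 2 n, by omega, by omega⟩

lemma enum_mem_box {m n : ℕ} (h : n < 2 ^ m) : enum n ∈ box m := by
  rcases eq_or_ne n 0 with rfl | hn
  · refine box_mono (Nat.zero_le m) ?_
    rw [show (0 : ℕ) = 2 * 0 by norm_num, mem_box_two_mul]
    simp [enum, offset]
  · obtain ⟨k, j, hj, rfl⟩ := exists_eq_two_pow_add hn
    rw [enum_two_pow_add hj]
    refine box_mono ?_ (snake_mem hj).1
    exact (Nat.pow_lt_pow_iff_right (a := 2) (by norm_num)).1 (by omega)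

lemma enum_injective : Function.Injective enum := by
  have key : ∀ i n, i < n → enum i ≠ enum n := by
    intro i n hin heq
    obtain ⟨m, j, hj, rfl⟩ := exists_eq_two_pow_add (show n ≠ 0 by omega)
    rw [enum_two_pow_add hj] at heq
    rcases lt_or_ge i (2 ^ m) with hi | hi
    · exact (snake_mem hj).2 (heq ▸ enum_mem_box hi)
    · obtain ⟨l, rfl⟩ := Nat.exists_eq_add_of_le hi
      rw [enum_two_pow_add (by omega)] at heq
      have := snake_injective heq
      omega
  intro i n h
  by_contra hne
  rcases lt_or_gt_of_ne hne with h' | h'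
  · exact key _ _ h' h
  · exact key _ _ h' h.symm

lemma enum_bijective : Function.Bijective enum := by
  refine ⟨enum_injective, fun q => ?_⟩
  obtain ⟨m, hm⟩ := exists_mem_box q
  -- the first `2 ^ m` points lie in a box with `2 ^ m` elements
  have h : (Finset.range (2 ^ m)).image enum = box m := by
    refine Finset.eq_of_subset_of_card_le ?_ ?_
    · intro q hq
      obtain ⟨n, hn, rfl⟩ := Finset.mem_image.1 hq
      exact enum_mem_box (Finset.mem_range.1 hn)
    · rw [card_box, Finset.card_image_of_injective _ enum_injective, Finset.card_range]
  rw [← h] at hm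
  obtain ⟨n, _, hn⟩ := Finset.mem_image.1 hm
  exact ⟨n, hn⟩

/-- The length of the step from `p` to `q` in the `ℓ¹` metric, except that horizontal unit steps
count zero. -/
def excess (p q : ℤ × ℤ) : ℕ :=
  if p.2 = q.2 ∧ (p.1 - q.1).natAbs = 1 then 0 else (p.1 - q.1).natAbs + (p.2 - q.2).natAbs

lemma excess_snake (m j : ℕ) :
    excess (snake m j) (snake m (j + 1)) = if 2 ^ ((m + 1) / 2) ∣ j + 1 then 1 else 0 := by
  obtain ⟨W, hW⟩ : ∃ W : ℕ, W = 2 ^ ((m + 1) / 2) := ⟨_, rfl⟩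
  have hWpos : 0 < W := hW ▸ by positivity
  unfold snake
  rw [← hW]
  generalize -offset ((m + 1) / 2) + (if Even m then (-2) ^ (m / 2) else 0) = A
  generalize -offset (m / 2) + (if Even m then 0 else (-2) ^ (m / 2)) = B
  obtain ⟨q, c, hc, rfl⟩ : ∃ q c, c < W ∧ j = W * q + c :=
    ⟨j / W, j % W, Nat.mod_lt j hWpos, (Nat.div_add_mod j W).symm⟩
  have hdiv : ∀ q c, c < W → (W * q + c) / W = q := fun q c h => by
    rw [Nat.mul_add_div hWpos, Nat.div_eq_of_lt h, add_zero]
  have hmod : ∀ q c, c < W → (W * q + c) % W = c := fun q c h => by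
    rw [Nat.mul_add_mod, Nat.mod_eq_of_lt h]
  rw [hdiv q c hc, hmod q c hc]
  rcases eq_or_ne (c + 1) W with h | h
  · -- the end of a row is directly below the beginning of the next one
    have h1 : W * q + c + 1 = W * (q + 1) + 0 := by rw [add_assoc, h]; ring
    rw [h1, hdiv _ _ hWpos, hmod _ _ hWpos, if_pos (show W ∣ W * (q + 1) + 0 by simp)]
    have h2 : W - 1 = c := by omega
    rw [h2]
    by_cases he : Even q
    · simp [excess, Nat.even_add_one, he]
    · simp [excess, Nat.even_add_one, he]
  · have h1 : c + 1 < W := by omega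
    have h2 : ¬ W ∣ W * q + (c + 1) := by
      rw [Nat.dvd_iff_mod_eq_zero, hmod _ _ h1]
      omega
    rw [add_assoc, hdiv _ _ h1, hmod _ _ h1, if_neg h2]
    have h3 : ((W - 1 - c : ℕ) : ℤ) = (W - 1 - (c + 1) : ℕ) + 1 := by omega
    unfold excess
    refine if_pos ⟨rfl, ?_⟩
    split_ifs <;> push_cast <;> omega

lemma excess_le {m : ℕ} {p q : ℤ × ℤ} (hp : p ∈ box m) (hq : q ∈ box m) :
    excess p q ≤ 4 * 2 ^ ((m + 1) / 2) := by
  have h1 := natAbs_add_natAbs_le hp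
  have h2 := natAbs_add_natAbs_le hq
  rw [excess]
  split_ifs <;> omega

lemma sum_excess_block {m J : ℕ} (hJ : J < 2 ^ m) :
    ∑ i ∈ Finset.range J, excess (enum (2 ^ m + i)) (enum (2 ^ m + i + 1)) =
      J / 2 ^ ((m + 1) / 2) := by
  induction J with
  | zero => simp
  | succ J ih =>
    rw [Finset.sum_range_succ, ih (by omega), add_assoc, enum_two_pow_add (by omega),
      enum_two_pow_add hJ, excess_snake,
      Nat.succ_div (a := J)]

lemma two_pow_div_two_le (m : ℕ) : (2 : ℝ) ^ (m / 2) ≤ √(2 ^ m) := by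
  refine Real.le_sqrt_of_sq_le ?_
  rw [← pow_mul]
  exact pow_le_pow_right₀ (by norm_num) (by omega)

lemma div_le_sqrt {m J : ℕ} (hJ : J < 2 ^ m) : ((J / 2 ^ ((m + 1) / 2) : ℕ) : ℝ) ≤ √(2 ^ m) := by
  refine le_trans ?_ (two_pow_div_two_le m)
  have : J / 2 ^ ((m + 1) / 2) ≤ 2 ^ (m / 2) := by
    refine Nat.div_le_of_le_mul ?_
    rw [← pow_add, show (m + 1) / 2 + m / 2 = m by omega]
    exact hJ.le
  exact_mod_cast this

lemma sum_excess_two_pow (m : ℕ) :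
    ((∑ i ∈ Finset.range (2 ^ m), excess (enum i) (enum (i + 1)) : ℕ) : ℝ) ≤ 68 * √(2 ^ m) := by
  induction m with
  | zero =>
    have h := excess_le (m := 1) (enum_mem_box (n := 0) (by norm_num))
      (enum_mem_box (n := 1) (by norm_num))
    norm_num at h
    have h' : (excess (enum 0) (enum 1) : ℝ) ≤ 8 := by exact_mod_cast h
    norm_num
    linarith
  | succ m ih =>
    have hpow : 0 < 2 ^ m := by positivity
    have h1 : 2 ^ (m + 1) = 2 ^ m + (2 ^ m - 1) + 1 := by rw [pow_succ]; omega
    have h2 := excess_le (m := m + 2)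
      (enum_mem_box (n := 2 ^ m + (2 ^ m - 1)) (by rw [pow_add]; omega))
      (enum_mem_box (n := 2 ^ m + (2 ^ m - 1) + 1) (by rw [pow_add]; omega))
    rw [h1, Finset.sum_range_succ, Finset.sum_range_add,
      sum_excess_block (Nat.sub_lt hpow one_pos)]
    have h3 := div_le_sqrt (Nat.sub_lt hpow one_pos)
    have h4 : ((4 * 2 ^ ((m + 2 + 1) / 2) : ℕ) : ℝ) ≤ 16 * √(2 ^ m) := by
      have h5 : 4 * 2 ^ ((m + 2 + 1) / 2) ≤ 16 * 2 ^ (m / 2) := by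
        have : 2 ^ ((m + 2 + 1) / 2) ≤ 2 ^ (m / 2 + 2) :=
          Nat.pow_le_pow_right (by norm_num) (by omega)
        rw [pow_add] at this
        omega
      have h6 : ((4 * 2 ^ ((m + 2 + 1) / 2) : ℕ) : ℝ) ≤ 16 * 2 ^ (m / 2) := by exact_mod_cast h5
      have := two_pow_div_two_le m
      linarith
    have h5 : √((2 : ℝ) ^ (m + 1)) = √2 * √(2 ^ m) := by
      rw [pow_succ', Real.sqrt_mul (by norm_num)]
    have h6 : (5 / 4 : ℝ) ≤ √2 := Real.le_sqrt_of_sq_le (by norm_num)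
    have h7 : ((excess (enum (2 ^ m + (2 ^ m - 1))) (enum (2 ^ m + (2 ^ m - 1) + 1)) : ℕ) : ℝ) ≤
        ((4 * 2 ^ ((m + 2 + 1) / 2) : ℕ) : ℝ) := by exact_mod_cast h2
    rw [h5]
    push_cast at ih h3 h4 h7 ⊢
    nlinarith [Real.sqrt_nonneg ((2 : ℝ) ^ m)]

/-- Up to `O(√N)`, the first `N` steps of the enumeration are horizontal unit steps. -/
lemma sum_excess_le {N : ℕ} (hN : N ≠ 0) :
    ((∑ i ∈ Finset.range N, excess (enum i) (enum (i + 1)) : ℕ) : ℝ) ≤ 69 * √N := by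
  obtain ⟨m, j, hj, rfl⟩ := exists_eq_two_pow_add hN
  have h1 := sum_excess_two_pow m
  have h2 := div_le_sqrt hj
  rw [Finset.sum_range_add, sum_excess_block hj]
  have h3 : √((2 : ℝ) ^ m) ≤ √((2 ^ m + j : ℕ) : ℝ) := by
    refine Real.sqrt_le_sqrt ?_
    push_cast
    linarith [(Nat.cast_nonneg j : (0 : ℝ) ≤ j)]
  rw [Nat.cast_add]
  linarith

lemma excess_enum_zero_le {N : ℕ} (hN : N ≠ 0) :
    (excess (enum (N - 1)) (enum 0) : ℝ) ≤ 8 * √N := by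
  obtain ⟨m, j, hj, rfl⟩ := exists_eq_two_pow_add hN
  have h1 : excess (enum (2 ^ m + j - 1)) (enum 0) ≤ 4 * 2 ^ ((m + 1 + 1) / 2) :=
    excess_le (enum_mem_box (by rw [pow_succ]; omega)) (enum_mem_box (by positivity))
  rw [show (m + 1 + 1) / 2 = m / 2 + 1 by omega, pow_succ] at h1
  have h2 : (excess (enum (2 ^ m + j - 1)) (enum 0) : ℝ) ≤ 8 * 2 ^ (m / 2) := by
    have : excess (enum (2 ^ m + j - 1)) (enum 0) ≤ 8 * 2 ^ (m / 2) := by omega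
    exact_mod_cast this
  have h3 : √((2 : ℝ) ^ m) ≤ √((2 ^ m + j : ℕ) : ℝ) := by
    refine Real.sqrt_le_sqrt ?_
    push_cast
    linarith [(Nat.cast_nonneg j : (0 : ℝ) ≤ j)]
  have := two_pow_div_two_le m
  linarith

/-! ### The hexagonal lattice and its Voronoi cells -/

/-- The point with index `(s, t)` of the lattice spanned by `(4 R a b, 0)` and `(2 R a b, 2 R b²)`.
With `a = sin β` and `b = cos β` its Voronoi cells are the cyclic hexagons of radius `R` with two
opposite sides seen under the angle `π - 4 β` and the other four under the angle `2 β`. -/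
noncomputable def latticePoint (R a b : ℝ) (q : ℤ × ℤ) : Plane :=
  !₂[4 * R * a * b * (q.1 + q.2 / 2), 2 * R * b ^ 2 * q.2]

lemma latticePoint_zero (R a b : ℝ) (q : ℤ × ℤ) :
    latticePoint R a b q 0 = 4 * R * a * b * (q.1 + q.2 / 2) := rfl

lemma latticePoint_one (R a b : ℝ) (q : ℤ × ℤ) : latticePoint R a b q 1 = 2 * R * b ^ 2 * q.2 := rfl

lemma latticePoint_sub (R a b : ℝ) (p q : ℤ × ℤ) :
    latticePoint R a b (p - q) = latticePoint R a b p - latticePoint R a b q := by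
  refine plane_ext ?_ ?_
  · simp only [latticePoint_zero, PiLp.sub_apply, Prod.fst_sub, Prod.snd_sub]
    push_cast
    ring
  · simp only [latticePoint_one, PiLp.sub_apply, Prod.snd_sub]
    push_cast
    ring

/-- The hexagon cut out by the perpendicular bisectors of the six shortest lattice vectors. -/
def hexagon (R a b : ℝ) : Set Plane :=
  {y | |y 0| ≤ 2 * R * a * b ∧ a * |y 0| + b * |y 1| ≤ b * R}

/-- The three kinds of lattice rows `t = 0`, `t = ±1` and `|t| ≥ 2`, with the bounds for the
horizontal coordinate `s + t / 2` of their points. -/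
lemma int_cases (s t : ℤ) : ((t : ℝ) = 0 ∧ |(s + t / 2 : ℝ)| ≤ (s + t / 2 : ℝ) ^ 2) ∨
    (|(t : ℝ)| = 1 ∧ 1 / 4 ≤ (s + t / 2 : ℝ) ^ 2) ∨ 2 ≤ |(t : ℝ)| := by
  rcases lt_trichotomy |t| 1 with h | h | h
  · left
    have h0 : t = 0 := Int.abs_lt_one_iff.1 h
    subst h0
    refine ⟨by simp, ?_⟩
    have h1 : |s| ≤ s ^ 2 := by
      rw [← sq_abs]
      rcases eq_or_lt_of_le (abs_nonneg s) with h | h <;> nlinarith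
    have h2 : ((|s| : ℤ) : ℝ) ≤ ((s ^ 2 : ℤ) : ℝ) := by exact_mod_cast h1
    push_cast at h2
    simpa using h2
  · right; left
    refine ⟨by exact_mod_cast h, ?_⟩
    have h1 : (1 : ℤ) ≤ (2 * s + t) ^ 2 := by
      have : 2 * s + t ≠ 0 := by
        rcases abs_cases t with h' | h' <;> omega
      have : 0 < (2 * s + t) ^ 2 := by positivity
      omega
    have h2 : (1 : ℝ) ≤ (2 * s + t) ^ 2 := by exact_mod_cast h1
    nlinarith
  · right; right
    have h1 : (2 : ℤ) ≤ |t| := by omega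
    have h2 : ((2 : ℤ) : ℝ) ≤ ((|t| : ℤ) : ℝ) := by exact_mod_cast h1
    push_cast at h2
    exact h2

lemma norm_le_norm_sub_iff (y w : Plane) : ‖y‖ ≤ ‖y - w‖ ↔ 2 * (y 0 * w 0 + y 1 * w 1) ≤
    w 0 ^ 2 + w 1 ^ 2 := by
  rw [← sq_le_sq₀ (norm_nonneg _) (norm_nonneg _), norm_sq_plane, norm_sq_plane]
  simp only [PiLp.sub_apply]
  constructor <;> intro h <;> nlinarith

/-- The Voronoi cell of the origin in the hexagonal lattice. -/
lemma mem_hexagon_iff {R a b : ℝ} (hR : 0 < R) (ha : 0 < a) (hab : a ≤ b)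
    (hsq : a ^ 2 + b ^ 2 = 1) (y : Plane) :
    y ∈ hexagon R a b ↔ ∀ q, ‖y‖ ≤ ‖y - latticePoint R a b q‖ := by
  have hb : 0 < b := ha.trans_le hab
  simp only [norm_le_norm_sub_iff, latticePoint_zero, latticePoint_one]
  constructor
  · rintro ⟨h1, h2⟩ ⟨s, t⟩
    simp only
    have hX := int_cases s t
    generalize ((s : ℝ) + t / 2) = X at *
    have e1 : y 0 * X ≤ |y 0| * |X| := by rw [← abs_mul]; exact le_abs_self _
    have e2 : y 1 * t ≤ |y 1| * |(t : ℝ)| := by rw [← abs_mul]; exact le_abs_self _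
    rw [← sq_abs X] at hX
    have goal : 2 * (|y 0| * (4 * R * a * b * |X|) + |y 1| * (2 * R * b ^ 2 * |(t : ℝ)|)) ≤
        (4 * R * a * b * |X|) ^ 2 + (2 * R * b ^ 2 * |(t : ℝ)|) ^ 2 := by
      have hXn := abs_nonneg X
      have hTn := abs_nonneg (t : ℝ)
      have hu := abs_nonneg (y 0)
      have hT0 : (t : ℝ) = 0 ↔ |(t : ℝ)| = 0 := abs_eq_zero.symm
      rw [hT0] at hX
      generalize |X| = X at *
      generalize |(t : ℝ)| = T at *
      generalize |y 0| = u at *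
      generalize |y 1| = v at *
      have k1 : v * (2 * R * b ^ 2 * T) ≤ 2 * R * b * T * (b * R - a * u) := by
        have : 0 ≤ 2 * R * b * T := by positivity
        nlinarith
      -- the bound is affine in `u`, so it suffices to check the ends of its range
      have end0 : 4 * R ^ 2 * b ^ 2 * T ≤ (4 * R * a * b * X) ^ 2 + (2 * R * b ^ 2 * T) ^ 2 := by
        have key : T ≤ 4 * a ^ 2 * X ^ 2 + b ^ 2 * T ^ 2 := by
          rcases hX with ⟨rfl, _⟩ | ⟨rfl, h⟩ | h
          · positivity
          · nlinarith [sq_nonneg a]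
          · have k2 : a ^ 2 ≤ b ^ 2 := by gcongr
            have k3 : T * (a ^ 2 + b ^ 2) ≤ T * (T * b ^ 2) := by
              refine mul_le_mul_of_nonneg_left ?_ hTn
              nlinarith [sq_nonneg b]
            rw [hsq] at k3
            nlinarith [mul_nonneg (sq_nonneg a) (sq_nonneg X)]
        nlinarith [mul_le_mul_of_nonneg_left key (show 0 ≤ 4 * R ^ 2 * b ^ 2 by positivity)]
      have end1 : 16 * R ^ 2 * a ^ 2 * b ^ 2 * X + 4 * R ^ 2 * b ^ 2 * T * (1 - 2 * a ^ 2) ≤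
          (4 * R * a * b * X) ^ 2 + (2 * R * b ^ 2 * T) ^ 2 := by
        have key : 4 * a ^ 2 * X + T * (1 - 2 * a ^ 2) ≤ 4 * a ^ 2 * X ^ 2 + b ^ 2 * T ^ 2 := by
          have k2 : 1 - 2 * a ^ 2 = b ^ 2 - a ^ 2 := by linarith
          rw [k2]
          have k3 : T = 0 ∧ X ≤ X ^ 2 ∨ 1 ≤ T := by
            rcases hX with ⟨h, h'⟩ | ⟨h, _⟩ | h
            · exact Or.inl ⟨h, h'⟩
            · exact Or.inr h.ge
            · exact Or.inr (by linarith)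
          rcases k3 with ⟨rfl, h⟩ | h
          · nlinarith [mul_le_mul_of_nonneg_left h (sq_nonneg a)]
          · nlinarith [mul_nonneg (sq_nonneg a) (sq_nonneg (2 * X - 1)),
              mul_nonneg (sq_nonneg a) (sub_nonneg.2 h),
              mul_nonneg (sq_nonneg b) (mul_nonneg hTn (sub_nonneg.2 h))]
        nlinarith [mul_le_mul_of_nonneg_left key (show 0 ≤ 4 * R ^ 2 * b ^ 2 by positivity)]
      have hU : 0 < 2 * R * a * b := by positivity
      refine le_of_mul_le_mul_left ?_ hU
      have k4 := mul_le_mul_of_nonneg_left end0 (sub_nonneg.2 h1)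
      have k5 := mul_le_mul_of_nonneg_left end1 hu
      have k6 := mul_le_mul_of_nonneg_left k1 hU.le
      linear_combination k4 + k5 + 2 * k6
    rw [mul_pow _ |X|, sq_abs, mul_pow _ |(t : ℝ)|, sq_abs, ← mul_pow, ← mul_pow] at goal
    refine le_trans ?_ goal
    have e1' := mul_le_mul_of_nonneg_left e1 (show 0 ≤ 4 * R * a * b by positivity)
    have e2' := mul_le_mul_of_nonneg_left e2 (show 0 ≤ 2 * R * b ^ 2 by positivity)
    linear_combination 2 * e1' + 2 * e2'
  · -- the six half planes belong to the six shortest vectors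
    intro h
    have h1 := h (1, 0)
    have h2 := h (-1, 0)
    have h3 := h (0, 1)
    have h4 := h (-1, 1)
    have h5 := h (1, -1)
    have h6 := h (0, -1)
    push_cast at h1 h2 h3 h4 h5 h6
    have hc : 0 < 4 * R * a * b := by positivity
    have hc' : 0 < 4 * R * b := by positivity
    have hp : (4 * R * a * b / 2) ^ 2 + (2 * R * b ^ 2) ^ 2 = 4 * R * b * (R * b) := by
      linear_combination 4 * R ^ 2 * b ^ 2 * hsq
    constructor
    · rw [abs_le]
      constructor
      · refine le_of_mul_le_mul_left ?_ hc
        nlinarith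
      · refine le_of_mul_le_mul_left ?_ hc
        nlinarith
    · refine le_of_mul_le_mul_left ?_ hc'
      rcases abs_cases (y 0) with ⟨e, _⟩ | ⟨e, _⟩ <;>
        rcases abs_cases (y 1) with ⟨e', _⟩ | ⟨e', _⟩ <;> rw [e, e']
      · linear_combination h3 + hp
      · linear_combination h5 + hp
      · linear_combination h4 + hp
      · linear_combination h6 + hp

lemma hexagon_subset_closedBall {R a b : ℝ} (hb : 0 < b) (ha : 0 < a) :
    hexagon R a b ⊆ Metric.closedBall 0 (2 * R * a * b + R) := by
  rintro y ⟨h1, h2⟩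
  rw [mem_closedBall_zero_iff]
  have h3 : |y 1| ≤ R := by
    refine le_of_mul_le_mul_left ?_ hb
    have := mul_nonneg ha.le (abs_nonneg (y 0))
    linarith
  have h4 : ‖y‖ ≤ |y 0| + |y 1| := by
    rw [← sq_le_sq₀ (norm_nonneg _) (by positivity), norm_sq_plane]
    nlinarith [sq_abs (y 0), sq_abs (y 1), mul_nonneg (abs_nonneg (y 0)) (abs_nonneg (y 1))]
  linarith

lemma convex_hexagon {R a b : ℝ} (hb : 0 < b) (ha : 0 < a) : Convex ℝ (hexagon R a b) := by
  rintro x ⟨hx1, hx2⟩ y ⟨hy1, hy2⟩ s t hs ht hst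
  have h : ∀ i, |(s • x + t • y) i| ≤ s * |x i| + t * |y i| := by
    intro i
    simp only [PiLp.add_apply, PiLp.smul_apply, smul_eq_mul]
    refine (abs_add_le _ _).trans ?_
    rw [abs_mul, abs_mul, abs_of_nonneg hs, abs_of_nonneg ht]
  have e : ∀ c : ℝ, s * c + t * c = c := fun c => by rw [← add_mul, hst, one_mul]
  constructor
  · calc _ ≤ s * |x 0| + t * |y 0| := h 0
      _ ≤ s * (2 * R * a * b) + t * (2 * R * a * b) := by gcongr
      _ = 2 * R * a * b := e (2 * R * a * b)
  · calc _ ≤ a * (s * |x 0| + t * |y 0|) + b * (s * |x 1| + t * |y 1|) :=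
          add_le_add (mul_le_mul_of_nonneg_left (h 0) ha.le) (mul_le_mul_of_nonneg_left (h 1) hb.le)
      _ = s * (a * |x 0| + b * |x 1|) + t * (a * |y 0| + b * |y 1|) := by ring
      _ ≤ s * (b * R) + t * (b * R) := by gcongr
      _ = b * R := e (b * R)

/-- A convex set containing the six vertices contains the hexagon: each point of the hexagon lies on
a vertical chord, whose ends lie on the four equal sides. -/
lemma hexagon_subset {R a b : ℝ} (hR : 0 < R) (ha : 0 < a) (hb : 0 < b) (hsq : a ^ 2 + b ^ 2 = 1)
    {C : Set Plane} (hC : Convex ℝ C) (h0 : ∀ τ : ℝ, |τ| = 1 → (!₂[0, τ * R] : Plane) ∈ C)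
    (h1 : ∀ ε τ : ℝ, |ε| = 1 → |τ| = 1 →
      (!₂[ε * (2 * R * a * b), τ * (R * (b ^ 2 - a ^ 2))] : Plane) ∈ C) : hexagon R a b ⊆ C := by
  rintro y ⟨hy1, hy2⟩
  obtain ⟨ε, hε, hy⟩ : ∃ ε : ℝ, |ε| = 1 ∧ y 0 = ε * |y 0| := by
    rcases abs_cases (y 0) with ⟨e, _⟩ | ⟨e, _⟩
    · exact ⟨1, by simp, by rw [e]; ring⟩
    · exact ⟨-1, by simp, by rw [e]; ring⟩
  have hU : 0 < 2 * R * a * b := by positivity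
  set l := |y 0| / (2 * R * a * b) with hl
  have hl0 : 0 ≤ l := by positivity
  have hl1 : l ≤ 1 := (div_le_one hU).2 hy1
  have hyl : |y 0| = l * (2 * R * a * b) := by rw [hl]; field_simp
  set M := R - 2 * R * a ^ 2 * l with hM
  have hM0 : 0 ≤ |y 1| := abs_nonneg _
  have hyM : |y 1| ≤ M := by
    refine le_of_mul_le_mul_left ?_ hb
    rw [hyl] at hy2
    rw [hM]
    linarith
  have hend : ∀ τ : ℝ, |τ| = 1 → (!₂[y 0, τ * M] : Plane) ∈ C := by
    intro τ hτ
    have := hC (h0 τ hτ) (h1 ε τ hε hτ) (sub_nonneg.2 hl1) hl0 (by ring)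
    convert this using 1
    refine plane_ext ?_ ?_
    · simp
      linear_combination hy + ε * hyl
    · simp [hM]
      linear_combination -τ * R * l * hsq
  rcases (hM0.trans hyM).eq_or_lt with hM' | hM'
  · have := hend 1 (by simp)
    convert this using 1
    have : y 1 = 0 := abs_eq_zero.1 (le_antisymm (hM' ▸ hyM) hM0)
    refine plane_ext rfl ?_
    simp [this, ← hM']
  · rw [abs_le] at hyM
    have := hC (hend 1 (by simp)) (hend (-1) (by simp))
      (show 0 ≤ (M + y 1) / (2 * M) by apply div_nonneg <;> linarith)
      (show 0 ≤ (M - y 1) / (2 * M) by apply div_nonneg <;> linarith) (by field_simp; ring)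
    convert this using 1
    refine plane_ext ?_ ?_
    · simp
      field_simp
      ring
    · simp
      field_simp
      ring

/-- The first vertex has the direction `-α`, so that the two sides with half angle `α` are
vertical. -/
lemma hexagon_eq_cyclicPolygon {R α β : ℝ} {ω : Fin 6 → ℝ} (hR : 0 < R)
    (hβ : β ∈ Ioo 0 (π / 2)) (hβ2 : 2 * β < π / 2)
    (hsum : α + 2 * β = π / 2) (hω : ω = ![α, β, β, α, β, β]) :
    cyclicPolygon 0 R (-α) ω = hexagon R (sin β) (cos β) := by
  have ha := sin_pos_of_mem hβ
  have hb := cos_pos_of_mem hβ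
  have hsq := sin_sq_add_cos_sq β
  have hα : α = π / 2 - 2 * β := by linarith
  have hcos : cos α = 2 * sin β * cos β := by rw [hα, cos_pi_div_two_sub, sin_two_mul]
  have hsin : sin α = cos β ^ 2 - sin β ^ 2 := by rw [hα, sin_pi_div_two_sub, cos_two_mul']
  have o : ω 0 = α ∧ ω 1 = β ∧ ω 2 = β ∧ ω 3 = α ∧ ω 4 = β := by simp [hω]
  have v0 : vertexAngle (-α) ω 0 = -α := vertexAngle_zero _ _
  have v1 : vertexAngle (-α) ω 1 = α := by
    rw [show 1 = (0 : Fin 6).val + 1 from rfl, vertexAngle_succ, o.1]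
    change vertexAngle (-α) ω 0 + _ = _
    linarith
  have v2 : vertexAngle (-α) ω 2 = π / 2 := by
    rw [show 2 = (1 : Fin 6).val + 1 from rfl, vertexAngle_succ, o.2.1]
    change vertexAngle (-α) ω 1 + _ = _
    linarith
  have v3 : vertexAngle (-α) ω 3 = π - α := by
    rw [show 3 = (2 : Fin 6).val + 1 from rfl, vertexAngle_succ, o.2.2.1]
    change vertexAngle (-α) ω 2 + _ = _
    linarith
  have v4 : vertexAngle (-α) ω 4 = α + π := by
    rw [show 4 = (3 : Fin 6).val + 1 from rfl, vertexAngle_succ, o.2.2.2.1]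
    change vertexAngle (-α) ω 3 + _ = _
    linarith
  have v5 : vertexAngle (-α) ω 5 = π / 2 + π := by
    rw [show 5 = (4 : Fin 6).val + 1 from rfl, vertexAngle_succ, o.2.2.2.2]
    change vertexAngle (-α) ω 4 + _ = _
    linarith
  have w0 : vertex 0 R (-α) ω 0 =
      !₂[1 * (2 * R * sin β * cos β), (-1) * (R * (cos β ^ 2 - sin β ^ 2))] := by
    rw [vertex, show (0 : Fin 6).val = 0 from rfl, v0]
    refine plane_ext ?_ ?_ <;> simp [dir, hcos, hsin] <;> ring
  have w1 : vertex 0 R (-α) ω 1 =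
      !₂[1 * (2 * R * sin β * cos β), 1 * (R * (cos β ^ 2 - sin β ^ 2))] := by
    rw [vertex, show (1 : Fin 6).val = 1 from rfl, v1]
    refine plane_ext ?_ ?_ <;> simp [dir, hcos, hsin]
    ring
  have w2 : vertex 0 R (-α) ω 2 = !₂[0, 1 * R] := by
    rw [vertex, show (2 : Fin 6).val = 2 from rfl, v2]
    refine plane_ext ?_ ?_ <;> simp [dir]
  have w3 : vertex 0 R (-α) ω 3 =
      !₂[(-1) * (2 * R * sin β * cos β), 1 * (R * (cos β ^ 2 - sin β ^ 2))] := by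
    rw [vertex, show (3 : Fin 6).val = 3 from rfl, v3]
    refine plane_ext ?_ ?_ <;> simp [dir, hcos, hsin]
    ring
  have w4 : vertex 0 R (-α) ω 4 =
      !₂[(-1) * (2 * R * sin β * cos β), (-1) * (R * (cos β ^ 2 - sin β ^ 2))] := by
    rw [vertex, show (4 : Fin 6).val = 4 from rfl, v4]
    refine plane_ext ?_ ?_ <;> simp [dir, hcos, hsin] <;> ring
  have w5 : vertex 0 R (-α) ω 5 = !₂[0, (-1) * R] := by
    rw [vertex, show (5 : Fin 6).val = 5 from rfl, v5, dir_add_pi]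
    refine plane_ext ?_ ?_ <;> simp [dir]
  rw [cyclicPolygon_eq]
  have hsub := subset_convexHull ℝ (range (vertex 0 R (-α) ω))
  refine Subset.antisymm (convexHull_min ?_ (convex_hexagon hb ha)) ?_
  · have hpos : 0 < cos β ^ 2 - sin β ^ 2 := by
      rw [← cos_two_mul']
      exact cos_pos_of_mem_Ioo ⟨by linarith [hβ.1, pi_pos], hβ2⟩
    have hapex : ∀ τ : ℝ, |τ| = 1 → (!₂[0, τ * R] : Plane) ∈ hexagon R (sin β) (cos β) := by
      intro τ hτ
      constructor
      · simp; positivity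
      · simp [abs_mul, hτ, abs_of_pos hR]
    have hside : ∀ ε τ : ℝ, |ε| = 1 → |τ| = 1 → (!₂[ε * (2 * R * sin β * cos β),
        τ * (R * (cos β ^ 2 - sin β ^ 2))] : Plane) ∈ hexagon R (sin β) (cos β) := by
      intro ε τ hε hτ
      have hU : 0 < 2 * R * sin β * cos β := by positivity
      constructor
      · simp only [Matrix.cons_val_zero]
        rw [abs_mul, hε, one_mul, abs_of_pos hU]
      · simp only [Matrix.cons_val_zero, Matrix.cons_val_one]
        rw [abs_mul, hε, one_mul, abs_of_pos hU, abs_mul, hτ, one_mul, abs_of_pos (mul_pos hR hpos)]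
        refine le_of_eq ?_
        linear_combination R * cos β * hsq
    rintro _ ⟨k, rfl⟩
    fin_cases k
    · change vertex 0 R (-α) ω 0 ∈ _
      rw [w0]; exact hside 1 (-1) (by simp) (by simp)
    · change vertex 0 R (-α) ω 1 ∈ _
      rw [w1]; exact hside 1 1 (by simp) (by simp)
    · change vertex 0 R (-α) ω 2 ∈ _
      rw [w2]; exact hapex 1 (by simp)
    · change vertex 0 R (-α) ω 3 ∈ _
      rw [w3]; exact hside (-1) 1 (by simp) (by simp)
    · change vertex 0 R (-α) ω 4 ∈ _
      rw [w4]; exact hside (-1) (-1) (by simp) (by simp)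
    · change vertex 0 R (-α) ω 5 ∈ _
      rw [w5]; exact hapex (-1) (by simp)
  · refine hexagon_subset hR ha hb hsq (convex_convexHull ℝ _) ?_ ?_
    · intro τ hτ
      rcases eq_or_eq_neg_of_abs_eq hτ with rfl | rfl
      · rw [← w2]; exact hsub ⟨2, rfl⟩
      · rw [← w5]; exact hsub ⟨5, rfl⟩
    · intro ε τ hε hτ
      rcases eq_or_eq_neg_of_abs_eq hε with rfl | rfl <;>
        rcases eq_or_eq_neg_of_abs_eq hτ with rfl | rfl
      · rw [← w1]; exact hsub ⟨1, rfl⟩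
      · rw [← w0]; exact hsub ⟨0, rfl⟩
      · rw [← w3]; exact hsub ⟨3, rfl⟩
      · rw [← w4]; exact hsub ⟨4, rfl⟩

/-! ### Area and first moment of the hexagon -/

/-- The gauge of the hexagon in the direction `θ`. -/
noncomputable def hexGauge (R a b θ : ℝ) : ℝ :=
  max (|cos θ| / (2 * R * a * b)) ((a * |cos θ| + b * |sin θ|) / (b * R))

lemma smul_dir_mem_hexagon_iff {R a b ρ θ : ℝ} (hR : 0 < R) (ha : 0 < a) (hb : 0 < b)
    (hρ : 0 ≤ ρ) : ρ • dir θ ∈ hexagon R a b ↔ ρ * hexGauge R a b θ ≤ 1 := by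
  have h0 : (ρ • dir θ) 0 = ρ * cos θ := by simp [dir]
  have h1 : (ρ • dir θ) 1 = ρ * sin θ := by simp [dir]
  rw [hexGauge, mul_max_of_nonneg _ _ hρ, max_le_iff, ← mul_div_assoc, ← mul_div_assoc,
    div_le_one (by positivity), div_le_one (by positivity)]
  change |(ρ • dir θ) 0| ≤ _ ∧ a * |(ρ • dir θ) 0| + b * |(ρ • dir θ) 1| ≤ _ ↔ _
  rw [h0, h1, abs_mul, abs_mul, abs_of_nonneg hρ]
  have e : a * (ρ * |cos θ|) + b * (ρ * |sin θ|) = ρ * (a * |cos θ| + b * |sin θ|) := by ring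
  rw [e]

lemma continuous_hexGauge (R a b : ℝ) : Continuous (hexGauge R a b) := by
  unfold hexGauge
  fun_prop

lemma le_hexGauge {R a b : ℝ} (hR : 0 < R) (ha : 0 < a) (hb : 0 < b) (θ : ℝ) :
    1 / (2 * R * a * b + R) ≤ hexGauge R a b θ := by
  have h1 : 0 < hexGauge R a b θ := by
    rcases eq_or_ne (cos θ) 0 with h | h
    · refine lt_max_of_lt_right ?_
      have : sin θ ≠ 0 := fun h' => by
        have := sin_sq_add_cos_sq θ
        rw [h, h'] at this
        norm_num at this
      positivity
    · exact lt_max_of_lt_left (by positivity)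
  have h2 : (1 / hexGauge R a b θ) • dir θ ∈ hexagon R a b := by
    rw [smul_dir_mem_hexagon_iff hR ha hb (by positivity)]
    exact (div_mul_cancel₀ _ h1.ne').le
  have h3 := hexagon_subset_closedBall hb ha h2
  rw [mem_closedBall_zero_iff, norm_smul, norm_dir, mul_one, norm_eq_abs,
    abs_of_pos (by positivity)] at h3
  rw [div_le_iff₀ (by positivity)]
  rwa [div_le_iff₀ h1, mul_comm] at h3

lemma hexGauge_pos {R a b : ℝ} (hR : 0 < R) (ha : 0 < a) (hb : 0 < b) (θ : ℝ) :
    0 < hexGauge R a b θ := lt_of_lt_of_le (by positivity) (le_hexGauge hR ha hb θ)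

lemma isClosed_hexagon (R a b : ℝ) : IsClosed (hexagon R a b) := by
  have h : ∀ i, Continuous fun y : Plane => y i := fun i => by fun_prop
  have h0 : IsClosed {y : Plane | |y 0| ≤ 2 * R * a * b} := isClosed_le (h 0).abs continuous_const
  have h1 : IsClosed {y : Plane | a * |y 0| + b * |y 1| ≤ b * R} :=
    isClosed_le (((h 0).abs.const_mul a).add ((h 1).abs.const_mul b)) continuous_const
  exact h0.inter h1

/-- Integration along rays from the centre. -/
lemma setIntegral_norm_pow_hexagon_eq_integral_hexGauge {R a b : ℝ} (hR : 0 < R) (ha : 0 < a)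
    (hb : 0 < b) (k : ℕ) : ∫ y in hexagon R a b, ‖y‖ ^ k =
      (∫ θ in (-π)..π, (1 / hexGauge R a b θ) ^ (k + 2)) / (k + 2) := by
  set G := hexGauge R a b with hG
  have hGpos := hexGauge_pos hR ha hb
  set S : Set (ℝ × ℝ) := {p | p.1 * G p.2 ≤ 1} with hS
  have hSm : MeasurableSet S := by
    refine (isClosed_le ?_ continuous_const).measurableSet
    exact continuous_fst.mul ((continuous_hexGauge R a b).comp continuous_snd)
  have htarget : polarCoord.target = Ioi (0 : ℝ) ×ˢ Ioo (-π) π := rfl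
  have hint : IntegrableOn (S.indicator fun p : ℝ × ℝ => p.1 ^ (k + 1))
      (Ioi (0 : ℝ) ×ˢ Ioo (-π) π) := by
    rw [integrableOn_indicator_iff hSm]
    have hc : ContinuousOn (fun p : ℝ × ℝ => p.1 ^ (k + 1))
        (Icc 0 (2 * R * a * b + R) ×ˢ Icc (-π) π) := by fun_prop
    refine (hc.integrableOn_compact (isCompact_Icc.prod isCompact_Icc)).mono_set ?_
    rintro ⟨ρ, θ⟩ ⟨h1, h2, h3⟩
    refine ⟨⟨le_of_lt h2, ?_⟩, h3.1.le, h3.2.le⟩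
    have h4 := le_hexGauge hR ha hb θ
    have h5 : ρ * (1 / (2 * R * a * b + R)) ≤ 1 :=
      (mul_le_mul_of_nonneg_left h4 (le_of_lt h2)).trans h1
    rwa [mul_one_div, div_le_one (by positivity)] at h5
  rw [← integral_indicator (isClosed_hexagon R a b).measurableSet, ← integral_polar, htarget]
  have hcongr : ∫ p in Ioi (0 : ℝ) ×ˢ Ioo (-π) π,
      p.1 * (hexagon R a b).indicator (fun y => ‖y‖ ^ k) (p.1 • dir p.2) =
      ∫ p in Ioi (0 : ℝ) ×ˢ Ioo (-π) π, S.indicator (fun p : ℝ × ℝ => p.1 ^ (k + 1)) p := by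
    refine setIntegral_congr_fun (measurableSet_Ioi.prod measurableSet_Ioo) ?_
    rintro ⟨ρ, θ⟩ ⟨h1, -⟩
    have h1' : 0 ≤ ρ := le_of_lt h1
    have h2 : ρ • dir θ ∈ hexagon R a b ↔ (ρ, θ) ∈ S := smul_dir_mem_hexagon_iff hR ha hb h1'
    simp only
    by_cases h : ρ • dir θ ∈ hexagon R a b
    · rw [indicator_of_mem h, indicator_of_mem (h2.1 h), norm_smul, norm_dir, mul_one,
        norm_of_nonneg h1', pow_succ']
    · rw [indicator_of_notMem h, indicator_of_notMem (fun h' => h (h2.2 h')), mul_zero]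
  rw [Measure.volume_eq_prod ℝ ℝ] at hint
  rw [hcongr, Measure.volume_eq_prod ℝ ℝ, ← setIntegral_prod_swap, setIntegral_prod
      (fun z : ℝ × ℝ => S.indicator (fun p : ℝ × ℝ => p.1 ^ (k + 1)) z.swap) hint.swap,
    intervalIntegral.integral_of_le (by linarith [pi_pos]), integral_Ioc_eq_integral_Ioo,
    ← integral_div]
  refine setIntegral_congr_fun measurableSet_Ioo fun θ _ => ?_
  have hpos := hGpos θ
  calc ∫ ρ in Ioi (0 : ℝ), S.indicator (fun p : ℝ × ℝ => p.1 ^ (k + 1)) (ρ, θ)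
      = ∫ ρ in Ioi (0 : ℝ), (Iic (1 / G θ)).indicator (fun ρ => ρ ^ (k + 1)) ρ := by
        congr 1
        ext ρ
        have : (ρ, θ) ∈ S ↔ ρ ∈ Iic (1 / G θ) := by
          rw [mem_Iic, le_div_iff₀ hpos]
          rfl
        by_cases h : (ρ, θ) ∈ S
        · rw [indicator_of_mem h, indicator_of_mem (this.1 h)]
        · rw [indicator_of_notMem h, indicator_of_notMem (fun h' => h (this.2 h'))]
    _ = ∫ ρ in (0)..(1 / G θ), ρ ^ (k + 1) := by
        rw [setIntegral_indicator measurableSet_Iic, Ioi_inter_Iic,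
          intervalIntegral.integral_of_le (by positivity)]
    _ = _ := by
        rw [integral_pow]
        push_cast
        ring

/-- The hexagon is cut into two triangles with angle `2 α` and four with angle `2 β` at the
centre. -/
lemma setIntegral_norm_pow_hexagon {R α β : ℝ} (hR : 0 < R) (hα : α ∈ Ioo 0 (π / 2))
    (hβ : β ∈ Ioo 0 (π / 2)) (hsum : α + 2 * β = π / 2) (k : ℕ) :
    ∫ y in hexagon R (sin β) (cos β), ‖y‖ ^ k =
      (2 * (R * cos α) ^ (k + 2) * (∫ t in (-α)..α, 1 / cos t ^ (k + 2)) +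
        4 * (R * cos β) ^ (k + 2) * ∫ t in (-β)..β, 1 / cos t ^ (k + 2)) / (k + 2) := by
  have ha := sin_pos_of_mem hβ
  have hb := cos_pos_of_mem hβ
  have hsq := sin_sq_add_cos_sq β
  have hαβ : α = π / 2 - 2 * β := by linarith
  have hcos : cos α = 2 * sin β * cos β := by rw [hαβ, cos_pi_div_two_sub, sin_two_mul]
  have hsin : sin α = cos β ^ 2 - sin β ^ 2 := by rw [hαβ, sin_pi_div_two_sub, cos_two_mul']
  rw [setIntegral_norm_pow_hexagon_eq_integral_hexGauge hR ha hb]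
  congr 1
  -- by symmetry it suffices to integrate over the first quadrant, where a vertical side is visible
  -- up to the angle `α` and an oblique one beyond
  set J : ℝ → ℝ := fun θ => (1 / hexGauge R (sin β) (cos β) θ) ^ (k + 2) with hJ
  have hJc : Continuous J :=
    (continuous_const.div (continuous_hexGauge _ _ _) fun θ => (hexGauge_pos hR ha hb θ).ne').pow _
  have hJi : ∀ u v, IntervalIntegrable J volume u v := fun u v => hJc.intervalIntegrable u v
  have hneg : ∀ θ, J (-θ) = J θ := fun θ => by simp [hJ, hexGauge]
  have hrefl : ∀ θ, J (π - θ) = J θ := fun θ => by simp [hJ, hexGauge]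
  have h1 : ∫ θ in (-π)..0, J θ = ∫ θ in (0)..π, J θ := by
    have := intervalIntegral.integral_comp_neg (a := 0) (b := π) J
    simp only [hneg, neg_zero] at this
    exact this.symm
  have h2 : ∫ θ in (π / 2)..π, J θ = ∫ θ in (0)..(π / 2), J θ := by
    have := intervalIntegral.integral_comp_sub_left (a := 0) (b := π / 2) J π
    simp only [hrefl, sub_zero] at this
    rw [this]
    congr 1
    ring
  have h3 : ∫ θ in (-π)..π, J θ = 4 * ((∫ θ in (0)..α, J θ) + ∫ θ in α..(π / 2), J θ) := by
    rw [← intervalIntegral.integral_add_adjacent_intervals (hJi (-π) 0) (hJi 0 π), h1,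
      ← intervalIntegral.integral_add_adjacent_intervals (hJi 0 (π / 2)) (hJi (π / 2) π), h2,
      ← intervalIntegral.integral_add_adjacent_intervals (hJi 0 α) (hJi α (π / 2))]
    ring
  have h4 : ∫ θ in (0)..α, J θ = (R * cos α) ^ (k + 2) * ∫ θ in (0)..α, 1 / cos θ ^ (k + 2) := by
    rw [← intervalIntegral.integral_const_mul]
    refine intervalIntegral.integral_congr fun θ hθ => ?_
    rw [uIcc_of_le hα.1.le] at hθ
    have hc : 0 < cos θ := cos_pos_of_mem_Ioo ⟨by linarith [hθ.1, pi_pos], by linarith [hθ.2, hα.2]⟩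
    have hs : 0 ≤ sin θ := sin_nonneg_of_nonneg_of_le_pi hθ.1 (by linarith [hθ.2, hα.2, pi_pos])
    have hd : 0 ≤ sin (α - θ) :=
      sin_nonneg_of_nonneg_of_le_pi (by linarith [hθ.2]) (by linarith [hθ.1, hα.2, pi_pos])
    have hG : hexGauge R (sin β) (cos β) θ = cos θ / (R * cos α) := by
      rw [hexGauge, abs_of_pos hc, abs_of_nonneg hs, max_eq_left]
      · rw [hcos]; congr 1; ring
      · rw [div_le_div_iff₀ (by positivity) (by positivity)]
        rw [sin_sub, hsin, hcos] at hd
        have h5 := mul_nonneg (mul_pos hR hb).le hd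
        linear_combination h5 + R * cos β * cos θ * hsq
    simp only [hJ]
    rw [hG, one_div_div, div_pow]
    ring
  have h5 : ∫ θ in α..(π / 2), J θ =
      (R * cos β) ^ (k + 2) * ∫ θ in (-β)..β, 1 / cos θ ^ (k + 2) := by
    rw [← intervalIntegral.integral_const_mul]
    have e := intervalIntegral.integral_comp_sub_right (a := α) (b := π / 2)
      (fun t => (R * cos β) ^ (k + 2) * (1 / cos t ^ (k + 2))) (α + β)
    rw [show α - (α + β) = -β by ring, show π / 2 - (α + β) = β by linarith] at e
    rw [← e]
    refine intervalIntegral.integral_congr fun θ hθ => ?_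
    rw [uIcc_of_le hα.2.le] at hθ
    have hc : 0 ≤ cos θ := cos_nonneg_of_mem_Icc ⟨by linarith [hθ.1, hα.1, pi_pos], hθ.2⟩
    have hs : 0 ≤ sin θ :=
      sin_nonneg_of_nonneg_of_le_pi (by linarith [hθ.1, hα.1]) (by linarith [hθ.2, pi_pos])
    have hd : 0 ≤ sin (θ - α) :=
      sin_nonneg_of_nonneg_of_le_pi (by linarith [hθ.1]) (by linarith [hθ.2, hα.1, pi_pos])
    have hadd : cos (θ - (α + β)) = sin β * cos θ + cos β * sin θ := by
      rw [show θ - (α + β) = θ - (π / 2 - β) by linarith, cos_sub, cos_pi_div_two_sub,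
        sin_pi_div_two_sub]
      ring
    have hG : hexGauge R (sin β) (cos β) θ = cos (θ - (α + β)) / (R * cos β) := by
      rw [hexGauge, abs_of_nonneg hc, abs_of_nonneg hs, max_eq_right]
      · rw [hadd, mul_comm R]
      · rw [div_le_div_iff₀ (by positivity) (by positivity)]
        rw [sin_sub, hsin, hcos] at hd
        have h5 := mul_nonneg (mul_pos hR hb).le hd
        linear_combination h5 - R * cos β * cos θ * hsq
    simp only [hJ]
    rw [hG, one_div_div, div_pow]
    ring
  have h6 : ∫ θ in (-α)..α, 1 / cos θ ^ (k + 2) = 2 * ∫ θ in (0)..α, 1 / cos θ ^ (k + 2) := by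
    have hi : ∀ u ∈ Icc (-α) α, ∀ v ∈ Icc (-α) α,
        IntervalIntegrable (fun θ => 1 / cos θ ^ (k + 2)) volume u v := by
      intro u hu v hv
      refine ContinuousOn.intervalIntegrable fun θ hθ => ContinuousAt.continuousWithinAt ?_
      have hθ' := uIcc_subset_Icc hu hv hθ
      have : cos θ ≠ 0 :=
        (cos_pos_of_mem_Ioo ⟨by linarith [hθ'.1, hα.2], by linarith [hθ'.2, hα.2]⟩).ne'
      exact continuousAt_const.div (continuous_cos.continuousAt.pow _) (pow_ne_zero _ this)
    have m1 : -α ∈ Icc (-α) α := ⟨le_rfl, by linarith [hα.1]⟩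
    have m2 : α ∈ Icc (-α) α := ⟨by linarith [hα.1], le_rfl⟩
    have m3 : (0 : ℝ) ∈ Icc (-α) α := ⟨by linarith [hα.1], hα.1.le⟩
    rw [← intervalIntegral.integral_add_adjacent_intervals (hi _ m1 _ m3) (hi _ m3 _ m2)]
    have := intervalIntegral.integral_comp_neg (a := 0) (b := α) fun θ => 1 / cos θ ^ (k + 2)
    simp only [cos_neg, neg_zero] at this
    rw [← this]
    ring
  rw [h3, h4, h5, h6]
  ring

lemma area_hexagon {R α β : ℝ} (hR : 0 < R) (hα : α ∈ Ioo 0 (π / 2))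
    (hβ : β ∈ Ioo 0 (π / 2)) (hsum : α + 2 * β = π / 2) :
    area (hexagon R (sin β) (cos β)) = 2 * R ^ 2 * sin (2 * β) + R ^ 2 * sin (2 * α) := by
  have h := setIntegral_norm_pow_hexagon hR hα hβ hsum 0
  have key : ∀ θ ∈ Ioo 0 (π / 2), ∫ t in (-θ)..θ, 1 / cos t ^ (0 + 2) = 2 * (sin θ / cos θ) := by
    intro θ hθ
    have hd : ∀ t ∈ uIcc (-θ) θ, HasDerivAt tan (1 / cos t ^ (0 + 2)) t := by
      intro t ht
      rw [uIcc_of_le (by linarith [hθ.1])] at ht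
      exact hasDerivAt_tan
        (cos_pos_of_mem_Ioo ⟨by linarith [ht.1, hθ.2], by linarith [ht.2, hθ.2]⟩).ne'
    rw [intervalIntegral.integral_eq_sub_of_hasDerivAt hd, tan_neg, tan_eq_sin_div_cos]
    · ring
    · refine ContinuousOn.intervalIntegrable fun t ht => ContinuousAt.continuousWithinAt ?_
      rw [uIcc_of_le (by linarith [hθ.1])] at ht
      have : cos t ≠ 0 :=
        (cos_pos_of_mem_Ioo ⟨by linarith [ht.1, hθ.2], by linarith [ht.2, hθ.2]⟩).ne'
      exact continuousAt_const.div (continuous_cos.continuousAt.pow _) (pow_ne_zero _ this)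
  rw [key α hα, key β hβ] at h
  simp only [pow_zero] at h
  rw [setIntegral_const, smul_eq_mul, mul_one] at h
  have hca := (cos_pos_of_mem hα).ne'
  have hcb := (cos_pos_of_mem hβ).ne'
  rw [area, ← measureReal_def, h, sin_two_mul, sin_two_mul]
  field_simp
  ring

/-! ### The hexagonal layout -/

/-- The closed tour through `M + 1` points, summed over its edges. -/
lemma sum_inboundLength (x : ℕ → Plane) (M : ℕ) :
    ∑ i ∈ Finset.range (M + 1), inboundLength x (M + 1) i =
      (∑ i ∈ Finset.range M, ‖x (i + 1) - x i‖) + ‖x 0 - x M‖ := by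
  unfold inboundLength
  rw [← Finset.mul_sum, Finset.sum_add_distrib]
  have h1 : ∑ i ∈ Finset.range (M + 1), ‖x i - x ((i + (M + 1) - 1) % (M + 1))‖ =
      (∑ i ∈ Finset.range M, ‖x (i + 1) - x i‖) + ‖x 0 - x M‖ := by
    rw [Finset.sum_range_succ']
    congr 1
    · refine Finset.sum_congr rfl fun i hi => ?_
      have hi := Finset.mem_range.1 hi
      rw [show i + 1 + (M + 1) - 1 = i + (M + 1) by omega, Nat.add_mod_right,
        Nat.mod_eq_of_lt (by omega)]
    · rw [show 0 + (M + 1) - 1 = M by omega, Nat.mod_eq_of_lt (by omega)]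
  have h2 : ∑ i ∈ Finset.range (M + 1), ‖x i - x ((i + 1) % (M + 1))‖ =
      (∑ i ∈ Finset.range M, ‖x (i + 1) - x i‖) + ‖x 0 - x M‖ := by
    rw [Finset.sum_range_succ]
    congr 1
    · refine Finset.sum_congr rfl fun i hi => ?_
      have hi := Finset.mem_range.1 hi
      rw [Nat.mod_eq_of_lt (by omega), norm_sub_rev]
    · rw [Nat.mod_self, norm_sub_rev]
  rw [h1, h2]
  ring

lemma norm_latticePoint_le {R a b : ℝ} (hR : 0 < R) (ha : 0 < a) (hb : 0 < b) (q : ℤ × ℤ) :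
    ‖latticePoint R a b q‖ ≤ (4 * R * a * b + 2 * R * b ^ 2) * (q.1.natAbs + q.2.natAbs : ℕ) := by
  have h : ‖latticePoint R a b q‖ ≤ |latticePoint R a b q 0| + |latticePoint R a b q 1| := by
    rw [← sq_le_sq₀ (norm_nonneg _) (by positivity), norm_sq_plane]
    nlinarith [sq_abs (latticePoint R a b q 0), sq_abs (latticePoint R a b q 1),
      mul_nonneg (abs_nonneg (latticePoint R a b q 0)) (abs_nonneg (latticePoint R a b q 1))]
  refine h.trans ?_
  rw [latticePoint_zero, latticePoint_one, abs_mul, abs_mul (2 * R * b ^ 2),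
    abs_of_pos (show 0 < 4 * R * a * b by positivity),
    abs_of_pos (show 0 < 2 * R * b ^ 2 by positivity)]
  push_cast [Nat.cast_natAbs]
  have h1 : |(q.1 : ℝ) + q.2 / 2| ≤ |(q.1 : ℝ)| + |(q.2 : ℝ)| := by
    refine (abs_add_le _ _).trans ?_
    rw [abs_div, abs_two]
    linarith [abs_nonneg (q.2 : ℝ)]
  have h2 : |(q.2 : ℝ)| ≤ |(q.1 : ℝ)| + |(q.2 : ℝ)| := by linarith [abs_nonneg (q.1 : ℝ)]
  rw [add_mul]
  gcongr

/-- No two lattice points are closer than the horizontal neighbours. -/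
lemma le_norm_latticePoint {R a b : ℝ} (hR : 0 < R) (ha : 0 < a) (hab : a ≤ b)
    (hsq : a ^ 2 + b ^ 2 = 1) (ha2 : 2 * a ≤ 1) {q : ℤ × ℤ} (hq : q ≠ 0) :
    4 * R * a * b ≤ ‖latticePoint R a b q‖ := by
  have hb : 0 < b := ha.trans_le hab
  rw [← sq_le_sq₀ (by positivity) (norm_nonneg _), norm_sq_plane, latticePoint_zero,
    latticePoint_one]
  suffices key : a ^ 2 ≤ a ^ 2 * (q.1 + q.2 / 2 : ℝ) ^ 2 + b ^ 2 / 4 * (q.2 : ℝ) ^ 2 by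
    linear_combination 16 * R ^ 2 * b ^ 2 * key
  have h4 : a ^ 2 ≤ 1 / 4 := by nlinarith
  rcases int_cases q.1 q.2 with ⟨h0, -⟩ | ⟨h1, h2⟩ | h1
  · have ht : q.2 = 0 := by exact_mod_cast h0
    have hs : q.1 ≠ 0 := fun hs => hq (Prod.ext hs ht)
    have h5 : (1 : ℝ) ≤ (q.1 : ℝ) ^ 2 := by
      have : 0 < q.1 ^ 2 := by positivity
      exact_mod_cast this
    rw [h0]
    nlinarith [sq_nonneg a]
  · have h3 : (q.2 : ℝ) ^ 2 = 1 := by rw [← sq_abs, h1, one_pow]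
    rw [h3]
    nlinarith [sq_nonneg a]
  · have h3 : 4 ≤ (q.2 : ℝ) ^ 2 := by rw [← sq_abs]; nlinarith
    have h5 : a ^ 2 ≤ b ^ 2 := by gcongr
    nlinarith [mul_nonneg (sq_nonneg a) (sq_nonneg (q.1 + q.2 / 2 : ℝ)), sq_nonneg b]

/-- The hexagonal lattice, enumerated along the rows of growing rectangles. -/
noncomputable def hexLayout (R a b : ℝ) (i : ℕ) : Plane := latticePoint R a b (enum i)

lemma norm_hexLayout_sub_le {R a b : ℝ} (hR : 0 < R) (ha : 0 < a) (hb : 0 < b) (i j : ℕ) :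
    ‖hexLayout R a b i - hexLayout R a b j‖ ≤
      4 * R * a * b + (4 * R * a * b + 2 * R * b ^ 2) * excess (enum j) (enum i) := by
  unfold hexLayout excess
  rw [norm_sub_rev, ← latticePoint_sub]
  split_ifs with h
  · have h1 : enum j - enum i = ((enum j).1 - (enum i).1, 0) := Prod.ext rfl (sub_eq_zero.2 h.1)
    have h2 : (((enum j).1 - (enum i).1 : ℤ) : ℝ) ^ 2 = 1 := by
      have : ((enum j).1 - (enum i).1) ^ 2 = 1 := by rw [← Int.natAbs_sq, h.2]; norm_num
      exact_mod_cast this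
    rw [← sq_le_sq₀ (norm_nonneg _) (by positivity), norm_sq_plane, latticePoint_zero,
      latticePoint_one, h1]
    simp only [Int.cast_zero, zero_div, add_zero, mul_zero, Nat.cast_zero]
    rw [mul_pow, h2]
    simp
  · refine (norm_latticePoint_le hR ha hb _).trans ?_
    rw [Prod.fst_sub, Prod.snd_sub]
    have : 0 ≤ 4 * R * a * b := by positivity
    linarith

lemma le_norm_hexLayout_sub {R a b : ℝ} (hR : 0 < R) (ha : 0 < a) (hab : a ≤ b)
    (hsq : a ^ 2 + b ^ 2 = 1) (ha2 : 2 * a ≤ 1) {i j : ℕ} (hij : i ≠ j) :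
    4 * R * a * b ≤ ‖hexLayout R a b i - hexLayout R a b j‖ := by
  unfold hexLayout
  rw [← latticePoint_sub]
  exact le_norm_latticePoint hR ha hab hsq ha2 (sub_ne_zero.2 (enum_injective.ne hij))

/-- Almost all edges of the closed tour join horizontal neighbours. -/
lemma tendsto_inboundLength {R a b : ℝ} (hR : 0 < R) (ha : 0 < a) (hab : a ≤ b)
    (hsq : a ^ 2 + b ^ 2 = 1) (ha2 : 2 * a ≤ 1) :
    Tendsto (fun N : ℕ => (∑ i ∈ Finset.range N, inboundLength (hexLayout R a b) N i) / N) atTop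
      (𝓝 (4 * R * a * b)) := by
  have hb : 0 < b := ha.trans_le hab
  set d := 4 * R * a * b with hd
  set D := 4 * R * a * b + 2 * R * b ^ 2 with hD
  have hD0 : 0 ≤ D := by positivity
  have hlow : ∀ᶠ N : ℕ in atTop,
      d ≤ (∑ i ∈ Finset.range N, inboundLength (hexLayout R a b) N i) / N := by
    filter_upwards [eventually_ge_atTop 2] with N hN
    obtain ⟨M, rfl⟩ : ∃ M, N = M + 1 := ⟨N - 1, by omega⟩
    rw [sum_inboundLength, le_div_iff₀ (by positivity)]
    have h1 : M • d ≤ ∑ i ∈ Finset.range M, ‖hexLayout R a b (i + 1) - hexLayout R a b i‖ := by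
      have := Finset.card_nsmul_le_sum (Finset.range M)
        (fun i => ‖hexLayout R a b (i + 1) - hexLayout R a b i‖) d
        fun i _ => le_norm_hexLayout_sub hR ha hab hsq ha2 (by omega)
      rwa [Finset.card_range] at this
    have h2 : d ≤ ‖hexLayout R a b 0 - hexLayout R a b M‖ :=
      le_norm_hexLayout_sub hR ha hab hsq ha2 (by omega)
    rw [nsmul_eq_mul] at h1
    push_cast
    linarith
  have hup : ∀ᶠ N : ℕ in atTop,
      (∑ i ∈ Finset.range N, inboundLength (hexLayout R a b) N i) / N ≤ d + 77 * D / √N := by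
    filter_upwards [eventually_ge_atTop 1] with N hN
    obtain ⟨M, rfl⟩ : ∃ M, N = M + 1 := ⟨N - 1, by omega⟩
    have hpos : (0 : ℝ) < (M + 1 : ℕ) := by positivity
    have h1 : ∑ i ∈ Finset.range M, ‖hexLayout R a b (i + 1) - hexLayout R a b i‖ ≤
        M * d + D * (∑ i ∈ Finset.range M, excess (enum i) (enum (i + 1)) : ℕ) := by
      refine (Finset.sum_le_sum fun i _ => norm_hexLayout_sub_le hR ha hb (i + 1) i).trans ?_
      rw [Finset.sum_add_distrib, Finset.sum_const, Finset.card_range, nsmul_eq_mul,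
        ← Finset.mul_sum, Nat.cast_sum]
    have h2 := norm_hexLayout_sub_le hR ha hb 0 M
    have h3 := excess_enum_zero_le (N := M + 1) (by omega)
    have h4 := sum_excess_le (N := M + 1) (by omega)
    rw [Nat.add_sub_cancel] at h3
    rw [Finset.sum_range_succ, Nat.cast_add] at h4
    have h5 : (0 : ℝ) ≤ excess (enum M) (enum (M + 1)) := Nat.cast_nonneg _
    have h6 : 77 * D / √((M + 1 : ℕ) : ℝ) * ((M + 1 : ℕ) : ℝ) = D * (77 * √((M + 1 : ℕ) : ℝ)) := by
      have hs : 0 < √((M + 1 : ℕ) : ℝ) := Real.sqrt_pos.2 hpos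
      rw [div_mul_eq_mul_div, div_eq_iff hs.ne']
      linear_combination -77 * D * Real.mul_self_sqrt hpos.le
    rw [sum_inboundLength, div_le_iff₀ hpos, add_mul, h6]
    have h8 : (∑ i ∈ Finset.range M, excess (enum i) (enum (i + 1)) : ℕ) +
        (excess (enum M) (enum 0) : ℝ) ≤ 77 * √((M + 1 : ℕ) : ℝ) := by linarith
    have h7 : D * ((∑ i ∈ Finset.range M, excess (enum i) (enum (i + 1)) : ℕ) +
        (excess (enum M) (enum 0) : ℝ)) ≤ D * (77 * √((M + 1 : ℕ) : ℝ)) :=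
      mul_le_mul_of_nonneg_left h8 hD0
    push_cast at h1 h2 h7 ⊢
    linarith
  have hlim : Tendsto (fun N : ℕ => d + 77 * D / √N) atTop (𝓝 d) := by
    have h : Tendsto (fun N : ℕ => 77 * D / √N) atTop (𝓝 0) :=
      tendsto_const_nhds.div_atTop (tendsto_sqrt_atTop.comp tendsto_natCast_atTop_atTop)
    simpa using tendsto_const_nhds.add h
  exact tendsto_of_tendsto_of_tendsto_of_le_of_le' tendsto_const_nhds hlim hlow hup

lemma serviceRegion_hexLayout {R a b : ℝ} (hR : 0 < R) (ha : 0 < a) (hab : a ≤ b)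
    (hsq : a ^ 2 + b ^ 2 = 1) (i : ℕ) :
    serviceRegion (hexLayout R a b) i =
      (fun y => y - hexLayout R a b i) ⁻¹' hexagon R a b := by
  ext y
  rw [mem_preimage, mem_hexagon_iff hR ha hab hsq]
  constructor
  · intro h q
    obtain ⟨j, hj⟩ := enum_bijective.2 (q + enum i)
    have h1 := h j
    have h2 : latticePoint R a b q = hexLayout R a b j - hexLayout R a b i := by
      rw [hexLayout, hexLayout, ← latticePoint_sub, hj, add_sub_cancel_right]
    rwa [h2, sub_sub_sub_cancel_right]
  · intro h j
    have h1 := h (enum j - enum i)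
    rwa [latticePoint_sub, ← hexLayout, ← hexLayout, sub_sub_sub_cancel_right] at h1

/-- The Voronoi cells of a locally finite sequence cover the plane. -/
lemma iUnion_serviceRegion {x : ℕ → Plane} (hx : ∀ ρ : ℝ, {i | ‖x i‖ ≤ ρ}.Finite) :
    (⋃ i, serviceRegion x i) = univ := by
  refine eq_univ_of_forall fun y => mem_iUnion.2 ?_
  have hfin : {i | ‖y - x i‖ ≤ ‖y - x 0‖}.Finite := by
    refine (hx (‖y‖ + ‖y - x 0‖)).subset fun i (hi : ‖y - x i‖ ≤ ‖y - x 0‖) => ?_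
    have := norm_sub_norm_le (x i) y
    rw [norm_sub_rev] at this
    change ‖x i‖ ≤ _
    linarith
  obtain ⟨i, hi, hmin⟩ := hfin.toFinset.exists_min_image (fun i => ‖y - x i‖) ⟨0, by simp⟩
  refine ⟨i, fun j => ?_⟩
  by_cases hj : ‖y - x j‖ ≤ ‖y - x 0‖
  · exact hmin j (by simpa using hj)
  · have h1 : ‖y - x i‖ ≤ ‖y - x 0‖ := by simpa using hi
    linarith

lemma isLayout_hexLayout {R a b : ℝ} (hR : 0 < R) (ha : 0 < a) (hab : a ≤ b)
    (hsq : a ^ 2 + b ^ 2 = 1) : IsLayout (hexLayout R a b) := by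
  have hb : 0 < b := ha.trans_le hab
  have hinj : Function.Injective (hexLayout R a b) := by
    refine Function.Injective.comp ?_ enum_injective
    intro p q h
    have h1 := congrArg (fun y : Plane => y 1) h
    simp only [latticePoint_one] at h1
    have h2 : (p.2 : ℝ) = q.2 := mul_left_cancel₀ (by positivity) h1
    have h0 := congrArg (fun y : Plane => y 0) h
    simp only [latticePoint_zero] at h0
    have h3 : (p.1 + p.2 / 2 : ℝ) = q.1 + q.2 / 2 := mul_left_cancel₀ (by positivity) h0
    rw [h2, add_left_inj] at h3
    exact Prod.ext (by exact_mod_cast h3) (by exact_mod_cast h2)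
  have hloc : ∀ ρ : ℝ, {i | ‖hexLayout R a b i‖ ≤ ρ}.Finite := by
    intro ρ
    have hc : 0 < 4 * R * a * b := by positivity
    have hc' : 0 < 2 * R * b ^ 2 := by positivity
    set K := ρ / (4 * R * a * b) + ρ / (2 * R * b ^ 2) with hK
    have hfin : {q : ℤ × ℤ | ‖latticePoint R a b q‖ ≤ ρ}.Finite := by
      refine ((finite_Icc (-⌈K⌉) ⌈K⌉).prod (finite_Icc (-⌈K⌉) ⌈K⌉)).subset ?_
      intro q (hq : ‖latticePoint R a b q‖ ≤ ρ)
      have hρ : 0 ≤ ρ := (norm_nonneg _).trans hq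
      have h0 := (PiLp.norm_apply_le (latticePoint R a b q) 0).trans hq
      have h1 := (PiLp.norm_apply_le (latticePoint R a b q) 1).trans hq
      rw [latticePoint_zero, norm_eq_abs, abs_mul, abs_of_pos hc, mul_comm, ← le_div_iff₀ hc] at h0
      rw [latticePoint_one, norm_eq_abs, abs_mul, abs_of_pos hc', mul_comm, ← le_div_iff₀ hc'] at h1
      have h2 : |(q.2 : ℝ)| ≤ K := h1.trans (by rw [hK]; linarith [div_nonneg hρ hc.le])
      have h3 : |(q.1 : ℝ)| ≤ K := by
        have e : (q.1 : ℝ) = (q.1 + q.2 / 2) - q.2 / 2 := by ring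
        rw [e]
        refine (abs_sub _ _).trans ?_
        rw [abs_div, abs_two]
        linarith [abs_nonneg (q.2 : ℝ)]
      have hmem : ∀ z : ℤ, |(z : ℝ)| ≤ K → z ∈ Icc (-⌈K⌉) ⌈K⌉ := by
        intro z hz
        have h4 : ((|z| : ℤ) : ℝ) ≤ (⌈K⌉ : ℝ) := by
          push_cast
          exact hz.trans (Int.le_ceil K)
        exact abs_le.1 (by exact_mod_cast h4)
      exact ⟨hmem _ h3, hmem _ h2⟩
    exact hfin.preimage enum_injective.injOn
  refine ⟨hinj, hloc, iUnion_serviceRegion hloc, fun i => ?_⟩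
  rw [serviceRegion_hexLayout hR ha hab hsq]
  refine (Metric.isBounded_closedBall (x := hexLayout R a b i)
    (r := 2 * R * a * b + R)).subset fun y hy => ?_
  have := hexagon_subset_closedBall hb ha hy
  rwa [mem_closedBall_zero_iff, ← dist_eq_norm] at this

lemma layoutCost_hexLayout {κ f r R a b : ℝ} (hR : 0 < R) (ha : 0 < a) (hab : a ≤ b)
    (hsq : a ^ 2 + b ^ 2 = 1) {N : ℕ} (hN : N ≠ 0) :
    layoutCost κ f r (hexLayout R a b) N =
      f / area (hexagon R a b) * (1 + κ * ∫ y in hexagon R a b, ‖y‖) +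
        κ * r * f * ((∑ i ∈ Finset.range N, inboundLength (hexLayout R a b) N i) / N) := by
  have harea : ∀ i, area (serviceRegion (hexLayout R a b) i) = area (hexagon R a b) := by
    intro i
    rw [serviceRegion_hexLayout hR ha hab hsq, area, area,
      (measurePreserving_sub_right volume (hexLayout R a b i)).measure_preimage
        (isClosed_hexagon R a b).measurableSet.nullMeasurableSet]
  have hint : ∀ i, ∫ y in serviceRegion (hexLayout R a b) i, ‖y - hexLayout R a b i‖ =
      ∫ y in hexagon R a b, ‖y‖ := by
    intro i
    rw [serviceRegion_hexLayout hR ha hab hsq]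
    exact (measurePreserving_sub_right volume (hexLayout R a b i)).setIntegral_preimage_emb
      (MeasurableEquiv.subRight (hexLayout R a b i)).measurableEmbedding (fun y => ‖y‖) _
  unfold layoutCost
  simp only [harea, hint, Finset.sum_const, Finset.card_range, nsmul_eq_mul]
  have hN' : (N : ℝ) ≠ 0 := Nat.cast_ne_zero.2 hN
  congr 1
  · rw [← mul_assoc, mul_comm (N : ℝ) (area _), ← div_div, div_mul_cancel₀ _ hN']
  · ring

/-- Lattice translates of the cyclic hexagon with the optimal angles and area `a*` are the Voronoi
cells of a layout with cost `z_ub*`. -/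
lemma exists_hexagonal_layout {κ f r : ℝ} (hκ : 0 < κ) (hf : 0 < f) (hr : 0 ≤ r) :
    ∃ (x : ℕ → Plane) (φ : ℝ), IsLayout x ∧
      (∀ i, serviceRegion x i = cyclicPolygon (x i) (radiusStar 6 r (hexArea κ r)) φ
        (optimalAngles r 6 0 3)) ∧
      (∀ i, area (serviceRegion x i) = hexArea κ r) ∧
      Tendsto (layoutCost κ f r x) atTop (𝓝 (zUb κ f r)) := by
  have hA := hexArea_pos hκ hr
  have hn : (2 : ℝ) < 6 := by norm_num
  have hα := alphaStar_mem hn hr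
  have hβ := betaStar_mem hn hr
  have hle := betaStar_le_alphaStar hn hr
  have hmul := betaStar_mul r hn
  have hadm := isAdmissible_star (n := 6) (by norm_num) hr hA
  have hcost := regionCost_star (κ := κ) (f := f) (n := 6) (by norm_num) hr hA
  push_cast at hadm hcost
  have hR := hadm.radius_pos
  have hareaA := hadm.area_eq
  push_cast at hareaA
  have hω : optimalAngles r 6 0 3 = ![alphaStar 6 r, betaStar 6 r, betaStar 6 r, alphaStar 6 r,
      betaStar 6 r, betaStar 6 r] := by
    funext i
    fin_cases i <;> simp [optimalAngles]
  set α := alphaStar 6 r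
  set β := betaStar 6 r
  set R := radiusStar 6 r (hexArea κ r)
  have hsum : α + 2 * β = π / 2 := by linarith
  have ha := sin_pos_of_mem hβ
  have hb := cos_pos_of_mem hβ
  have hsq := sin_sq_add_cos_sq β
  have hcos : cos α = 2 * sin β * cos β := by
    rw [show α = π / 2 - 2 * β by linarith, cos_pi_div_two_sub, sin_two_mul]
  have ha2 : 2 * sin β ≤ 1 := by
    have h : cos α ≤ cos β := cos_le_cos_of_nonneg_of_le_pi hβ.1.le (by linarith [hα.2, pi_pos]) hle
    rw [hcos] at h
    exact le_of_mul_le_mul_right (by linarith) hb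
  have hab : sin β ≤ cos β := by nlinarith
  have hhex := hexagon_eq_cyclicPolygon hR hβ (by linarith [hα.1]) hsum hω
  have harea : area (hexagon R (sin β) (cos β)) = hexArea κ r := by
    rw [area_hexagon hR hα hβ hsum, ← hareaA]
    ring
  have hcell := serviceRegion_hexLayout hR ha hab hsq
  refine ⟨hexLayout R (sin β) (cos β), -α, isLayout_hexLayout hR ha hab hsq, fun i => ?_,
    fun i => ?_, ?_⟩
  · have h := image_add_right_cyclicPolygon 0 (hexLayout R (sin β) (cos β) i) R (-α)
      (optimalAngles r 6 0 3)
    rw [zero_add] at h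
    rw [hcell, ← h, hhex]
    simp [image_add_right, sub_eq_add_neg]
  · rw [hcell, area, (measurePreserving_sub_right volume _).measure_preimage
      (isClosed_hexagon R _ _).measurableSet.nullMeasurableSet, ← harea, area]
  · have hlim : f / area (hexagon R (sin β) (cos β)) *
        (1 + κ * ∫ y in hexagon R (sin β) (cos β), ‖y‖) + κ * r * f * (4 * R * sin β * cos β) =
        zUb κ f r := by
      have hI := setIntegral_norm_pow_hexagon hR hα hβ hsum 1
      simp only [pow_one] at hI
      rw [← hexArea_cost hκ hf hr, ← hcost, regionCost, harea, hI, hcos]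
      field_simp
      push_cast
      ring
    rw [← hlim]
    refine (((tendsto_inboundLength hR ha hab hsq ha2).const_mul (κ * r * f)).const_add _).congr' ?_
    filter_upwards [eventually_ne_atTop 0] with N hN
    exact (layoutCost_hexLayout hR ha hab hsq hN).symm

lemma nonneg_of_mem_achievableCosts {κ f r z : ℝ} (hκ : 0 < κ) (hf : 0 < f) (hr : 0 ≤ r)
    (hz : z ∈ achievableCosts κ f r) : 0 ≤ z := by
  obtain ⟨x, -, hx⟩ := hz
  refine ge_of_tendsto' hx fun N => ?_
  have h1 : ∀ S, 0 ≤ area S := fun S => ENNReal.toReal_nonneg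
  have h2 : ∀ i, 0 ≤ ∫ y in serviceRegion x i, ‖y - x i‖ :=
    fun i => integral_nonneg fun y => norm_nonneg _
  have h3 : ∀ i, 0 ≤ inboundLength x N i := fun i => by unfold inboundLength; positivity
  refine add_nonneg (mul_nonneg (div_nonneg hf.le (Finset.sum_nonneg fun i _ => h1 _))
    (Finset.sum_nonneg fun i _ => ?_)) (mul_nonneg (by positivity)
      (Finset.sum_nonneg fun i _ => h3 i))
  have := mul_nonneg hκ.le (h2 i)
  linarith

end Transshipment

theorem mainTheorem3 (κ f r : ℝ) (hκ : 0 < κ) (hf : 0 < f) (hr : 0 ≤ r) :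
    -- `H(n, r, ·)` has exactly one root in `[π / n, π / 2)`, so `α*` and `g` are well defined
    (∀ n : ℝ, 3 ≤ n →
      (∃! α : ℝ, α ∈ Set.Ico (Real.pi / n) (Real.pi / 2) ∧ H n r α = 0) ∧ 0 < g n r) ∧
    -- the optimal parameters minimize the cost of a cyclic polygon with given area
    (∀ (n : ℕ) (A : ℝ), 3 ≤ n → 0 < A →
      IsAdmissible n A (alphaStar n r) (betaStar n r) (radiusStar n r A) ∧
      regionCost κ f r n A (alphaStar n r) (betaStar n r) (radiusStar n r A)
        = κ * f * √A / g n r ∧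
      ∀ α β R : ℝ, IsAdmissible n A α β R → κ * f * √A / g n r ≤ regionCost κ f r n A α β R) ∧
    -- lower bound on the averaged cost through the average number of sides
    (∀ (N : ℕ) (n : Fin N → ℕ) (a : Fin N → ℝ), 1 ≤ N → (∀ i, 3 ≤ n i) → (∀ i, 0 < a i) →
      costBound r Finset.univ a (meanSides Finset.univ n) ≤ averagedCost r Finset.univ n a) ∧
    -- polygons forming a partition of the plane, periodic with `N` polygons per period
    (∀ (N : ℕ) (n : Fin N → ℕ) (P : Fin N → Set Plane) (u v : Plane),
      1 ≤ N → (∀ i, 3 ≤ n i) → (∀ i, IsOptimalCyclicPolygon r (n i) (P i)) →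
      LinearIndependent ℝ ![u, v] →
      IsPlanePartition (fun q : Fin N × ℤ × ℤ =>
        (fun y => y + ((q.2.1 : ℝ) • u + (q.2.2 : ℝ) • v)) '' P q.1) →
      costBound r Finset.univ (fun i => area (P i)) (meanSides Finset.univ n)
        ≤ averagedCost r Finset.univ n (fun i => area (P i)) ∧
      costBound r Finset.univ (fun i => area (P i)) 6
        ≤ costBound r Finset.univ (fun i => area (P i)) (meanSides Finset.univ n) ∧
      zUb κ f r ≤ totalCost κ f r Finset.univ n (fun i => area (P i))) ∧
    -- polygons forming an arbitrary partition of the plane, asymptotically over large discs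
    (∀ (ι : Type) (n : ι → ℕ) (P : ι → Set Plane) (c C : ℝ),
      (∀ i, 3 ≤ n i) → (∀ i, IsOptimalCyclicPolygon r (n i) (P i)) →
      0 < c → (∀ i, c ≤ area (P i) ∧ area (P i) ≤ C) → IsPlanePartition P →
      ∀ ε : ℝ, 0 < ε → ∃ ρ₀ : ℝ, ∀ ρ : ℝ, ρ₀ ≤ ρ →
        ∃ T : Finset ι, (∀ i, i ∈ T ↔ P i ⊆ Metric.closedBall 0 ρ) ∧ T.Nonempty ∧
          costBound r T (fun i => area (P i)) (meanSides T n)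
            ≤ averagedCost r T n (fun i => area (P i)) ∧
          (1 - ε) * costBound r T (fun i => area (P i)) 6
            ≤ costBound r T (fun i => area (P i)) (meanSides T n) ∧
          (1 - ε) * zUb κ f r ≤ totalCost κ f r T n (fun i => area (P i))) ∧
    -- equality for hexagons
    (∀ (N : ℕ) (n : Fin N → ℕ) (a : Fin N → ℝ), 1 ≤ N → (∀ i, n i = 6) → (∀ i, 0 < a i) →
      costBound r Finset.univ a (meanSides Finset.univ n) = costBound r Finset.univ a 6 ∧
      ((∀ i j, a i = a j) →
        averagedCost r Finset.univ n a = costBound r Finset.univ a 6) ∧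
      ((∀ i, a i = hexArea κ r) → totalCost κ f r Finset.univ n a = zUb κ f r)) ∧
    -- identical cyclic hexagons are a feasible layout of cost `z_ub*`
    (∃ (x : ℕ → Plane) (φ : ℝ), IsLayout x ∧
      (∀ i, serviceRegion x i = cyclicPolygon (x i) (radiusStar 6 r (hexArea κ r)) φ
        (optimalAngles r 6 0 3)) ∧
      (∀ i, area (serviceRegion x i) = hexArea κ r) ∧
      Filter.Tendsto (layoutCost κ f r x) Filter.atTop (nhds (zUb κ f r))) ∧
    BddBelow (achievableCosts κ f r) ∧
    optimalCost κ f r ≤ zUb κ f r := by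
  refine ⟨fun n hn => ⟨existsUnique_root (by linarith) hr, g_pos (by linarith) hr⟩,
    fun n A hn hA => ⟨isAdmissible_star hn hr hA, regionCost_star hn hr hA,
      fun α β R h => le_regionCost hκ hf hn hr h⟩,
    fun N n a hN hn ha => costBound_le_averagedCost hr _ n a ⟨⟨0, hN⟩, Finset.mem_univ _⟩
      (fun i _ => hn i) (fun i _ => ha i),
    fun N n P u v hN hn hP _ hpart => periodic_bounds hκ hf hr N n P u v hN hn hP hpart,
    fun ι n P c C hn hP hc hA hpart ε hε =>
      partition_bounds hκ hf hr ι n P c C hn hP hc hA hpart ε hε,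
    fun N n a hN hn ha => hexagons_equality hκ hf hr N n a hN hn ha,
    exists_hexagonal_layout hκ hf hr, ?_, ?_⟩
  · exact ⟨0, fun z hz => nonneg_of_mem_achievableCosts hκ hf hr hz⟩
  · obtain ⟨x, -, hx, -, -, hlim⟩ := exists_hexagonal_layout hκ hf hr
    exact csInf_le ⟨0, fun z hz => nonneg_of_mem_achievableCosts hκ hf hr hz⟩ ⟨x, hx, hlim⟩
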